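/- Let $f:(\mathbb C^d,0)\to(\mathbb C^d,0)$ be a holomorphic germ that is contracting (every eigenvalue $\lambda$ of $df_0$ satisfies $|\lambda|<1$) and rigid, i.e. its generalized critical set $\mathcal C^\infty(f)=\bigcup_{n\ge 0}f^{-n}\{\det df=0\}$ has simple normal crossings at the origin: in suitable local holomorphic coordinates it is a (possibly empty) union of coordinate hyperplanes. For vectors $x\in\mathbb C^m$ and a matrix $M\in\mathcal M(m\times n,\mathbb N)$ write $x^M\in\mathbb C^n$ for the vector with $k$-th coordinate $\prod_{l}(x^l)^{M_{lk}}$; products of vectors of equal length are taken coordinatewise, and $\mathbb 1=(1,\dots,1)$. Let $s$ be the number of non-zero eigenvalues of $df_0$ counted with algebraic multiplicity (the rank of $(df_0)^d$), and $\mathbb D^*=\{0<|\zeta|<1\}$. Theorem. There are $r,e,p,t\in\mathbb N$ with $r+e=s$ and $r+e+p+t=d$ such that $f$ is analytically conjugated to a germ $$F:(u,v,y,z)\mapsto\Big(\alpha\,u^B,\ \mu v+\rho(u,v),\ \beta\,u^Cy^D\big(\mathbb 1+g(u,v,y,z)\big),\ h(u,v,y,z)\Big)$$ of $\mathbb C^r\times\mathbb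 C^e\times\mathbb C^p\times\mathbb C^t$ at $0$, where - $\alpha\in(\mathbb C^*)^r$, $\mu\in(\mathbb D^*)^e$, $\beta\in(\mathbb C^*)^p$; - $B\in\mathcal M(r\times r,\mathbb N)$ is a permutation matrix, $C\in\mathcal M(r\times p,\mathbb N)$, $D\in\mathcal M(p\times p,\mathbb N)$, and no hyperplane $\{y^j=0\}$ is periodic: for $A=\begin{pmatrix}B&C\\0&D\end{pmatrix}$ and all $m\ge1$, the column of $A^m$ indexed by $y^j$ is not the corresponding standard basis vector; - $\rho:(\mathbb C^s,0)\to(\mathbb C^e,0)$ is polynomial, and $g:(\mathbb C^d,0)\to(\mathbb C^p,0)$, $h:(\mathbb C^d,0)\to(\mathbb C^t,0)$ are holomorphic germs; - $\mathcal C^\infty(F)=\{u^1\cdots u^r\,y^1\cdots y^p=0\}$ as germs at $0$; - every $\mu^k$ is a (non-zero) eigenvalue of $df_0$, and $h|_{\{u=v=y=0\}}$ and $\rho|_{\{u=0\}}$ have nilpotent linear part at $0$; - $\rho$ contains only primary resonant monomials: if $\eta\ge1$ is the order of $B$, then the $\eta$-th iterate of $u\mapsto\alpha u^B$ is diagonal,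 $u\mapsto\xi u$ with $\xi\in(\mathbb D^*)^r$, and every monomial $u^{n_u}v^{n_v}$ with non-zero coefficient in the $k$-th coordinate $\rho^k$ satisfies $$\xi^{n_u}\mu^{\eta n_v}=(\mu^k)^\eta .$$ -/

import Mathlib

open Filter Topology

namespace RigidGerm

/-- The generalized critical set `⋃ₙ f⁻ⁿ(Crit f)`, where `Crit f = {det df = 0}`.  Only its germ at
`0` is ever used.  For a contracting germ the point `0` has a basis of neighbourhoods that `f` maps
into themselves, so this germ does not depend on the chosen representative of the germ `f`. -/
def generalizedCriticalSet {E : Type*} [NormedAddCommGroup E] [NormedSpace ℂ E]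
    (f : E → E) : Set E :=
  {x | ∃ n : ℕ, (fderiv ℂ f (f^[n] x)).det = 0}

/-- `Φ` is (a representative of) a germ of biholomorphism `(E, 0) → (E', 0)`. -/
structure IsBiholomorphicGerm {E E' : Type*} [NormedAddCommGroup E] [NormedSpace ℂ E]
    [NormedAddCommGroup E'] [NormedSpace ℂ E'] (Φ : E → E') : Prop where
  analyticAt : AnalyticAt ℂ Φ 0
  map_zero : Φ 0 = 0
  invertible : ∃ L : E ≃L[ℂ] E', HasFDerivAt Φ (L : E →L[ℂ] E') 0

/-- The germ at `0` of `S` has simple normal crossings: in suitable holomorphic coordinates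
at `0` it is a union of (finitely many, possibly no) coordinate hyperplanes. -/
def HasSimpleNormalCrossings {d : ℕ} (S : Set (Fin d → ℂ)) : Prop :=
  ∃ (Φ : (Fin d → ℂ) → (Fin d → ℂ)) (I : Finset (Fin d)),
    IsBiholomorphicGerm Φ ∧ ∀ᶠ x in 𝓝 (0 : Fin d → ℂ), (x ∈ S ↔ ∃ i ∈ I, Φ x i = 0)

/-- `f` represents a contracting rigid germ `(ℂᵈ, 0) → (ℂᵈ, 0)`. -/
structure IsContractingRigidGerm {d : ℕ} (f : (Fin d → ℂ) → (Fin d → ℂ)) : Prop where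
  analyticAt : AnalyticAt ℂ f 0
  map_zero : f 0 = 0
  contracting : ∀ a : ℂ,
    Module.End.HasEigenvalue (fderiv ℂ f 0 : (Fin d → ℂ) →ₗ[ℂ] (Fin d → ℂ)) a → ‖a‖ < 1
  rigid : HasSimpleNormalCrossings (generalizedCriticalSet f)

/-- Germs `f` at `0 ∈ E` and `F` at `0 ∈ E'` are analytically conjugated. -/
def AnalyticallyConjugated {E E' : Type*} [NormedAddCommGroup E] [NormedSpace ℂ E]
    [NormedAddCommGroup E'] [NormedSpace ℂ E'] (f : E → E) (F : E' → E') : Prop :=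
  ∃ Φ : E → E', IsBiholomorphicGerm Φ ∧ ∀ᶠ x in 𝓝 (0 : E), Φ (f x) = F (Φ x)

/-- `x ^ M`: its `k`-th coordinate is `∏ₗ (x l) ^ (M l k)`. -/
def matPow {m n : ℕ} (x : Fin m → ℂ) (M : Matrix (Fin m) (Fin n) ℕ) : Fin n → ℂ :=
  fun k => ∏ l, x l ^ M l k

/-- `B` is a permutation matrix. -/
def IsPermutationMatrix {r : ℕ} (B : Matrix (Fin r) (Fin r) ℕ) : Prop :=
  ∃ σ : Equiv.Perm (Fin r), B = σ.permMatrix ℕ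

/-- The space `ℂʳ × ℂᵉ × ℂᵖ × ℂᵗ` of the coordinates `(u, v, y, z)`. -/
abbrev Coord (r e p t : ℕ) : Type :=
  (Fin r → ℂ) × (Fin e → ℂ) × (Fin p → ℂ) × (Fin t → ℂ)

/-- The map `(u, v, y, z) ↦ (α u^B, μ v + ρ(u, v), β u^C y^D (1 + g), h)`. -/
noncomputable def normalForm {r e p t : ℕ}
    (α : Fin r → ℂ) (μ : Fin e → ℂ) (β : Fin p → ℂ)
    (B : Matrix (Fin r) (Fin r) ℕ) (C : Matrix (Fin r) (Fin p) ℕ) (D : Matrix (Fin p) (Fin p) ℕ)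
    (ρ : Fin e → MvPolynomial (Fin r ⊕ Fin e) ℂ)
    (g : Coord r e p t → (Fin p → ℂ)) (h : Coord r e p t → (Fin t → ℂ)) :
    Coord r e p t → Coord r e p t :=
  fun x =>
    (fun i => α i * matPow x.1 B i,
     fun k => μ k * x.2.1 k + MvPolynomial.eval (Sum.elim x.1 x.2.1) (ρ k),
     fun j => β j * matPow x.1 C j * matPow x.2.2.1 D j * (1 + g x j),
     h x)

/-- `ξ` is the vector of eigenvalues of the `η`-th iterate of `u ↦ α u^B`, `η` being the order
of `B`; this iterate is diagonal, and `ξ i` is the eigenvalue along the `i`-th coordinate. -/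
def IsIterateEigenvalues {r : ℕ} (α : Fin r → ℂ) (B : Matrix (Fin r) (Fin r) ℕ)
    (ξ : Fin r → ℂ) : Prop :=
  ∀ u : Fin r → ℂ, (fun w : Fin r → ℂ => fun i => α i * matPow w B i)^[orderOf B] u
    = fun i => ξ i * u i

/-- The monomial `u^{n_u} v^{n_v}` is primary resonant with respect to the `k`-th coordinate of `v`:
`ξ^{n_u} μ^{η n_v} = (μ k)^η`. -/
def IsPrimaryResonant {r e : ℕ} (η : ℕ) (ξ : Fin r → ℂ) (μ : Fin e → ℂ) (k : Fin e)
    (n : (Fin r ⊕ Fin e) →₀ ℕ) : Prop :=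
  (∏ i, ξ i ^ n (Sum.inl i)) * (∏ j, μ j ^ (η * n (Sum.inr j))) = μ k ^ η

/-- The matrix of the action `F ↦ F^*` of a map `F` in normal form on the hyperplanes
`{u i = 0}` and `{y j = 0}`: the column of a hyperplane `W` lists the multiplicities of `F^* W`. -/
def internalAction {r p : ℕ} (B : Matrix (Fin r) (Fin r) ℕ) (C : Matrix (Fin r) (Fin p) ℕ)
    (D : Matrix (Fin p) (Fin p) ℕ) : Matrix (Fin r ⊕ Fin p) (Fin r ⊕ Fin p) ℕ :=
  Matrix.fromBlocks B C 0 D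

end RigidGerm

/-! Write `f^*` for the pull-back `φ ↦ φ ∘ f`, and `κ < 1` for a rate at which orbits near `0` tend
to `0` (`exists_contractsOn`).

Critical coordinates. Let `c i` be coordinates cutting out the generalized critical set. This set
contains its own preimage, so `c i ∘ f` vanishes only on it, and is therefore a unit times a
monomial (`exists_pullback_eq_unit_mul_monomial`). The exponents form a matrix `A` over `ℕ` without
zero columns. Such a matrix permutes its periodic indices (`exists_internalAction_eq`). On the
periodic components the logarithms of the units are removed by a cohomological equation, solved by a
series along orbits that converges because `f` contracts (`exists_cohomological`); this gives `u`.
The other components give `y`, with the variable part of the unit absorbed in `1 + g`.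

Resonant coordinates. The `du` are completed to a basis of the cotangent space by generalized
eigencovectors. One with eigenvalue `a ≠ 0` lifts to a generalized eigenvector of `f^*` on `K`-jets,
a finite-dimensional space, and then to a germ: `f^* - a` is bijective on germs vanishing to order
`K` once `κ ^ K < ‖a‖` (`IsGenEigenjet.exists_lift`, `IsGenEigenjet.mem_top_of_mem`). This gives
`v`. Since `f^*` is multiplicative, products of generalized eigenvectors are generalized
eigenvectors for the product eigenvalue (`mul_mem_maxGenEigenspace`). Now `f^* v_k - μ_k v_k` is a
generalized eigengerm of the `η`-th iterate for `μ_k ^ η`, so only resonant monomials enter its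
`K`-jet, and variables of eigenvalue `0` cannot occur. The jet is thus a polynomial `ρ_k(u, v)`, and
injectivity at high order turns equality of jets into equality of germs
(`exists_resonantCoordinates`).

Assembly. The `du`, `dv` form a basis of the stable range of the cotangent map, which gives the rank
formula. Under iteration each `dy` is carried into the span of the `du`, so the `dy` are independent
of `du`, `dv` (`linearIndependent_duv_dy`). Arbitrary linear functions `z` complete the coordinates.
The linear part of `ρ` on `{u = 0}` is nilpotent because it is what remains of an operator after its
semisimple part is subtracted. That of `h` on `{u = v = y = 0}` is nilpotent because this invariant
fibre has tangent space killed by the `d`-th power of `df₀`. -/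

namespace RigidGerm

open Complex Set MeasureTheory Function

/-! ### Cauchy's formula on polydiscs and Osgood's lemma -/

/-- `F` is continuous on the closed polydisc of radius `R` and holomorphic in each variable. -/
structure SeparatelyHolomorphic {n : ℕ} (F : (Fin n → ℂ) → ℂ) (R : ℝ) : Prop where
  continuousOn : ContinuousOn F (Metric.closedBall 0 R)
  differentiableOn : ∀ x ∈ Metric.closedBall (0 : Fin n → ℂ) R, ∀ i,
    DifferentiableOn ℂ (fun z => F (update x i z)) (Metric.ball 0 R)

theorem mem_closedBall_pi {n : ℕ} {R : ℝ} (hR : 0 < R) {x : Fin n → ℂ} :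
    x ∈ Metric.closedBall (0 : Fin n → ℂ) R ↔ ∀ i, ‖x i‖ ≤ R := by
  rw [mem_closedBall_zero_iff, pi_norm_le_iff_of_nonneg hR.le]

theorem mem_ball_pi {n : ℕ} {R : ℝ} (hR : 0 < R) {x : Fin n → ℂ} :
    x ∈ Metric.ball (0 : Fin n → ℂ) R ↔ ∀ i, ‖x i‖ < R := by
  rw [mem_ball_zero_iff, pi_norm_lt_iff hR]

theorem update_mem_closedBall_pi {n : ℕ} {R : ℝ} (hR : 0 < R) {x : Fin n → ℂ}
    (hx : x ∈ Metric.closedBall (0 : Fin n → ℂ) R) (i : Fin n) {z : ℂ} (hz : ‖z‖ ≤ R) :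
    update x i z ∈ Metric.closedBall (0 : Fin n → ℂ) R := by
  rw [mem_closedBall_pi hR] at hx ⊢
  intro j
  rcases eq_or_ne j i with rfl | h
  · simpa using hz
  · simpa [update_of_ne h] using hx j

theorem norm_torusMap {n : ℕ} {R : ℝ} (hR : 0 < R) (θ : Fin n → ℝ) (i : Fin n) :
    ‖torusMap 0 (fun _ => R) θ i‖ = R := by
  simp [torusMap, abs_of_pos hR]

theorem continuous_torusMap {n : ℕ} (R : ℝ) :
    Continuous (torusMap (0 : Fin n → ℂ) (fun _ => R)) := by
  unfold torusMap; fun_prop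

theorem torusMap_mem_closedBall {n : ℕ} {R : ℝ} (hR : 0 < R) (θ : Fin n → ℝ) :
    torusMap 0 (fun _ => R) θ ∈ Metric.closedBall (0 : Fin n → ℂ) R :=
  (mem_closedBall_pi hR).2 fun i => (norm_torusMap hR θ i).le

theorem torusIntegrable_of_continuousOn {n : ℕ} {R : ℝ} (hR : 0 < R) {F : (Fin n → ℂ) → ℂ}
    (hF : ContinuousOn F {w | ∀ i, ‖w i‖ = R}) : TorusIntegrable F 0 fun _ => R := by
  refine Continuous.integrableOn_Icc ?_
  exact hF.comp_continuous (continuous_torusMap R) fun θ i => norm_torusMap hR θ i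

theorem continuousOn_cauchyKernel {n : ℕ} {R : ℝ} {F : (Fin n → ℂ) → ℂ} (hR : 0 < R)
    (hF : ContinuousOn F (Metric.closedBall 0 R)) {x : Fin n → ℂ}
    (hx : x ∈ Metric.ball (0 : Fin n → ℂ) R) :
    ContinuousOn (fun w => (∏ i, (w i - x i)⁻¹) * F w) {w | ∀ i, ‖w i‖ = R} := by
  refine ContinuousOn.mul (continuousOn_finsetProd _ fun i _ => ContinuousOn.inv₀ (by fun_prop) ?_)
    (hF.mono fun w hw => (mem_closedBall_pi hR).2 fun i => (hw i).le)
  intro w hw h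
  have h1 := (mem_ball_pi hR).1 hx i
  rw [sub_eq_zero] at h
  rw [← h, hw i] at h1
  exact lt_irrefl _ h1

/-- Induction on the number of variables: the inner integral over the last `n` variables is the
formula in dimension `n` with the first variable frozen on its circle, and the outer one is the
one-variable Cauchy formula. -/
theorem torusIntegral_cauchy {R : ℝ} (hR : 0 < R) : ∀ {n : ℕ} {F : (Fin n → ℂ) → ℂ},
    SeparatelyHolomorphic F R → ∀ {x : Fin n → ℂ}, x ∈ Metric.ball (0 : Fin n → ℂ) R →
    torusIntegral (fun w => (∏ i, (w i - x i)⁻¹) * F w) 0 (fun _ => R)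
      = (2 * Real.pi * I) ^ n * F x := by
  intro n
  induction n with
  | zero =>
    intro F hF x hx
    simp [Subsingleton.elim x 0]
  | succ n ih =>
    intro F hF x hx
    rw [torusIntegral_succ
      (torusIntegrable_of_continuousOn hR (continuousOn_cauchyKernel hR hF.continuousOn hx))]
    have hxt : (fun i : Fin n => x i.succ) ∈ Metric.ball (0 : Fin n → ℂ) R :=
      (mem_ball_pi hR).2 fun i => (mem_ball_pi hR).1 hx i.succ
    have hxt' : (fun i : Fin n => x i.succ) ∈ Metric.closedBall (0 : Fin n → ℂ) R :=
      Metric.ball_subset_closedBall hxt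
    have hcons : ∀ z : ℂ, ‖z‖ ≤ R → ∀ y ∈ Metric.closedBall (0 : Fin n → ℂ) R,
        (Fin.cons z y : Fin (n + 1) → ℂ) ∈ Metric.closedBall (0 : Fin (n + 1) → ℂ) R := by
      intro z hz y hy
      rw [mem_closedBall_pi hR] at hy ⊢
      intro i
      refine Fin.cases ?_ (fun i => ?_) i
      · simpa using hz
      · simpa using hy i
    have hcont : ∀ z : ℂ, Continuous fun y : Fin n → ℂ => (Fin.cons z y : Fin (n + 1) → ℂ) := by
      intro z; fun_prop
    have hinner : ∀ z ∈ Metric.sphere (0 : ℂ) R,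
        torusIntegral (fun y : Fin n → ℂ => (∏ i, ((Fin.cons z y : Fin (n + 1) → ℂ) i - x i)⁻¹) *
          F (Fin.cons z y)) 0 (fun _ => R)
        = (z - x 0)⁻¹ • ((2 * Real.pi * I) ^ n * F (Fin.cons z fun i => x i.succ)) := by
      intro z hz
      have hz' : ‖z‖ ≤ R := (mem_sphere_zero_iff_norm.1 hz).le
      have hsep : SeparatelyHolomorphic (fun y : Fin n → ℂ => F (Fin.cons z y)) R := by
        refine ⟨hF.continuousOn.comp (hcont z).continuousOn fun y hy => hcons z hz' y hy, ?_⟩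
        intro y hy i
        have := hF.differentiableOn _ (hcons z hz' y hy) i.succ
        simpa [Fin.cons_update] using this
      rw [← ih hsep hxt, smul_eq_mul, ← torusIntegral_const_mul]
      congr 1
      ext y
      simp only [Fin.prod_univ_succ, Fin.cons_zero, Fin.cons_succ]
      ring
    have hd : DiffContOnCl ℂ (fun z => (2 * Real.pi * I) ^ n * F (Fin.cons z fun i => x i.succ))
        (Metric.ball 0 R) := by
      have h0 := hcons 0 (by simpa using hR.le) _ hxt'
      refine ⟨?_, ?_⟩
      · have := hF.differentiableOn _ h0 0
        simp only [Fin.update_cons_zero] at this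
        exact this.const_mul _
      · rw [closure_ball _ hR.ne']
        refine ContinuousOn.mul continuousOn_const (hF.continuousOn.comp ?_ ?_)
        · exact Continuous.continuousOn (by fun_prop)
        · intro z hz
          exact hcons z (by simpa using hz) _ hxt'
    have h1 := hd.circleIntegral_sub_inv_smul (w := x 0)
      (by simpa using (mem_ball_pi hR).1 hx 0)
    refine (circleIntegral.integral_congr hR.le (g := fun z => (z - x 0)⁻¹ •
      ((2 * Real.pi * I) ^ n * F (Fin.cons z fun i => x i.succ))) hinner).trans ?_
    rw [h1, show (Fin.cons (x 0) fun i => x i.succ : Fin (n + 1) → ℂ) = x from Fin.cons_self_tail x]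
    rw [smul_eq_mul]; ring

/-- The coordinate function `w i` on the torus, as an element of a Banach algebra. -/
noncomputable def torusCoord {n : ℕ} (R : ℝ) (i : Fin n) :
    BoundedContinuousFunction (Fin n → ℝ) ℂ :=
  BoundedContinuousFunction.ofNormedAddCommGroup (fun θ => torusMap 0 (fun _ => R) θ i)
    ((continuous_apply i).comp (continuous_torusMap R)) |R| fun θ => by simp [torusMap]

theorem isUnit_torusCoord {n : ℕ} {R : ℝ} (hR : 0 < R) (i : Fin n) :
    IsUnit (torusCoord R i) := by
  have hne : ∀ θ : Fin n → ℝ, torusMap 0 (fun _ => R) θ i ≠ 0 := fun θ h => by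
    have := norm_torusMap hR θ i
    rw [h, norm_zero] at this
    exact hR.ne this
  let b : BoundedContinuousFunction (Fin n → ℝ) ℂ :=
    BoundedContinuousFunction.ofNormedAddCommGroup (fun θ => (torusMap 0 (fun _ => R) θ i)⁻¹)
      (((continuous_apply i).comp (continuous_torusMap R)).inv₀ hne) R⁻¹ fun θ => by
        rw [norm_inv, norm_torusMap hR]
  refine IsUnit.of_mul_eq_one b ?_
  ext θ
  exact mul_inv_cancel₀ (hne θ)

/-- The Cauchy kernel `∏ (w i - x i)⁻¹` on the torus. -/
noncomputable def cauchyKernel {n : ℕ} (R : ℝ) (x : Fin n → ℂ) :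
    BoundedContinuousFunction (Fin n → ℝ) ℂ :=
  ∏ i, Ring.inverse (torusCoord R i - algebraMap ℂ _ (x i))

theorem analyticAt_inverse_torusCoord {n : ℕ} {R : ℝ} (hR : 0 < R) (i : Fin n) :
    AnalyticAt ℂ (fun x : Fin n → ℂ => Ring.inverse (torusCoord R i - algebraMap ℂ _ (x i))) 0 := by
  obtain ⟨u, hu⟩ := isUnit_torusCoord hR i
  have h1 := analyticAt_inverse (𝕜 := ℂ) u
  have h2 : AnalyticAt ℂ (fun x : Fin n → ℂ => torusCoord R i -
      algebraMap ℂ (BoundedContinuousFunction (Fin n → ℝ) ℂ) (x i)) 0 := by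
    refine analyticAt_const.sub ?_
    exact ((Algebra.linearMap ℂ (BoundedContinuousFunction (Fin n → ℝ) ℂ)).toContinuousLinearMap.comp
      (ContinuousLinearMap.proj (R := ℂ) (φ := fun _ : Fin n => ℂ) i)).analyticAt 0
  refine AnalyticAt.comp (g := Ring.inverse) ?_ h2
  simpa [← hu] using h1

theorem analyticAt_cauchyKernel {n : ℕ} {R : ℝ} (hR : 0 < R) :
    AnalyticAt ℂ (cauchyKernel (n := n) R) 0 := by
  unfold cauchyKernel
  exact Finset.analyticAt_fun_prod _ fun i _ => analyticAt_inverse_torusCoord hR i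

theorem inverse_torusCoord_apply {n : ℕ} {R : ℝ} (hR : 0 < R) (i : Fin n) :
    ∀ᶠ x : Fin n → ℂ in 𝓝 0, ∀ θ, Ring.inverse (torusCoord R i - algebraMap ℂ _ (x i)) θ
      = (torusMap 0 (fun _ => R) θ i - x i)⁻¹ := by
  have hc : ContinuousAt (fun x : Fin n → ℂ => torusCoord R i -
      algebraMap ℂ (BoundedContinuousFunction (Fin n → ℝ) ℂ) (x i)) 0 := by
    refine continuousAt_const.sub ?_
    exact ((Algebra.linearMap ℂ
      (BoundedContinuousFunction (Fin n → ℝ) ℂ)).toContinuousLinearMap.comp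
      (ContinuousLinearMap.proj (R := ℂ) (φ := fun _ : Fin n => ℂ) i)).continuous.continuousAt
  have hu : ∀ᶠ x : Fin n → ℂ in 𝓝 0, IsUnit (torusCoord R i -
      algebraMap ℂ (BoundedContinuousFunction (Fin n → ℝ) ℂ) (x i)) := by
    refine hc.eventually_mem (Units.isOpen.mem_nhds ?_)
    simpa using isUnit_torusCoord hR i
  filter_upwards [hu] with x hx θ
  have h := congrArg (fun b : BoundedContinuousFunction (Fin n → ℝ) ℂ => b θ)
    (Ring.mul_inverse_cancel _ hx)
  exact eq_inv_of_mul_eq_one_right h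

/-- Integration against `F` over the torus. -/
noncomputable def torusFunctional {n : ℕ} (F : BoundedContinuousFunction (Fin n → ℝ) ℂ) :
    BoundedContinuousFunction (Fin n → ℝ) ℂ →L[ℂ] ℂ :=
  LinearMap.mkContinuous
    { toFun := fun b => ∫ θ in Icc (0 : Fin n → ℝ) fun _ => 2 * Real.pi, b θ * F θ
      map_add' := fun b c => by
        simp only [BoundedContinuousFunction.coe_add, Pi.add_apply, add_mul]
        exact integral_add (b.continuous.mul F.continuous).integrableOn_Icc
          (c.continuous.mul F.continuous).integrableOn_Icc
      map_smul' := fun a b => by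
        simp only [BoundedContinuousFunction.coe_smul, smul_mul_assoc, RingHom.id_apply]
        exact integral_smul _ _ }
    (‖F‖ * (volume (Icc (0 : Fin n → ℝ) fun _ => 2 * Real.pi)).toReal) fun b => by
      have := norm_setIntegral_le_of_norm_le_const
        (f := fun θ => b θ * F θ) (C := ‖b‖ * ‖F‖)
        (measure_Icc_lt_top (μ := volume) (a := (0 : Fin n → ℝ)) (b := fun _ => 2 * Real.pi))
        fun θ _ => (norm_mul_le _ _).trans (mul_le_mul (b.norm_coe_le_norm θ)
          (F.norm_coe_le_norm θ) (norm_nonneg _) (norm_nonneg _))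
      refine this.trans (le_of_eq ?_)
      rw [Measure.real]
      ring

/-- The density `∏ R e^{iθ} i` times `F` restricted to the torus. -/
theorem exists_torusDensity {n : ℕ} {R : ℝ} (hR : 0 < R) {F : (Fin n → ℂ) → ℂ}
    (hF : ContinuousOn F (Metric.closedBall 0 R)) :
    ∃ G : BoundedContinuousFunction (Fin n → ℝ) ℂ, ∀ θ, G θ =
      (∏ i, R * exp (θ i * I) * I : ℂ) * F (torusMap 0 (fun _ => R) θ) := by
  obtain ⟨C, hC⟩ := (isCompact_closedBall (0 : Fin n → ℂ) R).exists_bound_of_continuousOn hF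
  refine ⟨BoundedContinuousFunction.ofNormedAddCommGroup (fun θ => (∏ i, R * exp (θ i * I) * I : ℂ) *
    F (torusMap 0 (fun _ => R) θ)) ?_ (R ^ n * C) ?_, fun θ => rfl⟩
  · refine Continuous.mul (by fun_prop) (hF.comp_continuous (continuous_torusMap R) fun θ =>
      torusMap_mem_closedBall hR θ)
  · intro θ
    rw [norm_mul]
    refine mul_le_mul (le_of_eq ?_) (hC _ (torusMap_mem_closedBall hR θ)) (norm_nonneg _)
      (by positivity)
    simp [abs_of_pos hR]

/-- Cauchy's formula read as a fixed continuous functional applied to a kernel with values in the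
Banach algebra of bounded continuous functions of the angles. The kernel is analytic in `x` because
inversion is analytic at units, so no power series of `F` has to be summed. -/
theorem SeparatelyHolomorphic.exists_cauchy {n : ℕ} {R : ℝ} (hR : 0 < R) {F : (Fin n → ℂ) → ℂ}
    (hF : SeparatelyHolomorphic F R) :
    ∃ ℓ : BoundedContinuousFunction (Fin n → ℝ) ℂ →L[ℂ] ℂ,
      ∀ᶠ x in 𝓝 0, F x = ℓ (cauchyKernel R x) := by
  obtain ⟨G, hG⟩ := exists_torusDensity hR hF.continuousOn
  refine ⟨((2 * Real.pi * I) ^ n : ℂ)⁻¹ • torusFunctional G, ?_⟩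
  filter_upwards [Metric.ball_mem_nhds (0 : Fin n → ℂ) hR,
    eventually_all.2 fun i : Fin n => inverse_torusCoord_apply hR i] with x hx hx'
  have h := torusIntegral_cauchy hR hF hx
  have h2 : torusFunctional G (cauchyKernel R x)
      = torusIntegral (fun w => (∏ i, (w i - x i)⁻¹) * F w) 0 (fun _ => R) := by
    change ∫ θ in Icc (0 : Fin n → ℝ) fun _ => 2 * Real.pi, cauchyKernel R x θ * G θ = _
    unfold torusIntegral
    congr 1
    ext θ
    have : cauchyKernel R x θ = ∏ i, (torusMap 0 (fun _ => R) θ i - x i)⁻¹ := by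
      unfold cauchyKernel
      simp only [BoundedContinuousFunction.coe_prod, Finset.prod_apply]
      exact Finset.prod_congr rfl fun i _ => hx' i θ
    rw [this, hG, smul_eq_mul]
    ring
  rw [_root_.smul_apply, h2, h, smul_eq_mul, inv_mul_cancel_left₀]
  exact pow_ne_zero _ two_pi_I_ne_zero

/-- Osgood's lemma. -/
theorem SeparatelyHolomorphic.analyticAt {n : ℕ} {R : ℝ} (hR : 0 < R) {F : (Fin n → ℂ) → ℂ}
    (hF : SeparatelyHolomorphic F R) : AnalyticAt ℂ F 0 := by
  obtain ⟨ℓ, hℓ⟩ := hF.exists_cauchy hR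
  exact ((ℓ.analyticAt _).comp (analyticAt_cauchyKernel hR)).congr (hℓ.mono fun x hx => hx.symm)


theorem SeparatelyHolomorphic.of_analyticOnNhd {n : ℕ} {R : ℝ} (hR : 0 < R) {F : (Fin n → ℂ) → ℂ}
    (hF : AnalyticOnNhd ℂ F (Metric.closedBall 0 R)) : SeparatelyHolomorphic F R := by
  refine ⟨hF.continuousOn, fun x hx i z hz => ?_⟩
  have h1 := (hF _ (update_mem_closedBall_pi hR hx i
    (by simpa using (mem_ball_zero_iff.1 hz).le))).differentiableAt
  refine (h1.comp z ?_).differentiableWithinAt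
  exact (hasFDerivAt_update x z).differentiableAt

/-- A sum of analytic functions that converges normally on a polydisc is analytic. -/
theorem analyticAt_tsum_of_summable_norm {n : ℕ} {R : ℝ} (hR : 0 < R) {F : ℕ → (Fin n → ℂ) → ℂ}
    {b : ℕ → ℝ} (hb : Summable b) (hF : ∀ k, AnalyticOnNhd ℂ (F k) (Metric.closedBall 0 R))
    (hFb : ∀ k, ∀ x ∈ Metric.closedBall (0 : Fin n → ℂ) R, ‖F k x‖ ≤ b k) :
    AnalyticAt ℂ (fun x => ∑' k, F k x) 0 := by
  -- Osgood's lemma reduces the claim to continuity and to the one-variable theorem of Weierstrass.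
  refine SeparatelyHolomorphic.analyticAt hR
    ⟨continuousOn_tsum (fun k => (hF k).continuousOn) hb hFb, fun x hx i => ?_⟩
  refine Complex.differentiableOn_tsum_of_summable_norm hb
    (fun k => (SeparatelyHolomorphic.of_analyticOnNhd hR (hF k)).differentiableOn x hx i)
    Metric.isOpen_ball fun k z hz => hFb k _ (update_mem_closedBall_pi hR hx i ?_)
  simpa using (mem_ball_zero_iff.1 hz).le

theorem exists_analyticOnNhd_closedBall {E F : Type*} [NormedAddCommGroup E]
    [NormedSpace ℂ E] [NormedAddCommGroup F] [NormedSpace ℂ F] [CompleteSpace F] {f : E → F}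
    (hf : AnalyticAt ℂ f 0) : ∃ R > 0, AnalyticOnNhd ℂ f (Metric.closedBall 0 R) := by
  obtain ⟨R, hR, h⟩ := Metric.eventually_nhds_iff_ball.1 hf.eventually_analyticAt
  exact ⟨R / 2, by positivity, fun x hx => h x (Metric.closedBall_subset_ball (by linarith) hx)⟩

/-! ### Hadamard's lemma and the integral domain of germs -/

/-- Hadamard's lemma in one of the variables. -/
theorem exists_sub_update_eq {n : ℕ} {F : (Fin n → ℂ) → ℂ} (hF : AnalyticAt ℂ F 0)
    (i : Fin n) : ∃ G : (Fin n → ℂ) → ℂ, AnalyticAt ℂ G 0 ∧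
      ∀ᶠ x in 𝓝 0, F x - F (update x i 0) = x i * G x := by
  obtain ⟨R, hR, hF'⟩ := exists_analyticOnNhd_closedBall hF
  obtain ⟨ℓ, hℓ⟩ := (SeparatelyHolomorphic.of_analyticOnNhd hR hF').exists_cauchy hR
  -- The quotient comes from the resolvent identity `(w - x)⁻¹ - w⁻¹ = x w⁻¹ (w - x)⁻¹` in the
  -- `i`-th factor of the Cauchy kernel.
  refine ⟨fun x => ℓ (Ring.inverse (torusCoord R i) * cauchyKernel R x), ?_, ?_⟩
  · exact (ℓ.analyticAt _).comp (analyticAt_const.mul (analyticAt_cauchyKernel hR))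
  · have hup : Tendsto (fun x : Fin n → ℂ => update x i 0) (𝓝 0) (𝓝 0) := by
      have : Continuous fun x : Fin n → ℂ => update x i 0 := by fun_prop
      simpa using this.tendsto (0 : Fin n → ℂ)
    have hu : ∀ᶠ x : Fin n → ℂ in 𝓝 0, IsUnit (torusCoord R i -
        algebraMap ℂ (BoundedContinuousFunction (Fin n → ℝ) ℂ) (x i)) := by
      have hc : ContinuousAt (fun x : Fin n → ℂ => torusCoord R i -
          algebraMap ℂ (BoundedContinuousFunction (Fin n → ℝ) ℂ) (x i)) 0 :=
        continuousAt_const.sub ((Algebra.linearMap ℂ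
          (BoundedContinuousFunction (Fin n → ℝ) ℂ)).toContinuousLinearMap.comp
          (ContinuousLinearMap.proj (R := ℂ) (φ := fun _ : Fin n => ℂ) i)).continuous.continuousAt
      refine hc.eventually_mem (Units.isOpen.mem_nhds ?_)
      simpa using isUnit_torusCoord hR i
    filter_upwards [hℓ, hup.eventually hℓ, hu] with x h1 h2 hx
    rw [h1, h2, ← map_sub, ← smul_eq_mul, ← map_smul]
    congr 1
    have hk : ∀ y : Fin n → ℂ, cauchyKernel R y =
        Ring.inverse (torusCoord R i - algebraMap ℂ _ (y i)) *
          ∏ j ∈ Finset.univ.erase i, Ring.inverse (torusCoord R j - algebraMap ℂ _ (y j)) :=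
      fun y => (Finset.mul_prod_erase _ _ (Finset.mem_univ i)).symm
    have he : ∏ j ∈ Finset.univ.erase i, Ring.inverse (torusCoord R j -
          algebraMap ℂ (BoundedContinuousFunction (Fin n → ℝ) ℂ) (update x i 0 j))
        = ∏ j ∈ Finset.univ.erase i, Ring.inverse (torusCoord R j - algebraMap ℂ _ (x j)) :=
      Finset.prod_congr rfl fun j hj => by rw [update_of_ne (Finset.ne_of_mem_erase hj)]
    rw [hk x, hk (update x i 0), he, update_self, map_zero, sub_zero, ← sub_mul,
      Algebra.smul_def, ← mul_assoc, ← mul_assoc]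
    congr 1
    have hW := Ring.mul_inverse_cancel _ (isUnit_torusCoord hR i)
    have hWx := Ring.mul_inverse_cancel _ hx
    generalize Ring.inverse (torusCoord R i) = a at *
    generalize Ring.inverse (torusCoord R i - algebraMap ℂ
      (BoundedContinuousFunction (Fin n → ℝ) ℂ) (x i)) = b at *
    generalize algebraMap ℂ (BoundedContinuousFunction (Fin n → ℝ) ℂ) (x i) = c at *
    linear_combination a * hWx - b * hW

/-- Hadamard's lemma. -/
theorem exists_eq_add_sum_mul {n : ℕ} {F : (Fin n → ℂ) → ℂ} (hF : AnalyticAt ℂ F 0) :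
    ∃ G : Fin n → (Fin n → ℂ) → ℂ, (∀ i, AnalyticAt ℂ (G i) 0) ∧
      ∀ᶠ x in 𝓝 0, F x = F 0 + ∑ i, x i * G i x := by
  -- The coordinates are set to zero one after the other, and the differences telescope.
  have key : ∀ s : Finset (Fin n), ∃ G : Fin n → (Fin n → ℂ) → ℂ, (∀ i, AnalyticAt ℂ (G i) 0) ∧
      ∀ᶠ x in 𝓝 0, F x = F (fun i => if i ∈ s then 0 else x i) + ∑ i ∈ s, x i * G i x := by
    intro s
    induction s using Finset.induction_on with
    | empty => exact ⟨fun _ _ => 0, fun _ => analyticAt_const, by simp⟩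
    | insert j s hj ih =>
      obtain ⟨G, hG, h⟩ := ih
      let π : (Fin n → ℂ) →L[ℂ] (Fin n → ℂ) := ContinuousLinearMap.pi fun i =>
        if i ∈ s then 0 else ContinuousLinearMap.proj (R := ℂ) (φ := fun _ : Fin n => ℂ) i
      have hπ : ∀ x, π x = fun i => if i ∈ s then 0 else x i := fun x => by
        ext i; by_cases hi : i ∈ s <;> simp [π, hi]
      obtain ⟨H, hH, h'⟩ := exists_sub_update_eq hF j
      have hπ0 : Tendsto π (𝓝 0) (𝓝 0) := by simpa using π.continuous.tendsto 0
      refine ⟨update G j (H ∘ π), fun i => ?_, ?_⟩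
      · rcases eq_or_ne i j with rfl | hi
        · rw [update_self]
          exact AnalyticAt.comp (by simpa using hH) (π.analyticAt 0)
        · rw [update_of_ne hi]; exact hG i
      · filter_upwards [h, hπ0.eventually h'] with x h1 h2
        rw [Finset.sum_insert hj, update_self, h1]
        have h3 : ∑ i ∈ s, x i * update G j (H ∘ π) i x = ∑ i ∈ s, x i * G i x :=
          Finset.sum_congr rfl fun i hi => by
            rw [update_of_ne (ne_of_mem_of_not_mem hi hj)]
        have h4 : update (π x) j 0 = fun i => if i ∈ insert j s then 0 else x i := by
          ext i
          rcases eq_or_ne i j with rfl | hi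
          · simp
          · simp [hπ, hi]
        have h5 : π x j = x j := by simp [hπ, hj]
        rw [h3, Function.comp_apply, ← h5, ← h2, h4, hπ]
        ring
  obtain ⟨G, hG, h⟩ := key Finset.univ
  refine ⟨G, hG, h.mono fun x hx => ?_⟩
  simpa [← Pi.zero_def] using hx

/-- The ring of germs of analytic functions has no zero divisors. -/
theorem eventually_eq_zero_or_of_mul {E : Type*} [NormedAddCommGroup E] [NormedSpace ℂ E]
    {f g : E → ℂ} (hf : AnalyticAt ℂ f 0) (hg : AnalyticAt ℂ g 0)
    (h : ∀ᶠ x in 𝓝 0, f x * g x = 0) : (∀ᶠ x in 𝓝 0, f x = 0) ∨ ∀ᶠ x in 𝓝 0, g x = 0 := by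
  by_contra! hne
  obtain ⟨R, hR, hA⟩ := exists_analyticOnNhd_closedBall hg
  have hfr : ∃ᶠ x in 𝓝 (0 : E), f x ≠ 0 := hne.1
  -- Near a point where `f` is non-zero, `g` vanishes identically; the identity theorem on the ball
  -- carries this back to `0`.
  obtain ⟨x, hx, hfx, hfg, hxb⟩ := (hfr.and_eventually (hf.eventually_analyticAt.and
    (h.eventually_nhds.and (Metric.ball_mem_nhds 0 hR)))).exists
  have hgx : g =ᶠ[𝓝 x] 0 := by
    filter_upwards [hfg, hfx.continuousAt.eventually_ne hx] with y hy hy'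
    simpa [hy'] using hy
  have := (hA.mono Metric.ball_subset_closedBall).eqOn_zero_of_preconnected_of_eventuallyEq_zero
    (convex_ball 0 R).isPreconnected hxb hgx
  exact hne.2 (by filter_upwards [Metric.ball_mem_nhds 0 hR] with y hy; simpa using this hy)

theorem exists_eventually_eq_zero_of_prod {E ι : Type*} [NormedAddCommGroup E] [NormedSpace ℂ E]
    (s : Finset ι) {f : ι → E → ℂ} (hf : ∀ i ∈ s, AnalyticAt ℂ (f i) 0)
    (h : ∀ᶠ x in 𝓝 0, ∏ i ∈ s, f i x = 0) : ∃ i ∈ s, ∀ᶠ x in 𝓝 0, f i x = 0 := by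
  classical
  induction s using Finset.induction_on with
  | empty =>
    obtain ⟨x, hx⟩ := h.exists
    simp at hx
  | insert j s hj ih =>
    simp only [Finset.prod_insert hj] at h
    rcases eventually_eq_zero_or_of_mul (hf j (by simp))
      (Finset.analyticAt_fun_prod s fun i hi => hf i (by simp [hi])) h with h1 | h1
    · exact ⟨j, by simp, h1⟩
    · obtain ⟨i, hi, hi'⟩ := ih (fun i hi => hf i (by simp [hi])) h1
      exact ⟨i, by simp [hi], hi'⟩

/-! ### Biholomorphic germs and their inverses -/

section Biholomorphic

variable {E E' : Type*} [NormedAddCommGroup E] [NormedSpace ℂ E]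
  [NormedAddCommGroup E'] [NormedSpace ℂ E']

theorem IsBiholomorphicGerm.tendsto {Φ : E → E'} (hΦ : IsBiholomorphicGerm Φ) :
    Tendsto Φ (𝓝 0) (𝓝 0) := by
  simpa [hΦ.map_zero] using hΦ.analyticAt.continuousAt.tendsto

theorem IsBiholomorphicGerm.exists_inverse [CompleteSpace E] [CompleteSpace E'] {Φ : E → E'}
    (hΦ : IsBiholomorphicGerm Φ) : ∃ Ψ : E' → E, IsBiholomorphicGerm Ψ ∧
      (∀ᶠ x in 𝓝 0, Ψ (Φ x) = x) ∧ ∀ᶠ y in 𝓝 0, Φ (Ψ y) = y := by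
  obtain ⟨L, hL⟩ := hΦ.invertible
  have hs : HasStrictFDerivAt Φ (L : E →L[ℂ] E') 0 := by
    simpa [hL.fderiv] using hΦ.analyticAt.hasStrictFDerivAt
  have h1 : ∀ᶠ x in 𝓝 0, hs.localInverse Φ L 0 (Φ x) = x := hs.eventually_left_inverse
  have h2 : ∀ᶠ y in 𝓝 (Φ 0), Φ (hs.localInverse Φ L 0 y) = y := hs.eventually_right_inverse
  rw [hΦ.map_zero] at h2
  have h3 := (hs.to_localInverse).hasFDerivAt
  rw [hΦ.map_zero] at h3
  refine ⟨hs.localInverse Φ L 0, ⟨?_, ?_, L.symm, h3⟩, h1, h2⟩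
  · have := (hs.toOpenPartialHomeomorph Φ).analyticAt_symm' (a := 0) (i := L)
      hs.mem_toOpenPartialHomeomorph_source hΦ.analyticAt hL.fderiv
    rw [HasStrictFDerivAt.localInverse_def]
    simpa [hΦ.map_zero] using this
  · have := hs.localInverse_apply_image
    rwa [hΦ.map_zero] at this

theorem IsBiholomorphicGerm.eventually_fderiv [CompleteSpace E] [CompleteSpace E'] {Φ : E → E'}
    (hΦ : IsBiholomorphicGerm Φ) :
    ∀ᶠ x in 𝓝 0, ∃ L : E ≃L[ℂ] E', HasFDerivAt Φ (L : E →L[ℂ] E') x := by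
  obtain ⟨L, hL⟩ := hΦ.invertible
  have h1 : ContinuousAt (fderiv ℂ Φ) 0 := hΦ.analyticAt.fderiv.continuousAt
  have h2 := ContinuousLinearEquiv.nhds L
  rw [← hL.fderiv] at h2
  filter_upwards [h1 h2, hΦ.analyticAt.eventually_analyticAt] with x ⟨e, he⟩ hx
  exact ⟨e, by rw [he]; exact hx.differentiableAt.hasFDerivAt⟩

end Biholomorphic

/-! ### Geometric convergence of orbits -/

/-- `f` fixes `0` and its iterates converge geometrically to `0` on the ball of radius `R`. -/
structure ContractsOn {E : Type*} [NormedAddCommGroup E] (f : E → E) (C κ R : ℝ) : Prop where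
  C_pos : 0 < C
  κ_pos : 0 < κ
  κ_lt_one : κ < 1
  R_pos : 0 < R
  norm_iterate_le : ∀ x, ‖x‖ ≤ R → ∀ n, ‖f^[n] x‖ ≤ C * κ ^ n * ‖x‖

/-- Points near `0` have their whole orbit in a given neighbourhood of `0`. -/
theorem ContractsOn.eventually_forall_iterate {E : Type*} [NormedAddCommGroup E] {f : E → E}
    {C κ R : ℝ} (h : ContractsOn f C κ R) {p : E → Prop} (hp : ∀ᶠ x in 𝓝 0, p x) :
    ∀ᶠ x in 𝓝 0, ∀ n, p (f^[n] x) := by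
  obtain ⟨δ, hδ, hb⟩ := Metric.eventually_nhds_iff_ball.1 hp
  have hC := h.C_pos
  have hR := h.R_pos
  filter_upwards [Metric.ball_mem_nhds 0 (show 0 < min R (δ / C) by positivity)] with x hx n
  rw [mem_ball_zero_iff, lt_min_iff, lt_div_iff₀ hC] at hx
  refine hb _ (mem_ball_zero_iff.2 ((h.norm_iterate_le x hx.1.le n).trans_lt ?_))
  calc C * κ ^ n * ‖x‖ ≤ C * 1 * ‖x‖ := by
        gcongr; exact pow_le_one₀ h.κ_pos.le h.κ_lt_one.le
    _ < δ := by linarith [hx.2]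

section Contraction

variable {E : Type*} [NormedAddCommGroup E] [NormedSpace ℂ E] [FiniteDimensional ℂ E]

/-- Gelfand's formula: the spectral radius, which is less than `1`, is the limit of `‖A ^ N‖ ^ (1 /
N)`. -/
theorem exists_norm_pow_lt_one (A : E →L[ℂ] E)
    (hA : ∀ a : ℂ, Module.End.HasEigenvalue (A : E →ₗ[ℂ] E) a → ‖a‖ < 1) :
    ∃ N : ℕ, 0 < N ∧ ‖A ^ N‖ < 1 := by
  have : CompleteSpace E := FiniteDimensional.complete ℂ E
  rcases subsingleton_or_nontrivial E with hE | hE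
  · refine ⟨1, one_pos, ?_⟩
    have : A ^ 1 = 0 := by ext x; exact Subsingleton.elim _ _
    simp [this]
  · have hs : ∀ z ∈ spectrum ℂ A, ‖z‖₊ < 1 := by
      intro z hz
      have h1 : spectrum ℂ (A : Module.End ℂ E) = spectrum ℂ A := by
        have := AlgEquiv.spectrum_eq (Module.End.toContinuousLinearMap (𝕜 := ℂ) E)
          (A : Module.End ℂ E)
        rw [← this]
        congr 1
      rw [← h1] at hz
      exact_mod_cast hA z (Module.End.hasEigenvalue_iff_mem_spectrum.2 hz)
    have h2 := spectrum.spectralRadius_lt_of_forall_lt A hs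
    have h3 := (spectrum.pow_nnnorm_pow_one_div_tendsto_nhds_spectralRadius A).eventually
      (gt_mem_nhds h2)
    obtain ⟨N, hN, hN0⟩ := (h3.and (eventually_gt_atTop 0)).exists
    refine ⟨N, hN0, ?_⟩
    by_contra! hge
    refine absurd hN (not_lt.2 ?_)
    simp only [ENNReal.coe_one]
    refine ENNReal.one_le_rpow ?_ (by positivity)
    exact_mod_cast hge

/-- Some iterate `f^[N]` contracts by a factor `q < 1`, since the `N`-th power of the linear part
has norm below `q`. The rate of `f` itself is then `q ^ (1 / N)`, and the fewer than `N` leftover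
iterations only cost a constant. -/
theorem exists_contractsOn {f : E → E} {A : E →L[ℂ] E} (hf : HasFDerivAt f A 0) (h0 : f 0 = 0)
    (hA : ∀ a : ℂ, Module.End.HasEigenvalue (A : E →ₗ[ℂ] E) a → ‖a‖ < 1) :
    ∃ C κ R, ContractsOn f C κ R := by
  obtain ⟨N, hN0, hN⟩ := exists_norm_pow_lt_one A hA
  obtain ⟨q, hq, hq1⟩ := exists_between hN
  have hq0 : 0 < q := (norm_nonneg _).trans_lt hq
  have hit : ∀ j, f^[j] 0 = 0 := fun j => Function.iterate_fixed h0 j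
  have h1 : ∀ᶠ x in 𝓝 0, ‖f^[N] x‖ ≤ q * ‖x‖ := by
    have h := (hf.iterate h0 N).isLittleO.def (sub_pos.2 hq)
    filter_upwards [h] with x hx
    simp only [hit, sub_zero] at hx
    calc ‖f^[N] x‖ ≤ ‖f^[N] x - (A ^ N) x‖ + ‖(A ^ N) x‖ := by
          simpa using norm_add_le (f^[N] x - (A ^ N) x) ((A ^ N) x)
      _ ≤ (q - ‖A ^ N‖) * ‖x‖ + ‖A ^ N‖ * ‖x‖ := add_le_add hx ((A ^ N).le_opNorm x)
      _ = q * ‖x‖ := by ring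
  have h2 : ∀ j, ∃ c : ℝ, ∀ᶠ x in 𝓝 0, ‖f^[j] x‖ ≤ c * ‖x‖ := by
    intro j
    have := (hf.iterate h0 j).isBigO_sub
    simp only [hit, sub_zero] at this
    exact this.bound
  choose c hc using h2
  obtain ⟨δ, hδ, hb⟩ := Metric.eventually_nhds_iff_ball.1
    (h1.and (eventually_all.2 fun j : Fin N => hc j))
  set C₀ : ℝ := 1 + ∑ j : Fin N, |c j| with hC₀
  have hC₀pos : 0 < C₀ := by positivity
  set κ : ℝ := q ^ (1 / (N : ℝ)) with hκ
  have hκpos : 0 < κ := Real.rpow_pos_of_pos hq0 _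
  have hκN : κ ^ N = q := by
    rw [hκ, ← Real.rpow_natCast, ← Real.rpow_mul hq0.le, one_div,
      inv_mul_cancel₀ (by exact_mod_cast hN0.ne'), Real.rpow_one]
  have hκ1 : κ < 1 := Real.rpow_lt_one hq0.le hq1 (by positivity)
  -- `C₀` bounds the leftover `n % N` iterations; `(κ ^ N)⁻¹` pays for rounding `n` down to a
  -- multiple of `N`.
  refine ⟨C₀ * (κ ^ N)⁻¹, κ, δ / 2, by positivity, hκpos, hκ1, by positivity, fun x hx n => ?_⟩
  have hstep : ∀ m, ‖f^[N * m] x‖ ≤ q ^ m * ‖x‖ ∧ f^[N * m] x ∈ Metric.ball (0 : E) δ := by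
    intro m
    induction m with
    | zero => exact ⟨by simp, by simpa using by linarith⟩
    | succ m ih =>
      have h3 : ‖f^[N * (m + 1)] x‖ ≤ q ^ (m + 1) * ‖x‖ := by
        rw [mul_add, mul_one, add_comm, Function.iterate_add_apply]
        refine ((hb _ ih.2).1).trans ?_
        rw [pow_succ', mul_assoc]
        exact mul_le_mul_of_nonneg_left ih.1 hq0.le
      refine ⟨h3, mem_ball_zero_iff.2 (h3.trans_lt ?_)⟩
      calc q ^ (m + 1) * ‖x‖ ≤ 1 * ‖x‖ := by gcongr; exact pow_le_one₀ hq0.le hq1.le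
        _ < δ := by linarith
  have hn := Nat.div_add_mod n N
  have hlt := Nat.mod_lt n hN0
  have h4 : ‖f^[n] x‖ ≤ C₀ * ‖f^[N * (n / N)] x‖ := by
    conv_lhs => rw [← hn, add_comm, Function.iterate_add_apply]
    refine ((hb _ (hstep _).2).2 ⟨n % N, hlt⟩).trans ?_
    gcongr
    calc c (n % N) ≤ |c (n % N)| := le_abs_self _
      _ ≤ ∑ j : Fin N, |c j| := Finset.single_le_sum (f := fun j : Fin N => |c j|)
          (fun _ _ => abs_nonneg _) (Finset.mem_univ (⟨n % N, hlt⟩ : Fin N))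
      _ ≤ C₀ := by linarith
  have h5 : q ^ (n / N) ≤ (κ ^ N)⁻¹ * κ ^ n := by
    rw [← hκN, ← pow_mul, le_inv_mul_iff₀ (by positivity), ← pow_add]
    exact pow_le_pow_of_le_one hκpos.le hκ1.le (by omega)
  calc ‖f^[n] x‖ ≤ C₀ * ‖f^[N * (n / N)] x‖ := h4
    _ ≤ C₀ * (q ^ (n / N) * ‖x‖) := by gcongr; exact (hstep _).1
    _ ≤ C₀ * ((κ ^ N)⁻¹ * κ ^ n * ‖x‖) := by gcongr
    _ = _ := by ring

end Contraction

/-! ### Conjugacy invariance of the generalized critical set -/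

theorem det_eq_zero_iff_of_conj {E E' : Type*} [NormedAddCommGroup E] [NormedSpace ℂ E]
    [NormedAddCommGroup E'] [NormedSpace ℂ E'] [FiniteDimensional ℂ E]
    {A : E →L[ℂ] E} {A' : E' →L[ℂ] E'} (L₁ L₂ : E ≃L[ℂ] E')
    (h : (L₂ : E →L[ℂ] E') ∘L A = A' ∘L (L₁ : E →L[ℂ] E')) : A.det = 0 ↔ A'.det = 0 := by
  have : FiniteDimensional ℂ E' := L₁.toLinearEquiv.finiteDimensional
  have hx : ∀ x, L₂ (A x) = A' (L₁ x) := fun x => congrArg (fun B => B x) h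
  -- The isomorphisms on the two sides differ, so the determinants need not agree; injectivity is
  -- what is transported.
  rw [ContinuousLinearMap.det, ContinuousLinearMap.det, LinearMap.det_eq_zero_iff_ker_ne_bot,
    LinearMap.det_eq_zero_iff_ker_ne_bot, not_iff_not, LinearMap.ker_eq_bot', LinearMap.ker_eq_bot']
  constructor
  · intro hA y hy
    have h1 := hx (L₁.symm y)
    rw [L₁.apply_symm_apply] at h1
    have h2 : A (L₁.symm y) = 0 := by
      apply L₂.injective
      rw [h1, map_zero]; exact hy
    simpa using hA _ h2
  · intro hA x hx'
    have h1 : A' (L₁ x) = 0 := by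
      rw [← hx, show A x = 0 from hx', map_zero]
    simpa using hA _ h1

/-- The germ of the generalized critical set is invariant under analytic conjugacies. -/
theorem eventually_mem_generalizedCriticalSet_iff {E E' : Type*} [NormedAddCommGroup E]
    [NormedSpace ℂ E] [NormedAddCommGroup E'] [NormedSpace ℂ E'] [FiniteDimensional ℂ E]
    [FiniteDimensional ℂ E'] {f : E → E} {F : E' → E'} {Φ : E → E'} {C κ R : ℝ}
    (hf : AnalyticAt ℂ f 0) (h0 : f 0 = 0) (hc : ContractsOn f C κ R)
    (hF : AnalyticAt ℂ F 0) (hΦ : IsBiholomorphicGerm Φ)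
    (hconj : ∀ᶠ x in 𝓝 0, Φ (f x) = F (Φ x)) :
    ∀ᶠ x in 𝓝 0, x ∈ generalizedCriticalSet f ↔ Φ x ∈ generalizedCriticalSet F := by
  have : CompleteSpace E := FiniteDimensional.complete ℂ E
  have : CompleteSpace E' := FiniteDimensional.complete ℂ E'
  have hft : Tendsto f (𝓝 0) (𝓝 0) := by simpa [h0] using hf.continuousAt.tendsto
  have key : ∀ᶠ x in 𝓝 0, Φ (f x) = F (Φ x) ∧
      ((fderiv ℂ f x).det = 0 ↔ (fderiv ℂ F (Φ x)).det = 0) := by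
    filter_upwards [hconj.eventually_nhds, hΦ.eventually_fderiv, hft.eventually hΦ.eventually_fderiv,
      hf.eventually_analyticAt, hΦ.tendsto.eventually hF.eventually_analyticAt]
      with x h1 ⟨L₁, hL₁⟩ ⟨L₂, hL₂⟩ h4 h5
    refine ⟨h1.self_of_nhds, det_eq_zero_iff_of_conj L₁ L₂ ?_⟩
    have h6 := hL₂.comp x h4.differentiableAt.hasFDerivAt
    have h7 := h5.differentiableAt.hasFDerivAt.comp x hL₁
    exact h6.unique (h7.congr_of_eventuallyEq h1)
  -- The conjugacy is known only near `0`, but contraction keeps the whole orbit there.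
  filter_upwards [hc.eventually_forall_iterate key] with x hx
  have hit : ∀ n, F^[n] (Φ x) = Φ (f^[n] x) := by
    intro n
    induction n with
    | zero => rfl
    | succ n ih => rw [Function.iterate_succ_apply', ih, Function.iterate_succ_apply', (hx n).1]
  simp only [generalizedCriticalSet, Set.mem_ofPred_eq, hit]
  exact exists_congr fun n => (hx n).2

/-! ### Cohomological equations over a contraction -/

open Asymptotics

theorem ContractsOn.analyticOnNhd_iterate {E : Type*} [NormedAddCommGroup E] [NormedSpace ℂ E]
    {f : E → E} {C κ R δ : ℝ} (hc : ContractsOn f C κ R)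
    (hf : AnalyticOnNhd ℂ f (Metric.closedBall 0 (C * δ))) (hδ : δ ≤ R) (n : ℕ) :
    AnalyticOnNhd ℂ f^[n] (Metric.closedBall 0 δ) := by
  induction n with
  | zero => exact analyticOnNhd_id
  | succ n ih =>
    rw [Function.iterate_succ']
    refine hf.comp ih fun x hx => ?_
    rw [mem_closedBall_zero_iff] at hx ⊢
    refine (hc.norm_iterate_le x (hx.trans hδ) n).trans ?_
    have hC := hc.C_pos
    calc C * κ ^ n * ‖x‖ ≤ C * 1 * δ := by
          gcongr; exact pow_le_one₀ hc.κ_pos.le hc.κ_lt_one.le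
      _ = C * δ := by ring

/-- The cohomological equation `Δ = N (ψ + Δ ∘ f)` has an analytic solution when `ψ` vanishes to
an order `K` such that `‖N‖ κ ^ K < 1`, `κ` being the contraction rate of `f`. -/
theorem exists_cohomological {d r : ℕ} {f : (Fin d → ℂ) → (Fin d → ℂ)} {C κ R : ℝ}
    (hc : ContractsOn f C κ R) (hf : AnalyticAt ℂ f 0) (h0 : f 0 = 0)
    {ψ : (Fin d → ℂ) → (Fin r → ℂ)} (hψ : AnalyticAt ℂ ψ 0) {K : ℕ}
    (hO : ψ =O[𝓝 0] fun x => ‖x‖ ^ K) (N : (Fin r → ℂ) →L[ℂ] (Fin r → ℂ))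
    (hN : ‖N‖ * κ ^ K < 1) :
    ∃ Δ : (Fin d → ℂ) → (Fin r → ℂ), AnalyticAt ℂ Δ 0 ∧ (Δ =O[𝓝 0] fun x => ‖x‖ ^ K) ∧
      ∀ᶠ x in 𝓝 0, Δ x = N (ψ x + Δ (f x)) := by
  obtain ⟨B, hB0, hB⟩ := hO.exists_pos
  obtain ⟨R₁, hR₁, hfA⟩ := exists_analyticOnNhd_closedBall hf
  obtain ⟨R₂, hR₂, hψA⟩ := exists_analyticOnNhd_closedBall hψ
  obtain ⟨R₃, hR₃, hψB⟩ := Metric.eventually_nhds_iff_ball.1 hB.bound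
  have hC := hc.C_pos
  have hR := hc.R_pos
  have hκ := hc.κ_pos
  -- Orbits starting in the `δ`-ball remain in the `C δ`-ball, which must lie where `f` and `ψ` are
  -- analytic and where the bound on `ψ` holds.
  obtain ⟨δ, hδ, hδR, hδ1, hδ2, hδ3⟩ : ∃ δ > 0, δ ≤ R ∧ C * δ ≤ R₁ ∧ C * δ ≤ R₂ ∧ C * δ < R₃ := by
    refine ⟨min R (min (R₁ / C) (min (R₂ / C) (R₃ / C / 2))), by positivity, min_le_left _ _,
      ?_, ?_, ?_⟩
    · rw [mul_comm, ← le_div_iff₀ hC]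
      exact (min_le_right _ _).trans (min_le_left _ _)
    · rw [mul_comm, ← le_div_iff₀ hC]
      exact (min_le_right _ _).trans ((min_le_right _ _).trans (min_le_left _ _))
    · rw [mul_comm, ← lt_div_iff₀ hC]
      refine ((min_le_right _ _).trans ((min_le_right _ _).trans (min_le_right _ _))).trans_lt ?_
      exact half_lt_self (by positivity)
  have horb : ∀ x : Fin d → ℂ, ‖x‖ ≤ δ → ∀ n, ‖f^[n] x‖ ≤ C * δ := fun x hx n =>
    (hc.norm_iterate_le x (hx.trans hδR) n).trans <|
      calc C * κ ^ n * ‖x‖ ≤ C * 1 * δ := by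
            gcongr; exact pow_le_one₀ hκ.le hc.κ_lt_one.le
        _ = C * δ := by ring
  -- Unrolling the equation gives `Δ = ∑ N ^ (n + 1) (ψ ∘ f^[n])`, whose terms decay with ratio `‖N‖
  -- κ ^ K`.
  let F : ℕ → (Fin d → ℂ) → (Fin r → ℂ) := fun n x => (N ^ (n + 1)) (ψ (f^[n] x))
  have hFA : ∀ n, AnalyticOnNhd ℂ (F n) (Metric.closedBall 0 δ) := by
    intro n x hx
    have h1 := hc.analyticOnNhd_iterate (hfA.mono (Metric.closedBall_subset_closedBall hδ1)) hδR n
      x hx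
    have h2 := hψA (f^[n] x) (mem_closedBall_zero_iff.2
      ((horb x (mem_closedBall_zero_iff.1 hx) n).trans hδ2))
    exact ((N ^ (n + 1)).analyticAt _).comp (h2.comp h1)
  set A : ℝ := ‖N‖ * B * C ^ K with hA
  have hFb : ∀ n, ∀ x : Fin d → ℂ, ‖x‖ ≤ δ → ‖F n x‖ ≤ A * ‖x‖ ^ K * (‖N‖ * κ ^ K) ^ n := by
    intro n x hx
    have h1 := hψB (f^[n] x) (mem_ball_zero_iff.2 ((horb x hx n).trans_lt hδ3))
    rw [norm_pow, norm_norm] at h1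
    calc ‖F n x‖ ≤ ‖N ^ (n + 1)‖ * ‖ψ (f^[n] x)‖ := (N ^ (n + 1)).le_opNorm _
      _ ≤ ‖N‖ ^ (n + 1) * (B * (C * κ ^ n * ‖x‖) ^ K) := by
          refine mul_le_mul (norm_pow_le' _ n.succ_pos) (h1.trans ?_) (norm_nonneg _)
            (by positivity)
          gcongr
          exact hc.norm_iterate_le x (hx.trans hδR) n
      _ = A * ‖x‖ ^ K * (‖N‖ * κ ^ K) ^ n := by
          rw [hA, mul_pow, mul_pow, mul_pow, ← pow_mul, ← pow_mul, pow_succ, mul_comm n K]; ring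
  have hq0 : 0 ≤ ‖N‖ * κ ^ K := by positivity
  have hgeo := summable_geometric_of_lt_one hq0 hN
  have hsum : ∀ x : Fin d → ℂ, ‖x‖ ≤ δ → Summable fun n => F n x := fun x hx =>
    Summable.of_norm_bounded (hgeo.mul_left _) fun n => hFb n x hx
  have hAnn : 0 ≤ A := by positivity
  refine ⟨fun x => ∑' n, F n x, ?_, ?_, ?_⟩
  · rw [analyticAt_pi_iff]
    intro i
    have h1 : AnalyticAt ℂ (fun x => ∑' n, F n x i) 0 := by
      refine analyticAt_tsum_of_summable_norm hδ (hgeo.mul_left (A * δ ^ K)) (fun n x hx => ?_)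
        fun n x hx => ?_
      · exact analyticAt_pi_iff.1 (hFA n x hx) i
      · rw [mem_closedBall_zero_iff] at hx
        refine (norm_le_pi_norm (F n x) i).trans ((hFb n x hx).trans ?_)
        gcongr
    refine h1.congr ?_
    filter_upwards [Metric.closedBall_mem_nhds (0 : Fin d → ℂ) hδ] with x hx
    exact (tsum_apply (hsum x (mem_closedBall_zero_iff.1 hx))).symm
  · refine IsBigO.of_bound (A * (1 - ‖N‖ * κ ^ K)⁻¹) ?_
    filter_upwards [Metric.closedBall_mem_nhds (0 : Fin d → ℂ) hδ] with x hx
    have hx' := mem_closedBall_zero_iff.1 hx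
    rw [norm_pow, norm_norm]
    refine (tsum_of_norm_bounded ((hasSum_geometric_of_lt_one hq0 hN).mul_left (A * ‖x‖ ^ K))
      fun n => hFb n x hx').trans (le_of_eq ?_)
    ring
  · have hft : Tendsto f (𝓝 0) (𝓝 0) := by simpa [h0] using hf.continuousAt.tendsto
    filter_upwards [Metric.closedBall_mem_nhds (0 : Fin d → ℂ) hδ,
      hft (Metric.closedBall_mem_nhds (0 : Fin d → ℂ) hδ)] with x hx hfx
    have hx' := mem_closedBall_zero_iff.1 hx
    have hfx' := mem_closedBall_zero_iff.1 hfx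
    rw [(hsum x hx').tsum_eq_zero_add, map_add, N.map_tsum (hsum _ hfx')]
    simp only [F, Function.iterate_succ_apply, zero_add, pow_one, Function.iterate_zero, id_eq]
    congr 2
    ext1 n
    rw [pow_succ' N (n + 1)]
    rfl

/-- `φ ∘ f - λ φ = ψ` is solvable for `ψ` vanishing to sufficiently high order. -/
theorem exists_comp_sub_smul_eq {d : ℕ} {f : (Fin d → ℂ) → (Fin d → ℂ)} {C κ R : ℝ}
    (hc : ContractsOn f C κ R) (hf : AnalyticAt ℂ f 0) (h0 : f 0 = 0)
    {ψ : (Fin d → ℂ) → ℂ} (hψ : AnalyticAt ℂ ψ 0) {K : ℕ}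
    (hO : ψ =O[𝓝 0] fun x => ‖x‖ ^ K) {a : ℂ} (ha : κ ^ K < ‖a‖) :
    ∃ Δ : (Fin d → ℂ) → ℂ, AnalyticAt ℂ Δ 0 ∧ (Δ =O[𝓝 0] fun x => ‖x‖ ^ K) ∧
      ∀ᶠ x in 𝓝 0, Δ (f x) - a * Δ x = ψ x := by
  have hκ := hc.κ_pos
  have ha0 : 0 < ‖a‖ := lt_trans (by positivity) ha
  have hane : a ≠ 0 := norm_pos_iff.1 ha0
  -- The equation is rewritten as `Δ = a⁻¹ (-ψ + Δ ∘ f)`.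
  obtain ⟨Δ, h1, h2, h3⟩ := exists_cohomological hc hf h0 (ψ := fun x (_ : Fin 1) => -ψ x) (K := K)
    (analyticAt_pi_iff.2 fun _ => hψ.neg) (isBigO_pi.2 fun _ => hO.neg_left)
    (a⁻¹ • ContinuousLinearMap.id ℂ _) (by
      have h1 : ‖a⁻¹ • ContinuousLinearMap.id ℂ (Fin 1 → ℂ)‖ ≤ ‖a‖⁻¹ := by
        rw [norm_smul, norm_inv]
        exact mul_le_of_le_one_right (by positivity) ContinuousLinearMap.norm_id_le
      calc _ ≤ ‖a‖⁻¹ * κ ^ K := by gcongr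
        _ < ‖a‖⁻¹ * ‖a‖ := by gcongr
        _ = 1 := inv_mul_cancel₀ ha0.ne')
  refine ⟨fun x => Δ x 0, analyticAt_pi_iff.1 h1 0, isBigO_pi.1 h2 0, h3.mono fun x hx => ?_⟩
  have h4 := congrFun hx 0
  simp only [_root_.smul_apply, ContinuousLinearMap.id_apply, Pi.smul_apply, Pi.add_apply,
    smul_eq_mul] at h4
  beta_reduce
  rw [h4]
  field_simp
  ring

/-- Along an orbit `φ` is multiplied by `a` at each step, while the vanishing order forces decay at
rate `κ ^ K`. As `κ ^ K < ‖a‖`, comparing the two after `n` steps leaves only `φ x = 0`. -/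
theorem eventually_eq_zero_of_comp_eq_smul {d : ℕ} {f : (Fin d → ℂ) → (Fin d → ℂ)} {C κ R : ℝ}
    (hc : ContractsOn f C κ R) {φ : (Fin d → ℂ) → ℂ} {K : ℕ}
    (hO : φ =O[𝓝 0] fun x => ‖x‖ ^ K) {a : ℂ} (ha : κ ^ K < ‖a‖)
    (h : ∀ᶠ x in 𝓝 0, φ (f x) = a * φ x) : ∀ᶠ x in 𝓝 0, φ x = 0 := by
  obtain ⟨B, hB0, hB⟩ := hO.exists_pos
  have hκ := hc.κ_pos
  have ha0 : 0 < ‖a‖ := lt_trans (by positivity) ha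
  filter_upwards [hc.eventually_forall_iterate (h.and hB.bound),
    Metric.closedBall_mem_nhds (0 : Fin d → ℂ) hc.R_pos] with x hx hxR
  have hxR' := mem_closedBall_zero_iff.1 hxR
  have hit : ∀ n, φ (f^[n] x) = a ^ n * φ x := by
    intro n
    induction n with
    | zero => simp
    | succ n ih => rw [Function.iterate_succ_apply', (hx n).1, ih]; ring
  have hb : ∀ n : ℕ, ‖φ x‖ ≤ B * (C * ‖x‖) ^ K * (κ ^ K / ‖a‖) ^ n := by
    intro n
    have h1 := (hx n).2
    rw [hit, norm_mul, norm_pow, norm_pow, norm_norm] at h1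
    have h2 : ‖a‖ ^ n * ‖φ x‖ ≤ B * (C * κ ^ n * ‖x‖) ^ K := by
      refine h1.trans ?_
      gcongr
      exact hc.norm_iterate_le x hxR' n
    rw [div_pow, ← mul_div_assoc, le_div_iff₀ (by positivity)]
    calc ‖φ x‖ * ‖a‖ ^ n = ‖a‖ ^ n * ‖φ x‖ := mul_comm _ _
      _ ≤ _ := h2
      _ = _ := by rw [mul_pow, mul_pow, mul_pow, ← pow_mul, ← pow_mul, mul_comm n K]; ring
  have ht : Tendsto (fun n : ℕ => B * (C * ‖x‖) ^ K * (κ ^ K / ‖a‖) ^ n) atTop (𝓝 0) := by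
    have := (tendsto_pow_atTop_nhds_zero_of_lt_one (by positivity)
      ((div_lt_one ha0).2 ha)).const_mul (B * (C * ‖x‖) ^ K)
    simpa using this
  exact norm_le_zero_iff.1 (ge_of_tendsto' ht hb)

/-! ### Germs vanishing only on coordinate hyperplanes -/

/-- A zero of an analytic function that is isolated on a line persists on nearby lines. -/
theorem eventually_exists_zero_on_line {E : Type*} [NormedAddCommGroup E] [NormedSpace ℂ E]
    {φ : E → ℂ} (hφ : AnalyticAt ℂ φ 0) (h0 : φ 0 = 0) {v : E}
    (hv : ¬ ∀ᶠ ζ : ℂ in 𝓝 0, φ (ζ • v) = 0) {ε : ℝ} (hε : 0 < ε) :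
    ∀ᶠ a in 𝓝 0, ∃ ζ : ℂ, ‖ζ‖ < ε ∧ φ (a + ζ • v) = 0 := by
  have hline : ∀ a : E, Continuous fun ζ : ℂ => a + ζ • v := fun a => by fun_prop
  have hg : AnalyticAt ℂ (fun ζ : ℂ => φ (ζ • v)) 0 := by
    refine AnalyticAt.comp (g := φ) (by simpa using hφ) ?_
    exact ((ContinuousLinearMap.id ℂ ℂ).smulRight v).analyticAt 0
  have hne := hg.eventually_eq_zero_or_eventually_ne_zero.resolve_left hv
  obtain ⟨R, hR, hA⟩ := exists_analyticOnNhd_closedBall hφ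
  obtain ⟨ρ₁, hρ₁, hne'⟩ := Metric.eventually_nhds_iff_ball.1 (eventually_nhdsWithin_iff.1 hne)
  obtain ⟨ρ, hρ, hρε, hρ1, hρR⟩ : ∃ ρ > 0, ρ < ε ∧ ρ < ρ₁ ∧ ρ * (‖v‖ + 1) < R := by
    refine ⟨min ε (min ρ₁ (R / (‖v‖ + 1))) / 2, by positivity, ?_, ?_, ?_⟩
    · exact (half_lt_self (by positivity)).trans_le (min_le_left _ _)
    · exact (half_lt_self (by positivity)).trans_le ((min_le_right _ _).trans (min_le_left _ _))
    · rw [← lt_div_iff₀ (by positivity)]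
      exact (half_lt_self (by positivity)).trans_le ((min_le_right _ _).trans (min_le_right _ _))
  have hAline : ∀ a : E, ‖a‖ ≤ R - ρ * (‖v‖ + 1) → ∀ ζ : ℂ, ‖ζ‖ ≤ ρ →
      AnalyticAt ℂ φ (a + ζ • v) := by
    intro a ha ζ hζ
    refine hA _ (mem_closedBall_zero_iff.2 ((norm_add_le _ _).trans ?_))
    have : ‖ζ • v‖ ≤ ρ * ‖v‖ := by rw [norm_smul]; gcongr
    linarith
  have hcont : ContinuousOn (fun ζ : ℂ => ‖φ (ζ • v)‖) (Metric.sphere 0 ρ) := by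
    intro ζ hζ
    have h1 := (hAline 0 (by simpa using hρR.le) ζ (mem_sphere_zero_iff_norm.1 hζ).le).continuousAt
    rw [zero_add] at h1
    exact (ContinuousAt.comp (f := fun ζ : ℂ => ζ • v) (g := φ) h1 (by fun_prop)).norm.continuousWithinAt
  obtain ⟨ζ₀, hζ₀, hmin⟩ := (isCompact_sphere (0 : ℂ) ρ).exists_isMinOn
    (NormedSpace.sphere_nonempty.2 hρ.le) hcont
  -- The minimum of `‖φ‖` on a circle of the central line. On nearby lines the values stay above `m
  -- / 2` on the circle and below `m / 2` at its centre.
  set m := ‖φ (ζ₀ • v)‖ with hm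
  have hmpos : 0 < m := by
    rw [hm, norm_pos_iff]
    have h1 := mem_sphere_zero_iff_norm.1 hζ₀
    refine hne' ζ₀ (by simpa [h1] using hρ1) ?_
    rintro rfl
    rw [norm_zero] at h1
    exact hρ.ne h1
  have hsph : ∀ᶠ a in 𝓝 (0 : E), ∀ ζ ∈ Metric.sphere (0 : ℂ) ρ, m / 2 < ‖φ (a + ζ • v)‖ := by
    refine (isCompact_sphere (0 : ℂ) ρ).eventually_forall_of_forall_eventually fun ζ hζ => ?_
    have h1 := (hAline 0 (by simpa using hρR.le) ζ (mem_sphere_zero_iff_norm.1 hζ).le).continuousAt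
    have h2 : ContinuousAt (fun p : E × ℂ => ‖φ (p.1 + p.2 • v)‖) (0, ζ) :=
      (ContinuousAt.comp (f := fun p : E × ℂ => p.1 + p.2 • v) (g := φ) h1 (by fun_prop)).norm
    refine h2.eventually (lt_mem_nhds ?_)
    have := isMinOn_iff.1 hmin ζ hζ
    simp only [zero_add]
    linarith
  have hsmall : ∀ᶠ a in 𝓝 (0 : E), ‖φ a‖ < m / 2 := by
    refine hφ.continuousAt.norm.eventually (gt_mem_nhds ?_)
    beta_reduce
    rw [h0, norm_zero]
    exact half_pos hmpos
  filter_upwards [hsph, hsmall, Metric.closedBall_mem_nhds (0 : E) (sub_pos.2 hρR)]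
    with a h1 h2 h3
  -- Without a zero, `1 / φ` would be holomorphic on the disc, and the maximum principle would bound
  -- it at the centre by `(m / 2)⁻¹`.
  by_contra! hno
  have hne0 : ∀ ζ : ℂ, ‖ζ‖ ≤ ρ → φ (a + ζ • v) ≠ 0 := fun ζ hζ => hno ζ (hζ.trans_lt hρε)
  have hd : ∀ ζ : ℂ, ‖ζ‖ ≤ ρ → DifferentiableAt ℂ (fun ζ : ℂ => (φ (a + ζ • v))⁻¹) ζ := by
    intro ζ hζ
    have h4 := (hAline a (mem_closedBall_zero_iff.1 h3) ζ hζ).differentiableAt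
    exact (DifferentiableAt.comp (g := φ) ζ h4 (by fun_prop)).inv (hne0 ζ hζ)
  have hdc : DiffContOnCl ℂ (fun ζ : ℂ => (φ (a + ζ • v))⁻¹) (Metric.ball 0 ρ) := by
    refine DifferentiableOn.diffContOnCl fun ζ hζ => ?_
    rw [closure_ball _ hρ.ne'] at hζ
    exact (hd ζ (mem_closedBall_zero_iff.1 hζ)).differentiableWithinAt
  have hmax := Complex.norm_le_of_forall_mem_frontier_norm_le Metric.isBounded_ball hdc
    (C := (m / 2)⁻¹) (fun ζ hζ => by
      rw [frontier_ball _ hρ.ne'] at hζ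
      rw [norm_inv]
      exact inv_anti₀ (by positivity) (h1 ζ hζ).le) (z := 0)
    (subset_closure (Metric.mem_ball_self hρ))
  rw [zero_smul, add_zero, norm_inv, inv_le_inv₀ _ (by positivity)] at hmax
  · linarith
  · exact norm_pos_iff.2 (by simpa using hne0 0 (by simpa using hρ.le))

/-- A nonzero analytic germ is nonzero on some line that is not contained in a coordinate
hyperplane. -/
theorem exists_line_not_eventually_zero {d : ℕ} {φ : (Fin d → ℂ) → ℂ} (hφ : AnalyticAt ℂ φ 0)
    (hne : ¬ ∀ᶠ x in 𝓝 0, φ x = 0) :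
    ∃ v : Fin d → ℂ, (∀ i, v i ≠ 0) ∧ ¬ ∀ᶠ ζ : ℂ in 𝓝 0, φ (ζ • v) = 0 := by
  have hcoord : ∀ i : Fin d, AnalyticAt ℂ (fun x : Fin d → ℂ => x i) 0 := fun i =>
    (ContinuousLinearMap.proj (R := ℂ) (φ := fun _ : Fin d => ℂ) i).analyticAt 0
  have hcne : ∀ i : Fin d, ¬ ∀ᶠ x : Fin d → ℂ in 𝓝 0, x i = 0 := by
    intro i h
    have ht : Tendsto (fun ζ : ℂ => (fun _ : Fin d => ζ)) (𝓝 0) (𝓝 0) :=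
      (continuous_pi fun _ => continuous_id).tendsto' _ _ rfl
    obtain ⟨ζ, h1, h2⟩ := ((ht.eventually h).filter_mono nhdsWithin_le_nhds |>.and
      (self_mem_nhdsWithin (a := (0 : ℂ)) (s := {0}ᶜ))).exists
    exact h2 h1
  -- Multiplying by all coordinates makes a single non-vanishing point supply both a line on which
  -- `φ` is non-zero and a direction with no zero coordinate.
  have hprod : ¬ ∀ᶠ x : Fin d → ℂ in 𝓝 0, φ x * ∏ i, x i = 0 := by
    intro h
    rcases eventually_eq_zero_or_of_mul hφ
      (Finset.analyticAt_fun_prod _ fun i _ => hcoord i) h with h1 | h1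
    · exact hne h1
    · obtain ⟨i, -, hi⟩ := exists_eventually_eq_zero_of_prod _ (fun i _ => hcoord i) h1
      exact hcne i hi
  obtain ⟨R, hR, hA⟩ := exists_analyticOnNhd_closedBall hφ
  have hfr : ∃ᶠ x : Fin d → ℂ in 𝓝 0, φ x * ∏ i, x i ≠ 0 := by
    rw [Filter.Frequently]; simpa only [not_not] using hprod
  obtain ⟨v, hv, hvR⟩ := (hfr.and_eventually (Metric.ball_mem_nhds 0 hR)).exists
  refine ⟨v, fun i => Finset.prod_ne_zero_iff.1 (right_ne_zero_of_mul hv) i (Finset.mem_univ i),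
    fun h => left_ne_zero_of_mul hv ?_⟩
  have hmaps : Set.MapsTo (fun ζ : ℂ => ζ • v) (Metric.closedBall 0 1) (Metric.closedBall 0 R) := by
    intro ζ hζ
    rw [mem_closedBall_zero_iff] at hζ ⊢
    rw [norm_smul]
    have := mem_ball_zero_iff.1 hvR
    nlinarith [norm_nonneg v]
  have hg : AnalyticOnNhd ℂ (fun ζ : ℂ => φ (ζ • v)) (Metric.closedBall 0 1) :=
    hA.comp (fun ζ _ => ((ContinuousLinearMap.id ℂ ℂ).smulRight v).analyticAt ζ) hmaps
  have := hg.eqOn_zero_of_preconnected_of_eventuallyEq_zero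
    (convex_closedBall 0 1).isPreconnected (Metric.mem_closedBall_self zero_le_one) h
    (show (1 : ℂ) ∈ _ by simp)
  simpa using this

/-- On a line where `φ` does not vanish identically it has a finite order `n` at `0`, so `φ` cannot
be `O(‖x‖ ^ (n + 1))`. -/
theorem exists_not_isBigO_norm_pow {d : ℕ} {φ : (Fin d → ℂ) → ℂ} (hφ : AnalyticAt ℂ φ 0)
    (hne : ¬ ∀ᶠ x in 𝓝 0, φ x = 0) : ∃ m : ℕ, ¬ φ =O[𝓝 0] fun x => ‖x‖ ^ m := by
  obtain ⟨v, -, hv⟩ := exists_line_not_eventually_zero hφ hne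
  have hg : AnalyticAt ℂ (fun ζ : ℂ => φ (ζ • v)) 0 := by
    refine AnalyticAt.comp (g := φ) (by simpa using hφ) ?_
    exact ((ContinuousLinearMap.id ℂ ℂ).smulRight v).analyticAt 0
  obtain ⟨n, h, hh, hh0, heq⟩ := hg.exists_eventuallyEq_pow_smul_nonzero_iff.2 hv
  refine ⟨n + 1, fun hO => hh0 ?_⟩
  have ht : Tendsto (fun ζ : ℂ => ζ • v) (𝓝 0) (𝓝 0) :=
    (continuous_id.smul continuous_const).tendsto' _ _ (by simp)
  obtain ⟨B, hB0, hB⟩ := (hO.comp_tendsto ht).exists_pos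
  have hlim : Tendsto (fun ζ : ℂ => ‖h ζ‖) (𝓝[≠] 0) (𝓝 ‖h 0‖) :=
    hh.continuousAt.norm.tendsto.mono_left nhdsWithin_le_nhds
  have hlim0 : Tendsto (fun ζ : ℂ => B * ‖v‖ ^ (n + 1) * ‖ζ‖) (𝓝[≠] 0) (𝓝 0) := by
    have : Continuous fun ζ : ℂ => B * ‖v‖ ^ (n + 1) * ‖ζ‖ := by fun_prop
    exact (this.tendsto' 0 0 (by simp)).mono_left nhdsWithin_le_nhds
  refine norm_le_zero_iff.1 (le_of_tendsto_of_tendsto hlim hlim0 ?_)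
  filter_upwards [heq.filter_mono nhdsWithin_le_nhds, hB.bound.filter_mono nhdsWithin_le_nhds,
    self_mem_nhdsWithin] with ζ h1 h2 h3
  have hpos : 0 < ‖ζ‖ := norm_pos_iff.2 h3
  simp only [Function.comp_apply] at h2
  rw [h1, norm_smul, sub_zero, norm_pow, norm_pow, norm_norm, norm_smul, mul_pow] at h2
  refine le_of_mul_le_mul_left (h2.trans (le_of_eq ?_)) (pow_pos hpos n)
  ring

/-- Every line near `0` in a suitable direction `v` contains a zero of `φ`, which lies on some
hyperplane `x i = 0` with `i ∈ I`, hence is the projection `P i` of the base point along `v`. So the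
product of the `φ ∘ P i` vanishes identically, one factor does because germs form a domain, and `P
i` is the identity on its hyperplane. -/
theorem exists_eventually_update_eq_zero {d : ℕ} {φ : (Fin d → ℂ) → ℂ} (hφ : AnalyticAt ℂ φ 0)
    (hne : ¬ ∀ᶠ x in 𝓝 0, φ x = 0) (h0 : φ 0 = 0) {I : Finset (Fin d)}
    (hz : ∀ᶠ x in 𝓝 0, φ x = 0 → ∃ i ∈ I, x i = 0) :
    ∃ i ∈ I, ∀ᶠ x in 𝓝 0, φ (Function.update x i 0) = 0 := by
  obtain ⟨v, hv, hvl⟩ := exists_line_not_eventually_zero hφ hne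
  let P : Fin d → (Fin d → ℂ) →L[ℂ] (Fin d → ℂ) := fun i => ContinuousLinearMap.id ℂ _ -
    ((v i)⁻¹ • ContinuousLinearMap.proj (R := ℂ) (φ := fun _ : Fin d => ℂ) i).smulRight v
  have hP : ∀ i x, P i x = x + (-(x i / v i)) • v := fun i x => by
    simp [P, div_eq_inv_mul, sub_eq_add_neg]
  have hPA : ∀ i, AnalyticAt ℂ (fun x => φ (P i x)) 0 := fun i =>
    AnalyticAt.comp (g := φ) (by simpa using hφ) ((P i).analyticAt 0)
  have hprod : ∀ᶠ x in 𝓝 0, ∏ i ∈ I, φ (P i x) = 0 := by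
    obtain ⟨δ, hδ, hb⟩ := Metric.eventually_nhds_iff_ball.1 hz
    filter_upwards [eventually_exists_zero_on_line hφ h0 hvl
      (show 0 < δ / 2 / (‖v‖ + 1) by positivity), Metric.ball_mem_nhds (0 : Fin d → ℂ)
      (half_pos hδ)] with x ⟨ζ, h1, h2⟩ h3
    obtain ⟨i, hi, hi'⟩ := hb (x + ζ • v) (by
      rw [mem_ball_zero_iff] at h3 ⊢
      refine (norm_add_le _ _).trans_lt ?_
      rw [norm_smul]
      rw [lt_div_iff₀ (by positivity)] at h1
      nlinarith [norm_nonneg ζ, norm_nonneg v]) h2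
    refine Finset.prod_eq_zero hi ?_
    rw [hP]
    have h4 : ζ = -(x i / v i) := by
      simp only [Pi.add_apply, Pi.smul_apply, smul_eq_mul] at hi'
      rw [eq_neg_iff_add_eq_zero, ← mul_left_inj' (hv i), add_mul, div_mul_cancel₀ _ (hv i)]
      linear_combination hi'
    rwa [← h4]
  obtain ⟨i, hi, h⟩ := exists_eventually_eq_zero_of_prod I (fun i _ => hPA i) hprod
  refine ⟨i, hi, ?_⟩
  have ht : Tendsto (fun x : Fin d → ℂ => Function.update x i 0) (𝓝 0) (𝓝 0) := by
    have : Continuous fun x : Fin d → ℂ => Function.update x i 0 := by fun_prop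
    exact this.tendsto' _ _ (by simp)
  filter_upwards [ht.eventually h] with x hx
  simpa [hP] using hx

/-- An analytic germ whose zeros lie in a union of coordinate hyperplanes is the product of a
monomial and a unit. -/
theorem exists_eq_unit_mul_monomial {d : ℕ} {I : Finset (Fin d)} {φ : (Fin d → ℂ) → ℂ}
    (hφ : AnalyticAt ℂ φ 0) (hne : ¬ ∀ᶠ x in 𝓝 0, φ x = 0)
    (hz : ∀ᶠ x in 𝓝 0, φ x = 0 → ∃ i ∈ I, x i = 0) :
    ∃ (n : Fin d → ℕ) (ε : (Fin d → ℂ) → ℂ), AnalyticAt ℂ ε 0 ∧ ε 0 ≠ 0 ∧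
      ∀ᶠ x in 𝓝 0, φ x = ε x * ∏ i ∈ I, x i ^ n i := by
  obtain ⟨m, hm⟩ := exists_not_isBigO_norm_pow hφ hne
  clear hne
  -- The exponent `m` measures progress: a factor `x i` divided off lowers it by one. It cannot
  -- reach `0`, as every continuous function is `O(1)`.
  induction m generalizing φ with
  | zero => exact absurd (by simpa using hφ.continuousAt.tendsto.isBigO_one ℝ) hm
  | succ m ih =>
    by_cases h0 : φ 0 = 0
    · have hne : ¬ ∀ᶠ x in 𝓝 0, φ x = 0 := fun h =>
        hm (IsBigO.of_bound 0 (h.mono fun x hx => by simp [hx]))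
      obtain ⟨i, hi, hup⟩ := exists_eventually_update_eq_zero hφ hne h0 hz
      obtain ⟨ψ, hψ, heq⟩ := exists_sub_update_eq hφ i
      have heq' : ∀ᶠ x in 𝓝 0, φ x = x i * ψ x := by
        filter_upwards [hup, heq] with x h1 h2
        rwa [h1, sub_zero] at h2
      obtain ⟨n, ε, hε, hε0, h⟩ := ih hψ
        (by
          filter_upwards [heq', hz] with x h1 h2 h3
          exact h2 (by rw [h1, h3, mul_zero]))
        (fun hO => hm <| by
          have h1 : (fun x : Fin d → ℂ => x i) =O[𝓝 0] fun x => ‖x‖ :=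
            IsBigO.of_bound 1 (Eventually.of_forall fun x => by simpa using norm_le_pi_norm x i)
          exact (h1.mul hO).congr' (heq'.mono fun x hx => hx.symm)
            (Eventually.of_forall fun x => (pow_succ' _ _).symm))
      refine ⟨n + Pi.single i 1, ε, hε, hε0, ?_⟩
      filter_upwards [heq', h] with x h1 h2
      have h3 : ∏ j ∈ I, x j ^ (Pi.single i 1 : Fin d → ℕ) j = x i := by
        rw [Finset.prod_eq_single_of_mem i hi (fun j _ hj => by simp [hj])]
        simp
      simp only [Pi.add_apply, pow_add, Finset.prod_mul_distrib, h3]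
      rw [h1, h2]; ring
    · exact ⟨0, φ, hφ, h0, Eventually.of_forall fun x => by simp⟩

theorem IsBiholomorphicGerm.exists_eq_unit_mul_monomial {d : ℕ} {I : Finset (Fin d)}
    {φ : (Fin d → ℂ) → ℂ} {c : (Fin d → ℂ) → (Fin d → ℂ)} (hc : IsBiholomorphicGerm c)
    (hφ : AnalyticAt ℂ φ 0) (hne : ¬ ∀ᶠ x in 𝓝 0, φ x = 0)
    (hz : ∀ᶠ x in 𝓝 0, φ x = 0 → ∃ i ∈ I, c x i = 0) :
    ∃ (n : Fin d → ℕ) (ε : (Fin d → ℂ) → ℂ), AnalyticAt ℂ ε 0 ∧ ε 0 ≠ 0 ∧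
      ∀ᶠ x in 𝓝 0, φ x = ε x * ∏ i ∈ I, c x i ^ n i := by
  obtain ⟨b, hb, hbc, hcb⟩ := hc.exists_inverse
  obtain ⟨n, ε, hε, hε0, h⟩ := RigidGerm.exists_eq_unit_mul_monomial (φ := φ ∘ b) (I := I)
    (AnalyticAt.comp (by simpa [hb.map_zero] using hφ) hb.analyticAt)
    (fun h => hne <| by
      filter_upwards [hc.tendsto.eventually h, hbc] with x h1 h2
      simpa [h2] using h1)
    (by
      filter_upwards [hb.tendsto.eventually hz, hcb] with y h1 h2 h3
      simpa [h2] using h1 h3)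
  refine ⟨n, ε ∘ c, AnalyticAt.comp (by simpa [hc.map_zero] using hε) hc.analyticAt,
    by simpa [hc.map_zero] using hε0, ?_⟩
  filter_upwards [hc.tendsto.eventually h, hbc] with x h1 h2
  simpa [h2] using h1

/-! ### Periodic indices of a matrix over `ℕ` -/

section Combinatorics

variable {ι : Type*} [Fintype ι] [DecidableEq ι]

/-- The hyperplane `i` is periodic under the action given by the columns of `A`. -/
def IsPeriodicIndex (A : Matrix ι ι ℕ) (i : ι) : Prop :=
  ∃ m : ℕ, 1 ≤ m ∧ (A ^ m).col i = Pi.single i 1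

theorem col_pow_add {A : Matrix ι ι ℕ} {a : ℕ} {i k : ι} (h : (A ^ a).col i = Pi.single k 1)
    (b : ℕ) : (A ^ (b + a)).col i = (A ^ b).col k := by
  rw [pow_add, ← Matrix.mulVec_single_one, ← Matrix.mulVec_mulVec, Matrix.mulVec_single_one, h,
    Matrix.mulVec_single_one]

theorem one_le_sum_col_pow {A : Matrix ι ι ℕ} (hA : ∀ i, ∃ j, A j i ≠ 0) (n : ℕ) (i : ι) :
    1 ≤ ∑ j, (A ^ n) j i := by
  induction n generalizing i with
  | zero => simp [Matrix.one_apply]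
  | succ n ih =>
    obtain ⟨k, hk⟩ := hA i
    have h1 : ∑ j, (A ^ (n + 1)) j i = ∑ k, (∑ j, (A ^ n) j k) * A k i := by
      simp only [pow_succ, Matrix.mul_apply]
      rw [Finset.sum_comm]
      simp only [Finset.sum_mul]
    rw [h1]
    calc 1 ≤ (∑ j, (A ^ n) j k) * A k i := Nat.mul_pos (ih k) (Nat.pos_of_ne_zero hk)
      _ ≤ _ := Finset.single_le_sum (f := fun k => (∑ j, (A ^ n) j k) * A k i)
          (fun _ _ => Nat.zero_le _) (Finset.mem_univ k)

theorem exists_eq_single_of_sum_eq_one {v : ι → ℕ} (h : ∑ i, v i = 1) :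
    ∃ i, v = Pi.single i 1 := by
  obtain ⟨i, hi⟩ : ∃ i, v i ≠ 0 := by
    by_contra! h0
    simp [h0] at h
  refine ⟨i, ?_⟩
  have h1 := Finset.add_sum_erase Finset.univ v (Finset.mem_univ i)
  have h2 : v i = 1 ∧ ∑ j ∈ Finset.univ.erase i, v j = 0 := by omega
  ext j
  rcases eq_or_ne j i with rfl | hj
  · simpa using h2.1
  · rw [Pi.single_eq_of_ne hj]
    exact Finset.sum_eq_zero_iff.1 h2.2 j (Finset.mem_erase.2 ⟨hj, Finset.mem_univ _⟩)

/-- Column sums: that of `A ^ (m + 1)` at `i` is the sum of the entries of column `i` of `A`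
weighted by column sums of `A ^ m`, which are at least `1`. If the result is `1`, column `i` of `A`
has a single entry `1`. -/
theorem IsPeriodicIndex.exists_col_eq {A : Matrix ι ι ℕ} (hA : ∀ i, ∃ j, A j i ≠ 0) {i : ι}
    (hi : IsPeriodicIndex A i) : ∃ k, A.col i = Pi.single k 1 ∧ IsPeriodicIndex A k := by
  obtain ⟨m, hm, h⟩ := hi
  obtain ⟨m, rfl⟩ := Nat.exists_eq_add_of_le' hm
  have hsum : ∑ j, A j i ≤ 1 := by
    have h1 : ∑ j, (A ^ (m + 1)) j i = 1 := by
      have := congrArg (fun v : ι → ℕ => ∑ j, v j) h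
      simpa [Matrix.col_apply] using this
    rw [← h1]
    have h2 : ∑ j, (A ^ (m + 1)) j i = ∑ k, (∑ j, (A ^ m) j k) * A k i := by
      simp only [pow_succ, Matrix.mul_apply]
      rw [Finset.sum_comm]
      simp only [Finset.sum_mul]
    rw [h2]
    exact Finset.sum_le_sum fun k _ => Nat.le_mul_of_pos_left _ (one_le_sum_col_pow hA m k)
  have hsum' : 1 ≤ ∑ j, A j i := by simpa using one_le_sum_col_pow hA 1 i
  obtain ⟨k, hk⟩ := exists_eq_single_of_sum_eq_one (v := A.col i) (le_antisymm hsum hsum')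
  have hk1 : (A ^ 1).col i = Pi.single k 1 := by rwa [pow_one]
  refine ⟨k, hk, m + 1, hm, ?_⟩
  rw [← col_pow_add hk1, add_comm, col_pow_add h, hk1]

/-- The induced self-map of the periodic indices is injective, because for any two of them a common
iterate fixes both. -/
theorem exists_perm_of_periodic {A : Matrix ι ι ℕ} (hA : ∀ i, ∃ j, A j i ≠ 0) :
    ∃ τ : Equiv.Perm {i // IsPeriodicIndex A i}, ∀ i, A.col i.1 = Pi.single (τ i).1 1 := by
  choose τ hτ hτp using fun i : {i // IsPeriodicIndex A i} => i.2.exists_col_eq hA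
  let T : {i // IsPeriodicIndex A i} → {i // IsPeriodicIndex A i} := fun i => ⟨τ i, hτp i⟩
  have hiter : ∀ n (i : {i // IsPeriodicIndex A i}), (A ^ n).col i.1 = Pi.single (T^[n] i).1 1 := by
    intro n
    induction n with
    | zero => intro i; ext j; simp [Matrix.col_apply, Matrix.one_apply, Pi.single_apply]
    | succ n ih =>
      intro i
      rw [Function.iterate_succ_apply, ← ih (T i)]
      exact col_pow_add (a := 1) (by rw [pow_one]; exact hτ i) n
  have hinj : Function.Injective T := by
    intro i i' h
    obtain ⟨m, hm, h1⟩ := i.2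
    obtain ⟨m', hm', h2⟩ := i'.2
    have hfix : ∀ (i : {i // IsPeriodicIndex A i}) m, (A ^ m).col i = Pi.single i.1 1 →
        T^[m] i = i := by
      intro i m hi
      rw [hiter] at hi
      have := congrFun hi (T^[m] i).1
      rw [Pi.single_eq_same, Pi.single_apply] at this
      exact Subtype.ext (by by_contra hne; simp [hne] at this)
    have e1 : T^[m * m'] i = i := by
      rw [Function.iterate_mul]; exact Function.iterate_fixed (hfix i m h1) _
    have e2 : T^[m * m'] i' = i' := by
      rw [mul_comm, Function.iterate_mul]; exact Function.iterate_fixed (hfix i' m' h2) _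
    obtain ⟨n, hn⟩ := Nat.exists_eq_add_of_le' (Nat.mul_pos hm hm')
    rw [← e1, ← e2, hn, Function.iterate_add_apply, Function.iterate_one, h,
      Function.iterate_add_apply, Function.iterate_one]
  exact ⟨Equiv.ofBijective T (Finite.injective_iff_bijective.1 hinj), fun i => hτ i⟩

/-- Pigeonhole: if all the columns `i` of the powers are basis vectors, two of them coincide, and
the index they share is periodic. In the first case a power of the cotangent map will kill the
differential, in the second it will send it into the periodic span. -/
theorem exists_col_pow_periodic (A : Matrix ι ι ℕ) (i : ι) :
    ∃ n, (∀ k, (A ^ n).col i ≠ Pi.single k 1) ∨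
      ∃ k, IsPeriodicIndex A k ∧ (A ^ n).col i = Pi.single k 1 := by
  by_cases h : ∃ n, ∀ k, (A ^ n).col i ≠ Pi.single k 1
  · exact h.imp fun n hn => Or.inl hn
  · push Not at h
    choose k hk using h
    obtain ⟨a, b, hab, heq⟩ := Finite.exists_ne_map_eq_of_infinite k
    wlog hlt : a < b generalizing a b
    · exact this b a hab.symm heq.symm (lt_of_le_of_ne (not_lt.1 hlt) hab.symm)
    refine ⟨a, Or.inr ⟨k a, ⟨b - a, by omega, ?_⟩, hk a⟩⟩
    rw [← col_pow_add (hk a), Nat.sub_add_cancel hlt.le, hk b, heq]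

theorem submatrix_pow {κ : Type*} [Fintype κ] [DecidableEq κ] (A : Matrix ι ι ℕ) (e : κ ≃ ι)
    (n : ℕ) : A.submatrix e e ^ n = (A ^ n).submatrix e e := by
  induction n with
  | zero => simp
  | succ n ih => rw [pow_succ, ih, pow_succ, ← Matrix.submatrix_mul_equiv _ _ _ e]

/-- Splitting the hyperplanes into periodic and non-periodic ones. -/
theorem exists_internalAction_eq {A : Matrix ι ι ℕ} (hA : ∀ i, ∃ j, A j i ≠ 0) :
    ∃ (r p : ℕ) (e : Fin r ⊕ Fin p ≃ ι) (σ : Equiv.Perm (Fin r))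
      (C : Matrix (Fin r) (Fin p) ℕ) (D : Matrix (Fin p) (Fin p) ℕ),
      A.submatrix e e = internalAction (σ.permMatrix ℕ) C D ∧
      (∀ (j : Fin p) (m : ℕ), 1 ≤ m → (internalAction (σ.permMatrix ℕ) C D ^ m).col (Sum.inr j) ≠
        Pi.single (Sum.inr j) 1) ∧
      ∀ i, ∃ n, (∀ k, (internalAction (σ.permMatrix ℕ) C D ^ n).col i ≠ Pi.single k 1) ∨
        ∃ k, (internalAction (σ.permMatrix ℕ) C D ^ n).col i = Pi.single (Sum.inl k) 1 := by
  classical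
  obtain ⟨τ, hτ⟩ := exists_perm_of_periodic hA
  let eu := Fintype.equivFin {i // IsPeriodicIndex A i}
  let ey := Fintype.equivFin {i // ¬ IsPeriodicIndex A i}
  let e : Fin (Fintype.card {i // IsPeriodicIndex A i}) ⊕
      Fin (Fintype.card {i // ¬ IsPeriodicIndex A i}) ≃ ι :=
    (Equiv.sumCongr eu.symm ey.symm).trans (Equiv.sumCompl _)
  have heu : ∀ i, e (Sum.inl i) = (eu.symm i).1 := fun i => rfl
  have hey : ∀ j, e (Sum.inr j) = (ey.symm j).1 := fun i => rfl
  -- The `1` in column `i` of `σ.permMatrix` sits in row `σ⁻¹ i`, which has to be `τ i`; hence the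
  -- inverse.
  let σ : Equiv.Perm (Fin (Fintype.card {i // IsPeriodicIndex A i})) := (eu.permCongr τ)⁻¹
  let A' := A.submatrix e e
  have hA' : A' = internalAction (σ.permMatrix ℕ) A'.toBlocks₁₂ A'.toBlocks₂₂ := by
    have h11 : A'.toBlocks₁₁ = σ.permMatrix ℕ := by
      ext l i
      have h1 : A (eu.symm l).1 (eu.symm i).1 =
          (Pi.single (τ (eu.symm i)).1 1 : ι → ℕ) (eu.symm l).1 := congrFun (hτ (eu.symm i)) _
      have h2 : (eu.symm l).1 = (τ (eu.symm i)).1 ↔ σ l = i := by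
        rw [Subtype.coe_inj, Equiv.symm_apply_eq, Equiv.Perm.inv_eq_iff_eq, Equiv.permCongr_apply]
      change A (eu.symm l).1 (eu.symm i).1 = _
      rw [h1, Pi.single_apply]
      simp [Equiv.Perm.permMatrix, PEquiv.toMatrix_apply, h2]
    have h21 : A'.toBlocks₂₁ = 0 := by
      ext j i
      have h1 := congrFun (hτ (eu.symm i)) (e (Sum.inr j))
      simp only [Matrix.col_apply] at h1
      simp only [Matrix.toBlocks₂₁, A', Matrix.of_apply, Matrix.submatrix_apply, heu, h1,
        Matrix.zero_apply]
      refine Pi.single_eq_of_ne (fun h => ?_) _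
      rw [hey] at h
      exact (ey.symm j).2 (h ▸ (τ (eu.symm i)).2)
    rw [internalAction, ← h11, ← h21, Matrix.fromBlocks_toBlocks]
  have hcol : ∀ n i k, (A' ^ n).col i = Pi.single k 1 ↔ (A ^ n).col (e i) = Pi.single (e k) 1 := by
    intro n i k
    simp only [A', submatrix_pow]
    constructor
    · intro h
      ext j
      have := congrFun h (e.symm j)
      simpa [Matrix.col_apply, Pi.single_apply, Equiv.symm_apply_eq] using this
    · intro h
      ext j
      have := congrFun h (e j)
      simpa [Matrix.col_apply, Pi.single_apply] using this
  refine ⟨_, _, e, σ, A'.toBlocks₁₂, A'.toBlocks₂₂, hA', ?_, ?_⟩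
  · intro j m hm h
    rw [← hA', hcol] at h
    exact (ey.symm j).2 ⟨m, hm, h⟩
  · intro i
    rw [← hA']
    obtain ⟨n, h | ⟨k, hk, h⟩⟩ := exists_col_pow_periodic A (e i)
    · exact ⟨n, Or.inl fun k hk => h (e k) ((hcol n i k).1 hk)⟩
    · refine ⟨n, Or.inr ⟨eu ⟨k, hk⟩, (hcol _ _ _).2 ?_⟩⟩
      rw [h, heu, Equiv.symm_apply_apply]

end Combinatorics

/-! ### Monomial maps given by a permutation matrix -/

section MonomialMap

variable {r : ℕ}

theorem matPow_permMatrix (σ : Equiv.Perm (Fin r)) (w : Fin r → ℂ) (i : Fin r) :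
    matPow w (σ.permMatrix ℕ) i = w (σ⁻¹ i) := by
  unfold matPow
  rw [Finset.prod_eq_single (σ⁻¹ i)]
  · simp [Equiv.Perm.permMatrix, PEquiv.toMatrix_apply]
  · intro l _ hl
    have : σ l ≠ i := fun h => hl (by simp [← h])
    simp [Equiv.Perm.permMatrix, PEquiv.toMatrix_apply, this]
  · simp

theorem permMatrix_pow (σ : Equiv.Perm (Fin r)) (n : ℕ) :
    (σ.permMatrix ℕ) ^ n = (σ ^ n).permMatrix ℕ := by
  induction n with
  | zero => simp
  | succ n ih => rw [pow_succ, ih, pow_succ', Matrix.permMatrix_mul]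

theorem orderOf_permMatrix (σ : Equiv.Perm (Fin r)) : orderOf (σ.permMatrix ℕ) = orderOf σ := by
  refine orderOf_eq_orderOf_iff.2 fun n => ?_
  rw [permMatrix_pow]
  constructor
  · intro h
    ext i
    have := congrFun (congrFun h i) i
    rw [Matrix.one_apply_eq] at this
    by_contra hne
    have hne' : (σ ^ n) i ≠ i := fun h => hne (by simp [h])
    simp [Equiv.Perm.permMatrix, PEquiv.toMatrix_apply, hne'] at this
  · rintro h
    rw [h, Matrix.permMatrix_one]

theorem iterate_monomial (α : Fin r → ℂ) (τ : Equiv.Perm (Fin r)) (n : ℕ) (w : Fin r → ℂ)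
    (i : Fin r) : (fun (w : Fin r → ℂ) i => α i * w (τ i))^[n] w i =
      (∏ k ∈ Finset.range n, α ((τ ^ k) i)) * w ((τ ^ n) i) := by
  induction n generalizing i with
  | zero => simp
  | succ n ih =>
    rw [Function.iterate_succ_apply', ih (τ i), Finset.prod_range_succ']
    simp only [pow_succ, Equiv.Perm.mul_apply, pow_zero, Equiv.Perm.one_apply]
    ring

theorem isIterateEigenvalues_permMatrix (α : Fin r → ℂ) (σ : Equiv.Perm (Fin r)) :
    IsIterateEigenvalues α (σ.permMatrix ℕ)
      fun i => ∏ k ∈ Finset.range (orderOf (σ.permMatrix ℕ)), α ((σ⁻¹ ^ k) i) := by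
  intro u
  ext i
  simp only [matPow_permMatrix]
  rw [iterate_monomial, orderOf_permMatrix, inv_pow σ (orderOf σ), pow_orderOf_eq_one]
  simp

end MonomialMap

/-! ### Generalized eigenvectors -/

section LinearAlgebra

variable {V : Type*} [AddCommGroup V] [Module ℂ V]

theorem mem_maxGenEigenspace_of_sub_apply_mem {T : Module.End ℂ V} {a : ℂ} {x : V}
    (h : T x - a • x ∈ T.maxGenEigenspace a) : x ∈ T.maxGenEigenspace a := by
  rw [Module.End.mem_maxGenEigenspace] at h ⊢
  obtain ⟨k, hk⟩ := h
  exact ⟨k + 1, by rw [pow_succ]; simpa using hk⟩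

theorem apply_mem_maxGenEigenspace {T : Module.End ℂ V} {a : ℂ} {x : V}
    (h : x ∈ T.maxGenEigenspace a) : T x ∈ T.maxGenEigenspace a :=
  Module.End.mapsTo_maxGenEigenspace_of_comm (Commute.refl T) a h

theorem map_sub_smul_pow_apply {V' : Type*} [AddCommGroup V'] [Module ℂ V']
    {T : Module.End ℂ V} {L : Module.End ℂ V'} {π : V →ₗ[ℂ] V'} (hπ : ∀ x, π (T x) = L (π x))
    (a : ℂ) (k : ℕ) (y : V) :
    π (((T - a • 1 : Module.End ℂ V) ^ k) y) = ((L - a • 1 : Module.End ℂ V') ^ k) (π y) := by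
  induction k generalizing y with
  | zero => simp
  | succ k ih => rw [pow_succ, pow_succ, Module.End.mul_apply, ih]; simp [hπ]

theorem map_mem_maxGenEigenspace {V' : Type*} [AddCommGroup V'] [Module ℂ V']
    {T : Module.End ℂ V} {L : Module.End ℂ V'} {π : V →ₗ[ℂ] V'} (hπ : ∀ x, π (T x) = L (π x))
    {a : ℂ} {x : V} (hx : x ∈ T.maxGenEigenspace a) : π x ∈ L.maxGenEigenspace a := by
  rw [Module.End.mem_maxGenEigenspace] at hx ⊢
  obtain ⟨k, hk⟩ := hx
  refine ⟨k, ?_⟩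
  rw [← map_sub_smul_pow_apply hπ, hk, map_zero]

theorem mem_maxGenEigenspace_of_map_mem {V' : Type*} [AddCommGroup V'] [Module ℂ V']
    {T : Module.End ℂ V} {L : Module.End ℂ V'} {π : V →ₗ[ℂ] V'} (hπ : ∀ x, π (T x) = L (π x))
    (hinj : Function.Injective π) {a : ℂ} {x : V} (hx : π x ∈ L.maxGenEigenspace a) :
    x ∈ T.maxGenEigenspace a := by
  rw [Module.End.mem_maxGenEigenspace] at hx ⊢
  obtain ⟨k, hk⟩ := hx
  refine ⟨k, hinj ?_⟩
  rw [map_sub_smul_pow_apply hπ, hk, map_zero]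

/-- `T ^ n - a ^ n` is a multiple of `T - a` by an operator commuting with it. -/
theorem mem_maxGenEigenspace_pow {T : Module.End ℂ V} {a : ℂ} {x : V}
    (h : x ∈ T.maxGenEigenspace a) (n : ℕ) : x ∈ (T ^ n).maxGenEigenspace (a ^ n) := by
  rw [Module.End.mem_maxGenEigenspace] at h ⊢
  obtain ⟨k, hk⟩ := h
  refine ⟨k, ?_⟩
  have hc : Commute T (a • 1 : Module.End ℂ V) := (Commute.one_right T).smul_right a
  have h1 : T ^ n - a ^ n • 1 = (∑ i ∈ Finset.range n, T ^ i * (a • 1) ^ (n - 1 - i)) *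
      (T - a • 1) := by
    rw [hc.geom_sum₂_mul, smul_pow, one_pow]
  have hc2 : Commute (∑ i ∈ Finset.range n, T ^ i * (a • 1 : Module.End ℂ V) ^ (n - 1 - i))
      (T - a • 1) := by
    refine Commute.sum_left _ _ _ fun i _ => ?_
    have hT : Commute T (T - a • 1) := (Commute.refl T).sub_right hc
    have ha : Commute (a • 1 : Module.End ℂ V) (T - a • 1) := hc.symm.sub_right (Commute.refl _)
    exact (hT.pow_left i).mul_left (ha.pow_left _)
  rw [h1, hc2.mul_pow, Module.End.mul_apply, hk, map_zero]

/-- In a sum of generalized eigenvectors lying in a generalized eigenspace, only the terms of that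
eigenspace matter. -/
theorem sum_eq_sum_filter_of_mem_maxGenEigenspace {T : Module.End ℂ V} {ι : Type*}
    (s : Finset ι) {x : ι → V} {χ : ι → ℂ} (hx : ∀ i ∈ s, x i ∈ T.maxGenEigenspace (χ i)) {a : ℂ}
    (h : ∑ i ∈ s, x i ∈ T.maxGenEigenspace a) :
    ∑ i ∈ s, x i = ∑ i ∈ s with χ i = a, x i := by
  have h1 : ∑ i ∈ s with χ i = a, x i ∈ T.maxGenEigenspace a :=
    Submodule.sum_mem _ fun i hi => by
      rw [Finset.mem_filter] at hi
      exact hi.2 ▸ hx i hi.1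
  have h2 : ∑ i ∈ s with ¬ χ i = a, x i ∈ ⨆ (b) (_ : b ≠ a), T.maxGenEigenspace b :=
    Submodule.sum_mem _ fun i hi => by
      rw [Finset.mem_filter] at hi
      exact Submodule.mem_iSup_of_mem (χ i) (Submodule.mem_iSup_of_mem hi.2 (hx i hi.1))
  have h3 := Finset.sum_filter_add_sum_filter_not s (fun i => χ i = a) x
  have h4 : ∑ i ∈ s with ¬ χ i = a, x i ∈ T.maxGenEigenspace a := by
    rw [← add_sub_cancel_left (∑ i ∈ s with χ i = a, x i) (∑ i ∈ s with ¬ χ i = a, x i), h3]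
    exact Submodule.sub_mem _ h h1
  have h5 := Submodule.disjoint_def.1 (T.independent_maxGenEigenspace a) _ h4 h2
  rw [← h3, h5, add_zero]

/-- Generalized eigenvectors lift along equivariant surjections from finite-dimensional spaces. -/
theorem exists_lift_maxGenEigenspace [FiniteDimensional ℂ V] {V' : Type*} [AddCommGroup V']
    [Module ℂ V'] {T : Module.End ℂ V} {L : Module.End ℂ V'} {π : V →ₗ[ℂ] V'}
    (hπ : ∀ x, π (T x) = L (π x)) (hs : Function.Surjective π) {a : ℂ} {y : V'}
    (hy : y ∈ L.maxGenEigenspace a) : ∃ x ∈ T.maxGenEigenspace a, π x = y := by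
  obtain ⟨x, rfl⟩ := hs y
  -- An arbitrary preimage is split into generalized eigenvectors, and only its component for `a` is
  -- kept.
  have hx : x ∈ ⨆ b, T.maxGenEigenspace b := by
    rw [Module.End.iSup_maxGenEigenspace_eq_top]; trivial
  obtain ⟨g, hg, hsum⟩ := (Submodule.mem_iSup_iff_exists_finsupp _ _).1 hx
  rw [Finsupp.sum] at hsum
  have h1 : ∑ b ∈ g.support, π (g b) = ∑ b ∈ g.support with b = a, π (g b) := by
    refine sum_eq_sum_filter_of_mem_maxGenEigenspace (T := L) _
      (fun b _ => map_mem_maxGenEigenspace hπ (hg b)) ?_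
    rwa [← map_sum, hsum]
  refine ⟨∑ b ∈ g.support with b = a, g b, Submodule.sum_mem _ fun b hb => ?_, ?_⟩
  · rw [Finset.mem_filter] at hb
    exact hb.2 ▸ hg b
  · rw [map_sum, ← h1, ← map_sum, hsum]

/-- An endomorphism minus its semisimple part in a basis of generalized eigenvectors is
nilpotent. -/
theorem isNilpotent_sub_of_basis {ι : Type*} [Finite ι] (b : Module.Basis ι ℂ V)
    {T S : Module.End ℂ V} {χ : ι → ℂ} (hb : ∀ i, b i ∈ T.maxGenEigenspace (χ i))
    (hS : ∀ i, S (b i) = χ i • b i) : IsNilpotent (T - S) := by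
  classical
  have := Fintype.ofFinite ι
  -- `S` is the scalar `a` on the entire generalized eigenspace for `a`, so `T - S` acts there as
  -- the nilpotent `T - a`.
  have hSx : ∀ a, ∀ x ∈ T.maxGenEigenspace a, S x = a • x := by
    intro a x hx
    have h1 := b.sum_repr x
    have h2 := sum_eq_sum_filter_of_mem_maxGenEigenspace (T := T) (a := a) Finset.univ
      (x := fun i => b.repr x i • b i) (χ := χ) (fun i _ => Submodule.smul_mem _ _ (hb i))
      (by rwa [h1])
    rw [h1] at h2
    conv_lhs => rw [h2]
    conv_rhs => rw [h2]
    rw [map_sum, Finset.smul_sum]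
    refine Finset.sum_congr rfl fun i hi => ?_
    rw [Finset.mem_filter] at hi
    rw [map_smul, hS, hi.2, smul_comm]
  have hpow : ∀ a k, ∀ x ∈ T.maxGenEigenspace a, ((T - S) ^ k) x = ((T - a • 1) ^ k) x := by
    intro a k
    induction k with
    | zero => simp
    | succ k ih =>
      intro x hx
      rw [pow_succ, pow_succ, Module.End.mul_apply, Module.End.mul_apply]
      have h1 : (T - S) x = (T - a • 1) x := by simp [hSx a x hx]
      rw [h1]
      refine ih _ ?_
      simpa using Submodule.sub_mem _ (apply_mem_maxGenEigenspace hx) (Submodule.smul_mem _ a hx)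
  choose k hk using fun i => (Module.End.mem_maxGenEigenspace _ _ _).1 (hb i)
  refine ⟨∑ i, k i, b.ext fun i => ?_⟩
  rw [← Finset.sum_erase_add _ _ (Finset.mem_univ i), pow_add, Module.End.mul_apply,
    hpow _ _ _ (hb i), hk, map_zero, LinearMap.zero_apply]

end LinearAlgebra

/-! ### Generalized eigenvectors of algebra endomorphisms -/

section Algebra

variable {R : Type*} [CommRing R] [Algebra ℂ R] {T : R →ₐ[ℂ] R}

/-- A twisted Leibniz rule, `T (x y) - a b x y = (T x - a x) T y + a x (T y - b y)`: each term on
the right lowers the nilpotency exponent of one factor, so induction on the sum of the exponents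
applies. -/
theorem mul_mem_maxGenEigenspace {a b : ℂ} {x y : R}
    (hx : x ∈ Module.End.maxGenEigenspace T.toLinearMap a)
    (hy : y ∈ Module.End.maxGenEigenspace T.toLinearMap b) :
    x * y ∈ Module.End.maxGenEigenspace T.toLinearMap (a * b) := by
  obtain ⟨m, hm⟩ := (Module.End.mem_maxGenEigenspace _ _ _).1 hx
  obtain ⟨n, hn⟩ := (Module.End.mem_maxGenEigenspace _ _ _).1 hy
  clear hx hy
  induction hN : m + n generalizing m n x y with
  | zero =>
    obtain rfl : m = 0 := by omega
    have : x = 0 := by simpa using hm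
    simp [this]
  | succ N ih =>
    rcases m with _ | m
    · have : x = 0 := by simpa using hm
      simp [this]
    rcases n with _ | n
    · have : y = 0 := by simpa using hn
      simp [this]
    refine mem_maxGenEigenspace_of_sub_apply_mem ?_
    have h1 : T.toLinearMap (x * y) - (a * b) • (x * y) =
        (T x - a • x) * T y + a • (x * (T y - b • y)) := by
      simp only [AlgHom.toLinearMap_apply, map_mul, Algebra.smul_def, map_mul]
      ring
    rw [h1]
    have hTy : ((T.toLinearMap - b • 1) ^ (n + 1)) (T y) = 0 := by
      have hc : Commute (T.toLinearMap : Module.End ℂ R) (T.toLinearMap - b • 1) :=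
        (Commute.refl _).sub_right ((Commute.one_right _).smul_right b)
      have h2 := congrArg (fun S : Module.End ℂ R => S y) (hc.pow_right (n + 1)).eq
      simp only [Module.End.mul_apply] at h2
      rw [hn, map_zero] at h2
      exact h2.symm
    refine Submodule.add_mem _ (ih (m := m) (n := n + 1) ?_ hTy (by omega))
      (Submodule.smul_mem _ _ (ih (m := m + 1) (n := n) hm ?_ (by omega)))
    · rw [pow_succ] at hm; simpa using hm
    · rw [pow_succ] at hn; simpa using hn

theorem one_mem_maxGenEigenspace : (1 : R) ∈ Module.End.maxGenEigenspace T.toLinearMap 1 :=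
  mem_maxGenEigenspace_of_sub_apply_mem (by simp)

theorem pow_mem_maxGenEigenspace {a : ℂ} {x : R}
    (hx : x ∈ Module.End.maxGenEigenspace T.toLinearMap a) (n : ℕ) :
    x ^ n ∈ Module.End.maxGenEigenspace T.toLinearMap (a ^ n) := by
  induction n with
  | zero => simpa using one_mem_maxGenEigenspace (T := T)
  | succ n ih => rw [pow_succ, pow_succ]; exact mul_mem_maxGenEigenspace ih hx

theorem prod_mem_maxGenEigenspace {ι : Type*} (s : Finset ι) {χ : ι → ℂ} {x : ι → R}
    (hx : ∀ i ∈ s, x i ∈ Module.End.maxGenEigenspace T.toLinearMap (χ i)) :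
    ∏ i ∈ s, x i ∈ Module.End.maxGenEigenspace T.toLinearMap (∏ i ∈ s, χ i) := by
  classical
  induction s using Finset.induction_on with
  | empty => simpa using one_mem_maxGenEigenspace (T := T)
  | insert j s hj ih =>
    rw [Finset.prod_insert hj, Finset.prod_insert hj]
    exact mul_mem_maxGenEigenspace (hx j (by simp)) (ih fun i hi => hx i (by simp [hi]))

variable {ι : Type*} [Fintype ι] {χ : ι → ℂ} {x : ι → R}

theorem monomial_mem_maxGenEigenspace
    (hx : ∀ i, x i ∈ Module.End.maxGenEigenspace T.toLinearMap (χ i)) (n : ι →₀ ℕ) :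
    ∏ i, x i ^ n i ∈ Module.End.maxGenEigenspace T.toLinearMap (∏ i, χ i ^ n i) :=
  prod_mem_maxGenEigenspace _ fun i _ => pow_mem_maxGenEigenspace (hx i) _

theorem aeval_mem_maxGenEigenspace
    (hx : ∀ i, x i ∈ Module.End.maxGenEigenspace T.toLinearMap (χ i)) {a : ℂ}
    {P : MvPolynomial ι ℂ} (hP : ∀ n ∈ P.support, ∏ i, χ i ^ n i = a) :
    MvPolynomial.aeval x P ∈ Module.End.maxGenEigenspace T.toLinearMap a := by
  rw [MvPolynomial.aeval_def, MvPolynomial.eval₂_eq']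
  refine Submodule.sum_mem _ fun n hn => ?_
  rw [← Algebra.smul_def, ← hP n hn]
  exact Submodule.smul_mem _ _ (monomial_mem_maxGenEigenspace hx n)

/-- A generalized eigenvector that is a polynomial in generalized eigenvectors is a polynomial all
of whose monomials are resonant. -/
theorem exists_resonant_aeval_eq
    (hx : ∀ i, x i ∈ Module.End.maxGenEigenspace T.toLinearMap (χ i)) {a : ℂ}
    {P : MvPolynomial ι ℂ}
    (hP : MvPolynomial.aeval x P ∈ Module.End.maxGenEigenspace T.toLinearMap a) :
    ∃ Q : MvPolynomial ι ℂ, MvPolynomial.aeval x Q = MvPolynomial.aeval x P ∧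
      ∀ n ∈ Q.support, ∏ i, χ i ^ n i = a := by
  classical
  refine ⟨∑ n ∈ P.support with ∏ i, χ i ^ n i = a, MvPolynomial.monomial n (P.coeff n), ?_, ?_⟩
  · have h1 : MvPolynomial.aeval x P = ∑ n ∈ P.support, P.coeff n • ∏ i, x i ^ n i := by
      rw [MvPolynomial.aeval_def, MvPolynomial.eval₂_eq']
      simp only [Algebra.smul_def]
    rw [h1] at hP ⊢
    rw [sum_eq_sum_filter_of_mem_maxGenEigenspace _ (χ := fun n : ι →₀ ℕ => ∏ i, χ i ^ n i)
      (fun n _ => Submodule.smul_mem _ _ (monomial_mem_maxGenEigenspace hx n)) hP, map_sum]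
    refine Finset.sum_congr rfl fun n _ => ?_
    rw [MvPolynomial.aeval_monomial, Algebra.smul_def, Finsupp.prod_fintype _ _ (by simp)]
  · intro n hn
    obtain ⟨m, hm, hnm⟩ := Finset.mem_biUnion.1 (MvPolynomial.support_sum hn)
    obtain rfl := Finset.mem_singleton.1 (MvPolynomial.support_monomial_subset hnm)
    exact (Finset.mem_filter.1 hm).2

end Algebra

/-! ### Jets of analytic germs -/

/-- The algebra of functions on `ℂᵈ` that are analytic at `0`. -/
def analyticAlgebra (d : ℕ) : Subalgebra ℂ ((Fin d → ℂ) → ℂ) where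
  carrier := {φ | AnalyticAt ℂ φ 0}
  mul_mem' := fun ha hb => AnalyticAt.mul ha hb
  add_mem' := fun ha hb => AnalyticAt.add ha hb
  algebraMap_mem' := fun _ => analyticAt_const

/-- The ideal of functions vanishing at `0` to order at least `K`; for `K = ⊤`, the functions with
zero germ. -/
def vanishingIdeal (d : ℕ) (K : ℕ∞) : Ideal (analyticAlgebra d) where
  carrier := {φ | ∀ n : ℕ, (n : ℕ∞) ≤ K → φ.1 =O[𝓝 0] fun x => ‖x‖ ^ n}
  add_mem' := fun ha hb n hn => (ha n hn).add (hb n hn)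
  zero_mem' := fun _ _ => isBigO_zero _ _
  smul_mem' := fun c φ hφ n hn => by
    have h1 : c.1 =O[𝓝 0] fun _ => (1 : ℝ) := c.2.continuousAt.tendsto.isBigO_one ℝ
    simpa only [one_mul] using! h1.mul (hφ n hn)

variable {d : ℕ}

theorem mem_vanishingIdeal_natCast {K : ℕ} {φ : analyticAlgebra d} :
    φ ∈ vanishingIdeal d K ↔ φ.1 =O[𝓝 0] fun x => ‖x‖ ^ K := by
  refine ⟨fun h => h K le_rfl, fun h n hn => h.trans ?_⟩
  have hn' : n ≤ K := by exact_mod_cast hn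
  refine IsBigO.of_bound 1 ?_
  filter_upwards [Metric.ball_mem_nhds (0 : Fin d → ℂ) one_pos] with x hx
  simp only [norm_pow, norm_norm, one_mul]
  exact pow_le_pow_of_le_one (norm_nonneg _) (mem_ball_zero_iff.1 hx).le hn'

theorem mem_vanishingIdeal_top {φ : analyticAlgebra d} :
    φ ∈ vanishingIdeal d ⊤ ↔ ∀ᶠ x in 𝓝 0, φ.1 x = 0 := by
  constructor
  · intro h
    by_contra hne
    obtain ⟨m, hm⟩ := exists_not_isBigO_norm_pow φ.2 hne
    exact hm (h m le_top)
  · intro h n _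
    exact IsBigO.of_bound 0 (h.mono fun x hx => by simp [hx])

theorem vanishingIdeal_anti {K K' : ℕ∞} (h : K ≤ K') :
    vanishingIdeal d K' ≤ vanishingIdeal d K := fun _ hφ n hn => hφ n (hn.trans h)

theorem mul_mem_vanishingIdeal {j k : ℕ} {φ ψ : analyticAlgebra d} (hφ : φ ∈ vanishingIdeal d j)
    (hψ : ψ ∈ vanishingIdeal d k) : φ * ψ ∈ vanishingIdeal d (j + k : ℕ) := by
  rw [mem_vanishingIdeal_natCast] at *
  simpa only [pow_add] using! hφ.mul hψ

theorem mem_vanishingIdeal_one {φ : analyticAlgebra d} (h : φ.1 0 = 0) :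
    φ ∈ vanishingIdeal d (1 : ℕ) := by
  rw [mem_vanishingIdeal_natCast]
  have h1 := (AnalyticAt.differentiableAt φ.2).isBigO_sub
  simp only [h, sub_zero] at h1
  simpa using h1.norm_right

/-- The components of a biholomorphic germ generate all jets. -/
theorem IsBiholomorphicGerm.exists_polynomial_jets {c : (Fin d → ℂ) → (Fin d → ℂ)}
    (hc : IsBiholomorphicGerm c) {c' : Fin d → analyticAlgebra d}
    (hc' : ∀ i x, (c' i).1 x = c x i) (K : ℕ) :
    ∃ S : Submodule ℂ (MvPolynomial (Fin d) ℂ), S.FG ∧ ∀ φ : analyticAlgebra d,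
      ∃ P ∈ S, φ - MvPolynomial.aeval c' P ∈ vanishingIdeal d K := by
  induction K with
  | zero =>
    refine ⟨⊥, Submodule.fg_bot, fun φ => ⟨0, Submodule.zero_mem _, ?_⟩⟩
    rw [mem_vanishingIdeal_natCast]
    simpa using φ.2.continuousAt.tendsto.isBigO_one ℝ
  | succ K ih =>
    obtain ⟨S, hS, h⟩ := ih
    -- By Hadamard's lemma a germ is a constant plus `∑ c i ψ i`, so jets one order higher need only
    -- the constants and the products `X i * P` with `P ∈ S`. Finite generation is carried along for
    -- the dimension of the jet spaces.
    refine ⟨Submodule.span ℂ {1} ⊔ ⨆ i : Fin d, S.map (LinearMap.mulLeft ℂ (MvPolynomial.X i)),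
      (Submodule.fg_span_singleton 1).sup (Submodule.fg_iSup _ fun i => hS.map _), fun φ => ?_⟩
    obtain ⟨b, hb, hbc, hcb⟩ := hc.exists_inverse
    obtain ⟨G, hG, hGe⟩ := exists_eq_add_sum_mul (F := φ.1 ∘ b)
      (AnalyticAt.comp (by rw [hb.map_zero]; exact φ.2) hb.analyticAt)
    let ψ : Fin d → analyticAlgebra d := fun i => ⟨G i ∘ c,
      AnalyticAt.comp (by simpa [hc.map_zero] using hG i) hc.analyticAt⟩
    choose P hP hPψ using fun i => h (ψ i)
    refine ⟨φ.1 0 • 1 + ∑ i, MvPolynomial.X i * P i, Submodule.add_mem _ ?_ ?_, ?_⟩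
    · exact Submodule.mem_sup_left (Submodule.smul_mem _ _ (Submodule.mem_span_singleton_self 1))
    · refine Submodule.mem_sup_right (Submodule.sum_mem _ fun i _ => ?_)
      exact Submodule.mem_iSup_of_mem i (Submodule.mem_map_of_mem (hP i))
    · have h1 : φ - (algebraMap ℂ _ (φ.1 0) + ∑ i, c' i * ψ i) ∈ vanishingIdeal d ⊤ := by
        rw [mem_vanishingIdeal_top]
        filter_upwards [hc.tendsto.eventually hGe, hbc] with x hx hx'
        simp only [Function.comp_apply, hx', hb.map_zero] at hx
        have h2 : (∑ i, c' i * ψ i : analyticAlgebra d).1 x = ∑ i, c x i * G i (c x) := by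
          simp [hc', ψ]
        change φ.1 x - (φ.1 0 + (∑ i, c' i * ψ i : analyticAlgebra d).1 x) = 0
        rw [hx, h2, sub_self]
      have h2 : ∑ i, c' i * (ψ i - MvPolynomial.aeval c' (P i)) ∈
          vanishingIdeal d (K + 1 : ℕ) := by
        refine Ideal.sum_mem _ fun i _ => ?_
        rw [add_comm]
        refine mul_mem_vanishingIdeal (mem_vanishingIdeal_one ?_) (hPψ i)
        rw [hc', hc.map_zero]; rfl
      have h3 := Ideal.add_mem _ (vanishingIdeal_anti le_top h1) h2
      convert h3 using 1
      simp only [map_add, map_smul, map_one, map_sum, map_mul, MvPolynomial.aeval_X, mul_sub,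
        Finset.sum_sub_distrib, Algebra.algebraMap_eq_smul_one]
      ring

/-- This makes every jet a sum of generalized eigenvectors of the pull-back, which fails to be
available directly for germs. -/
instance finiteDimensional_jets (K : ℕ) :
    FiniteDimensional ℂ (analyticAlgebra d ⧸ vanishingIdeal d K) := by
  have hid : IsBiholomorphicGerm (id : (Fin d → ℂ) → (Fin d → ℂ)) :=
    ⟨analyticAt_id, rfl, ContinuousLinearEquiv.refl ℂ _, hasFDerivAt_id 0⟩
  obtain ⟨S, hS, h⟩ := hid.exists_polynomial_jets (c' := fun i => ⟨fun x => x i,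
    (ContinuousLinearMap.proj (R := ℂ) (φ := fun _ : Fin d => ℂ) i).analyticAt 0⟩)
    (fun i x => rfl) K
  have h1 := hS.map ((Ideal.Quotient.mkₐ ℂ (vanishingIdeal d K)).toLinearMap ∘ₗ
    (MvPolynomial.aeval (R := ℂ) fun i => (⟨fun x => x i,
    (ContinuousLinearMap.proj (R := ℂ) (φ := fun _ : Fin d => ℂ) i).analyticAt 0⟩ :
      analyticAlgebra d)).toLinearMap)
  refine ⟨?_⟩
  rwa [(eq_top_iff.2 fun x _ => ?_ : Submodule.map _ S = ⊤)] at h1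
  obtain ⟨φ, rfl⟩ := Ideal.Quotient.mk_surjective x
  obtain ⟨P, hP, hPφ⟩ := h φ
  exact ⟨P, hP, (Ideal.Quotient.eq.2 hPφ).symm⟩

/-! ### The pull-back on jets and germs -/

section Pullback

variable {f : (Fin d → ℂ) → (Fin d → ℂ)}

/-- The pull-back `φ ↦ φ ∘ f` of analytic functions. -/
def pullback (hf : AnalyticAt ℂ f 0) (h0 : f 0 = 0) : analyticAlgebra d →ₐ[ℂ] analyticAlgebra d where
  toFun φ := ⟨φ.1 ∘ f, AnalyticAt.comp (by rw [h0]; exact φ.2) hf⟩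
  map_one' := rfl
  map_mul' _ _ := rfl
  map_zero' := rfl
  map_add' _ _ := rfl
  commutes' _ := rfl

variable (hf : AnalyticAt ℂ f 0) (h0 : f 0 = 0)

theorem vanishingIdeal_le_comap (K : ℕ∞) :
    vanishingIdeal d K ≤ (vanishingIdeal d K).comap (pullback hf h0) := by
  intro φ hφ n hn
  have ht : Tendsto f (𝓝 0) (𝓝 0) := by simpa [h0] using hf.continuousAt.tendsto
  have h1 : (fun x => f x) =O[𝓝 0] fun x => x := by
    simpa [h0] using hf.differentiableAt.isBigO_sub
  exact ((hφ n hn).comp_tendsto ht).trans (h1.norm_norm.pow n)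

/-- The action of the pull-back on jets (`K` finite) or germs (`K = ⊤`). -/
def jetMap (K : ℕ∞) : analyticAlgebra d ⧸ vanishingIdeal d K →ₐ[ℂ]
    analyticAlgebra d ⧸ vanishingIdeal d K :=
  Ideal.quotientMapₐ _ (pullback hf h0) (vanishingIdeal_le_comap hf h0 K)

/-- The class of `φ` is a generalized eigenvector of the pull-back acting on jets of order `K`. -/
def IsGenEigenjet (K : ℕ∞) (a : ℂ) (φ : analyticAlgebra d) : Prop :=
  Ideal.Quotient.mkₐ ℂ (vanishingIdeal d K) φ ∈
    Module.End.maxGenEigenspace (jetMap hf h0 K).toLinearMap a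

theorem mk_sub_smul_pow_apply (K : ℕ∞) (a : ℂ) (n : ℕ) (φ : analyticAlgebra d) :
    Ideal.Quotient.mkₐ ℂ (vanishingIdeal d K)
      ((((pullback hf h0).toLinearMap - a • 1 : Module.End ℂ (analyticAlgebra d)) ^ n) φ) =
    (((jetMap hf h0 K).toLinearMap - a • 1 : Module.End ℂ _) ^ n)
      (Ideal.Quotient.mkₐ ℂ (vanishingIdeal d K) φ) :=
  map_sub_smul_pow_apply (T := (pullback hf h0).toLinearMap)
    (L := (jetMap hf h0 K).toLinearMap) (π := (Ideal.Quotient.mkₐ ℂ (vanishingIdeal d K)).toLinearMap)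
    (fun _ => rfl) a n φ

theorem isGenEigenjet_iff {K : ℕ∞} {a : ℂ} {φ : analyticAlgebra d} :
    IsGenEigenjet hf h0 K a φ ↔ ∃ n : ℕ, (((pullback hf h0).toLinearMap - a • 1 :
      Module.End ℂ (analyticAlgebra d)) ^ n) φ ∈ vanishingIdeal d K := by
  unfold IsGenEigenjet
  rw [Module.End.mem_maxGenEigenspace]
  refine exists_congr fun n => ?_
  rw [← mk_sub_smul_pow_apply, Ideal.Quotient.mkₐ_eq_mk, Ideal.Quotient.eq_zero_iff_mem]

variable {hf h0}

theorem IsGenEigenjet.mono {K K' : ℕ∞} (h : K' ≤ K) {a : ℂ} {φ : analyticAlgebra d}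
    (hφ : IsGenEigenjet hf h0 K a φ) : IsGenEigenjet hf h0 K' a φ := by
  rw [isGenEigenjet_iff] at hφ ⊢
  exact hφ.imp fun n hn => vanishingIdeal_anti h hn

theorem IsGenEigenjet.congr {K : ℕ∞} {a : ℂ} {φ ψ : analyticAlgebra d}
    (hφ : IsGenEigenjet hf h0 K a φ) (h : φ - ψ ∈ vanishingIdeal d K) :
    IsGenEigenjet hf h0 K a ψ := by
  unfold IsGenEigenjet at *
  rwa [Ideal.Quotient.mkₐ_eq_mk, ← Ideal.Quotient.eq.2 h]

theorem IsGenEigenjet.of_apply_sub {K : ℕ∞} {a : ℂ} {φ : analyticAlgebra d}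
    (h : pullback hf h0 φ - a • φ ∈ vanishingIdeal d K) : IsGenEigenjet hf h0 K a φ := by
  rw [isGenEigenjet_iff]
  exact ⟨1, by simpa using h⟩

theorem IsGenEigenjet.apply_sub {K : ℕ∞} {a : ℂ} {φ : analyticAlgebra d}
    (h : IsGenEigenjet hf h0 K a φ) : IsGenEigenjet hf h0 K a (pullback hf h0 φ - a • φ) := by
  unfold IsGenEigenjet at *
  rw [map_sub, map_smul]
  exact Submodule.sub_mem _ (apply_mem_maxGenEigenspace h) (Submodule.smul_mem _ a h)

theorem IsGenEigenjet.sub {K : ℕ∞} {a : ℂ} {φ ψ : analyticAlgebra d}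
    (hφ : IsGenEigenjet hf h0 K a φ) (hψ : IsGenEigenjet hf h0 K a ψ) :
    IsGenEigenjet hf h0 K a (φ - ψ) := by
  unfold IsGenEigenjet at *
  rw [map_sub]
  exact Submodule.sub_mem _ hφ hψ

theorem analyticAt_iterate (hf : AnalyticAt ℂ f 0) (h0 : f 0 = 0) (n : ℕ) :
    AnalyticAt ℂ f^[n] 0 := by
  induction n with
  | zero => exact analyticAt_id
  | succ n ih =>
    rw [Function.iterate_succ]
    exact AnalyticAt.comp (by rwa [h0]) hf

theorem pullback_pow_apply (n : ℕ) (φ : analyticAlgebra d) :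
    (((pullback hf h0).toLinearMap : Module.End ℂ (analyticAlgebra d)) ^ n) φ =
      pullback (analyticAt_iterate hf h0 n) (Function.iterate_fixed h0 n) φ := by
  induction n generalizing φ with
  | zero => rfl
  | succ n ih => rw [pow_succ', Module.End.mul_apply, ih]; rfl

theorem jetMap_pow_mk (K : ℕ∞) (n : ℕ) (φ : analyticAlgebra d) :
    (((jetMap hf h0 K).toLinearMap : Module.End ℂ _) ^ n)
      (Ideal.Quotient.mkₐ ℂ (vanishingIdeal d K) φ) = Ideal.Quotient.mkₐ ℂ (vanishingIdeal d K)
        ((((pullback hf h0).toLinearMap : Module.End ℂ (analyticAlgebra d)) ^ n) φ) := by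
  induction n generalizing φ with
  | zero => rfl
  | succ n ih => rw [pow_succ, pow_succ, Module.End.mul_apply, Module.End.mul_apply, ← ih]; rfl

theorem jetMap_iterate (K : ℕ∞) (n : ℕ) :
    (jetMap (analyticAt_iterate hf h0 n) (Function.iterate_fixed h0 n) K).toLinearMap =
      ((jetMap hf h0 K).toLinearMap : Module.End ℂ _) ^ n := by
  refine LinearMap.ext fun x => ?_
  obtain ⟨φ, rfl⟩ := Ideal.Quotient.mkₐ_surjective ℂ _ x
  rw [jetMap_pow_mk, pullback_pow_apply]
  rfl

theorem IsGenEigenjet.iterate {K : ℕ∞} {a : ℂ} {φ : analyticAlgebra d}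
    (hφ : IsGenEigenjet hf h0 K a φ) (n : ℕ) :
    IsGenEigenjet (analyticAt_iterate hf h0 n) (Function.iterate_fixed h0 n) K (a ^ n) φ := by
  unfold IsGenEigenjet at *
  rw [jetMap_iterate]
  exact mem_maxGenEigenspace_pow hφ n

theorem sub_smul_pow_mem_vanishingIdeal {K : ℕ∞} (a : ℂ) (n : ℕ) {φ : analyticAlgebra d}
    (hφ : φ ∈ vanishingIdeal d K) : (((pullback hf h0).toLinearMap - a • 1 :
      Module.End ℂ (analyticAlgebra d)) ^ n) φ ∈ vanishingIdeal d K := by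
  rw [← Ideal.Quotient.eq_zero_iff_mem, ← Ideal.Quotient.mkₐ_eq_mk ℂ, mk_sub_smul_pow_apply,
    Ideal.Quotient.mkₐ_eq_mk, Ideal.Quotient.eq_zero_iff_mem.2 hφ, map_zero]

section Lift

variable {C κ R : ℝ}

/-- Generalized eigenjets of high order lift to generalized eigengerms. -/
theorem IsGenEigenjet.exists_lift (hc : ContractsOn f C κ R) {K : ℕ} {a : ℂ} (ha : κ ^ K < ‖a‖)
    {φ : analyticAlgebra d} (hφ : IsGenEigenjet hf h0 K a φ) :
    ∃ φ', φ - φ' ∈ vanishingIdeal d K ∧ IsGenEigenjet hf h0 ⊤ a φ' := by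
  -- On germs of order `K` each power of `f^* - a` is onto up to functions with zero germ, by `n`
  -- cohomological equations. The obstruction `(f^* - a) ^ n φ`, which has order `K`, can therefore
  -- be removed by a correction of order `K`.
  have hsurj : ∀ n : ℕ, ∀ ψ ∈ vanishingIdeal d K, ∃ δ ∈ vanishingIdeal d K,
      (((pullback hf h0).toLinearMap - a • 1 : Module.End ℂ (analyticAlgebra d)) ^ n) δ - ψ ∈
        vanishingIdeal d ⊤ := by
    intro n
    induction n with
    | zero => intro ψ hψ; exact ⟨ψ, hψ, by simp⟩
    | succ n ih =>
      intro ψ hψ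
      obtain ⟨δ₁, hδ₁, h1⟩ := ih ψ hψ
      obtain ⟨Δ, hΔ, hΔO, hΔe⟩ := exists_comp_sub_smul_eq hc hf h0 δ₁.2
        (mem_vanishingIdeal_natCast.1 hδ₁) ha
      refine ⟨⟨Δ, hΔ⟩, mem_vanishingIdeal_natCast.2 hΔO, ?_⟩
      have h2 : ((pullback hf h0).toLinearMap - a • 1 : Module.End ℂ (analyticAlgebra d)) ⟨Δ, hΔ⟩ -
          δ₁ ∈ vanishingIdeal d ⊤ := by
        rw [mem_vanishingIdeal_top]
        filter_upwards [hΔe] with x hx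
        change (Δ (f x) - a * Δ x) - δ₁.1 x = 0
        rw [hx, sub_self]
      have h3 := Ideal.add_mem _ (sub_smul_pow_mem_vanishingIdeal (hf := hf) (h0 := h0) a n h2) h1
      rw [map_sub, sub_add_sub_cancel] at h3
      rwa [pow_succ]
  obtain ⟨n, hn⟩ := (isGenEigenjet_iff hf h0).1 hφ
  obtain ⟨δ, hδ, h⟩ := hsurj n _ hn
  refine ⟨φ - δ, by simpa using hδ, (isGenEigenjet_iff hf h0).2 ⟨n, ?_⟩⟩
  rw [map_sub, ← neg_sub]
  exact neg_mem h

/-- The injective counterpart of the lifting: `f^* - a` has no kernel among germs of order `K`, so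
its powers have none either. A generalized eigengerm is thus determined by its `K`-jet. -/
theorem IsGenEigenjet.mem_top_of_mem (hc : ContractsOn f C κ R) {K : ℕ} {a : ℂ}
    (ha : κ ^ K < ‖a‖) {φ : analyticAlgebra d} (hφ : IsGenEigenjet hf h0 ⊤ a φ)
    (hK : φ ∈ vanishingIdeal d K) : φ ∈ vanishingIdeal d ⊤ := by
  obtain ⟨n, hn⟩ := (isGenEigenjet_iff hf h0).1 hφ
  clear hφ
  induction n generalizing φ with
  | zero => simpa using hn
  | succ n ih =>
    have h1 : ((pullback hf h0).toLinearMap - a • 1 : Module.End ℂ (analyticAlgebra d)) φ ∈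
        vanishingIdeal d K := by
      simpa using sub_smul_pow_mem_vanishingIdeal (hf := hf) (h0 := h0) a 1 hK
    have h2 := ih h1 (by rwa [pow_succ] at hn)
    rw [mem_vanishingIdeal_top] at h2 ⊢
    refine eventually_eq_zero_of_comp_eq_smul hc (mem_vanishingIdeal_natCast.1 hK) ha ?_
    filter_upwards [h2] with x hx
    exact sub_eq_zero.1 hx

end Lift

end Pullback

/-! ### Differentials and the action on the cotangent space -/

/-- The differential at `0`. -/
noncomputable def differential (d : ℕ) :
    analyticAlgebra d →ₗ[ℂ] Module.Dual ℂ (Fin d → ℂ) where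
  toFun φ := (fderiv ℂ φ.1 0 : (Fin d → ℂ) →ₗ[ℂ] ℂ)
  map_add' φ ψ := by
    have h := fderiv_add (AnalyticAt.differentiableAt φ.2) (AnalyticAt.differentiableAt ψ.2)
    exact LinearMap.ext fun x => congrArg (fun B : (Fin d → ℂ) →L[ℂ] ℂ => B x) h
  map_smul' a φ := by
    have h := fderiv_const_smul (AnalyticAt.differentiableAt φ.2) a
    exact LinearMap.ext fun x => congrArg (fun B : (Fin d → ℂ) →L[ℂ] ℂ => B x) h

theorem hasFDerivAt_differential (φ : analyticAlgebra d) :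
    HasFDerivAt φ.1 (LinearMap.toContinuousLinearMap (differential d φ)) 0 :=
  (AnalyticAt.differentiableAt φ.2).hasFDerivAt

theorem differential_eq_of_hasFDerivAt {φ : analyticAlgebra d} {B : (Fin d → ℂ) →L[ℂ] ℂ}
    (h : HasFDerivAt φ.1 B 0) : differential d φ = B :=
  congrArg (fun B : (Fin d → ℂ) →L[ℂ] ℂ => (B : (Fin d → ℂ) →ₗ[ℂ] ℂ)) h.fderiv

theorem differential_mul (φ ψ : analyticAlgebra d) :
    differential d (φ * ψ) = φ.1 0 • differential d ψ + ψ.1 0 • differential d φ :=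
  (differential_eq_of_hasFDerivAt (φ := φ * ψ)
    ((hasFDerivAt_differential φ).mul (hasFDerivAt_differential ψ))).trans rfl

theorem differential_algebraMap (a : ℂ) : differential d (algebraMap ℂ _ a) = 0 :=
  (differential_eq_of_hasFDerivAt (φ := algebraMap ℂ _ a) (B := 0)
    (hasFDerivAt_const a (0 : Fin d → ℂ))).trans rfl

/-- The action of `f` on the cotangent space at the fixed point `0`. -/
noncomputable def cotangentMap (f : (Fin d → ℂ) → (Fin d → ℂ)) :
    Module.End ℂ (Module.Dual ℂ (Fin d → ℂ)) :=
  (fderiv ℂ f 0 : (Fin d → ℂ) →ₗ[ℂ] (Fin d → ℂ)).dualMap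

theorem differential_pullback {f : (Fin d → ℂ) → (Fin d → ℂ)} (hf : AnalyticAt ℂ f 0)
    (h0 : f 0 = 0) (φ : analyticAlgebra d) : differential d (pullback hf h0 φ) =
      cotangentMap f (differential d φ) := by
  have h1 : HasFDerivAt φ.1 (LinearMap.toContinuousLinearMap (differential d φ)) (f 0) := by
    rw [h0]; exact hasFDerivAt_differential φ
  exact differential_eq_of_hasFDerivAt (φ := pullback hf h0 φ) (h1.comp 0 hf.differentiableAt.hasFDerivAt)

theorem differential_eq_zero_of_mem {φ : analyticAlgebra d} (h : φ ∈ vanishingIdeal d (2 : ℕ)) :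
    differential d φ = 0 := by
  rw [mem_vanishingIdeal_natCast] at h
  refine differential_eq_of_hasFDerivAt (B := 0) (HasFDerivAt.of_isLittleO ?_)
  have h1 : φ.1 0 = 0 := by
    simpa using h.eq_zero_imp.self_of_nhds
  simp only [h1, sub_zero, _root_.zero_apply]
  refine h.trans_isLittleO ?_
  simpa using (isLittleO_norm_pow_id (E' := Fin d → ℂ) one_lt_two)

theorem differential_congr {φ ψ : analyticAlgebra d} {K : ℕ∞} (hK : 2 ≤ K)
    (h : φ - ψ ∈ vanishingIdeal d K) : differential d φ = differential d ψ := by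
  rw [← sub_eq_zero, ← map_sub]
  exact differential_eq_zero_of_mem (vanishingIdeal_anti hK h)

/-- A linear functional, as an element of the algebra of analytic functions. -/
noncomputable def ofDual (ℓ : Module.Dual ℂ (Fin d → ℂ)) : analyticAlgebra d :=
  ⟨ℓ, (LinearMap.toContinuousLinearMap ℓ).analyticAt 0⟩

theorem differential_ofDual (ℓ : Module.Dual ℂ (Fin d → ℂ)) : differential d (ofDual ℓ) = ℓ :=
  differential_eq_of_hasFDerivAt (φ := ofDual ℓ) (LinearMap.toContinuousLinearMap ℓ).hasFDerivAt

section Polynomial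

variable {ι : Type*} {x : ι → analyticAlgebra d}

theorem aeval_apply (x : ι → analyticAlgebra d) (P : MvPolynomial ι ℂ) (y : Fin d → ℂ) :
    (MvPolynomial.aeval x P).1 y = MvPolynomial.eval (fun i => (x i).1 y) P := by
  induction P using MvPolynomial.induction_on with
  | C a => simp only [MvPolynomial.aeval_C, MvPolynomial.eval_C]; rfl
  | add P Q hP hQ => rw [map_add, map_add, ← hP, ← hQ]; rfl
  | mul_X P i hP =>
    rw [map_mul, map_mul, ← hP, MvPolynomial.aeval_X, MvPolynomial.eval_X]; rfl

theorem aeval_apply_zero (hx : ∀ i, (x i).1 0 = 0) (P : MvPolynomial ι ℂ) :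
    (MvPolynomial.aeval x P).1 0 = MvPolynomial.constantCoeff P := by
  rw [aeval_apply]
  simp only [hx]
  rw [← MvPolynomial.eval_zero]
  rfl

theorem differential_aeval [Fintype ι] (hx : ∀ i, (x i).1 0 = 0) (P : MvPolynomial ι ℂ) :
    differential d (MvPolynomial.aeval x P) =
      ∑ i, P.coeff (Finsupp.single i 1) • differential d (x i) := by
  classical
  induction P using MvPolynomial.induction_on with
  | C a =>
    rw [MvPolynomial.aeval_C, differential_algebraMap, Finset.sum_eq_zero]
    intro i _
    rw [MvPolynomial.coeff_C, if_neg (by simp [eq_comm]), zero_smul]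
  | add P Q hP hQ =>
    rw [map_add, map_add, hP, hQ, ← Finset.sum_add_distrib]
    exact Finset.sum_congr rfl fun i _ => by rw [MvPolynomial.coeff_add, add_smul]
  | mul_X P i hP =>
    rw [map_mul, MvPolynomial.aeval_X, differential_mul, hx, zero_smul, add_zero,
      aeval_apply_zero hx, Finset.sum_eq_single i]
    · rw [MvPolynomial.coeff_mul_X', if_pos (by simp), tsub_self]; rfl
    · intro j _ hj
      rw [MvPolynomial.coeff_mul_X', if_neg, zero_smul]
      simp [hj.symm]
    · simp

end Polynomial

/-- A germ whose components have differentials spanning the cotangent space is biholomorphic. -/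
theorem isBiholomorphicGerm_of_finrank {E' : Type*} [NormedAddCommGroup E'] [NormedSpace ℂ E']
    [FiniteDimensional ℂ E'] {Φ : (Fin d → ℂ) → E'} (hΦ : AnalyticAt ℂ Φ 0) (h0 : Φ 0 = 0)
    (hd : Module.finrank ℂ E' = d) (hinj : ∀ w, fderiv ℂ Φ 0 w = 0 → w = 0) :
    IsBiholomorphicGerm Φ := by
  have hinj' : Function.Injective (fderiv ℂ Φ 0 : (Fin d → ℂ) →ₗ[ℂ] E') := by
    rw [← LinearMap.ker_eq_bot, LinearMap.ker_eq_bot']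
    exact hinj
  let e := LinearEquiv.ofInjectiveOfFinrankEq (fderiv ℂ Φ 0 : (Fin d → ℂ) →ₗ[ℂ] E') hinj'
    (by simp [hd])
  refine ⟨hΦ, h0, e.toContinuousLinearEquiv, ?_⟩
  convert hΦ.differentiableAt.hasFDerivAt using 1
  ext w
  rfl

theorem eq_zero_of_forall_mem_span {V : Type*} [AddCommGroup V] [Module ℂ V]
    {s : Set (Module.Dual ℂ V)} (hs : Submodule.span ℂ s = ⊤) {w : V} (h : ∀ ℓ ∈ s, ℓ w = 0) :
    w = 0 := by
  refine (Module.forall_dual_apply_eq_zero_iff ℂ w).1 fun ℓ => ?_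
  have hℓ : ℓ ∈ Submodule.span ℂ s := hs ▸ Submodule.mem_top
  induction hℓ using Submodule.span_induction with
  | mem ℓ hℓ => exact h ℓ hℓ
  | zero => rfl
  | add a b _ _ ha hb => rw [LinearMap.add_apply, ha, hb, add_zero]
  | smul a b _ hb => rw [LinearMap.smul_apply, hb, smul_zero]

section Eigenjets

variable {f : (Fin d → ℂ) → (Fin d → ℂ)} {hf : AnalyticAt ℂ f 0} {h0 : f 0 = 0}

/-- As `0` is fixed, each application of `f^* - a` multiplies the value at `0` by `1 - a`, which is
not zero. -/
theorem IsGenEigenjet.apply_zero {K : ℕ∞} (hK : 1 ≤ K) {a : ℂ} (ha : a ≠ 1)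
    {φ : analyticAlgebra d} (h : IsGenEigenjet hf h0 K a φ) : φ.1 0 = 0 := by
  obtain ⟨n, hn⟩ := (isGenEigenjet_iff hf h0).1 h
  have h1 : ∀ (n : ℕ) (φ : analyticAlgebra d), ((((pullback hf h0).toLinearMap - a • 1 :
      Module.End ℂ (analyticAlgebra d)) ^ n) φ).1 0 = (1 - a) ^ n * φ.1 0 := by
    intro n
    induction n with
    | zero => intro φ; simp
    | succ n ih =>
      intro φ
      rw [pow_succ, Module.End.mul_apply, ih]
      have : (((pullback hf h0).toLinearMap - a • 1 : Module.End ℂ (analyticAlgebra d)) φ).1 0 =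
          φ.1 (f 0) - a * φ.1 0 := rfl
      rw [this, h0]; ring
  have h2 := vanishingIdeal_anti hK hn
  have h3 := (mem_vanishingIdeal_natCast (K := 1)).1 (by exact_mod_cast h2)
  have h4 := h3.eq_zero_imp.self_of_nhds
  rw [h1] at h4
  have h5 := h4 (by simp)
  exact (mul_eq_zero.1 h5).resolve_left (pow_ne_zero _ (sub_ne_zero.2 ha.symm))

/-- Generalized eigenvectors of the cotangent map are differentials of generalized eigenjets. -/
theorem exists_isGenEigenjet_differential_eq (hf : AnalyticAt ℂ f 0) (h0 : f 0 = 0) {K : ℕ}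
    (hK : 2 ≤ K) {a : ℂ} {ℓ : Module.Dual ℂ (Fin d → ℂ)} (hℓ : ℓ ∈ Module.End.maxGenEigenspace
      (cotangentMap f) a) :
    ∃ φ, IsGenEigenjet hf h0 K a φ ∧ differential d φ = ℓ := by
  have hK' : (2 : ℕ∞) ≤ K := by exact_mod_cast hK
  let q := Submodule.Quotient.restrictScalarsEquiv ℂ (vanishingIdeal d K)
  -- For `K ≥ 2` the differential factors through `K`-jets, equivariantly and onto, and generalized
  -- eigenvectors lift along such maps.
  let π : (analyticAlgebra d ⧸ vanishingIdeal d K) →ₗ[ℂ] Module.Dual ℂ (Fin d → ℂ) :=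
    (Submodule.liftQ ((vanishingIdeal d K).restrictScalars ℂ) (differential d) fun φ hφ =>
      differential_eq_zero_of_mem (vanishingIdeal_anti hK' hφ)) ∘ₗ q.symm.toLinearMap
  have hπ : ∀ φ, π (Ideal.Quotient.mkₐ ℂ (vanishingIdeal d K) φ) = differential d φ := fun φ => rfl
  obtain ⟨x, hx, hxℓ⟩ := exists_lift_maxGenEigenspace (T := (jetMap hf h0 K).toLinearMap) (π := π)
    (fun x => by
      obtain ⟨φ, rfl⟩ := Ideal.Quotient.mkₐ_surjective ℂ _ x
      rw [hπ]
      exact differential_pullback hf h0 φ)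
    (fun ℓ => ⟨Ideal.Quotient.mkₐ ℂ _ (ofDual ℓ), differential_ofDual ℓ⟩) hℓ
  obtain ⟨φ, rfl⟩ := Ideal.Quotient.mkₐ_surjective ℂ _ x
  exact ⟨φ, hx, hxℓ⟩

end Eigenjets

/-! ### Coordinates along the generalized critical set -/

variable {f : (Fin d → ℂ) → (Fin d → ℂ)}

theorem mem_generalizedCriticalSet_of_apply {E : Type*} [NormedAddCommGroup E] [NormedSpace ℂ E]
    {f : E → E} {x : E} (h : f x ∈ generalizedCriticalSet f) : x ∈ generalizedCriticalSet f := by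
  obtain ⟨n, hn⟩ := h
  exact ⟨n + 1, by rwa [Function.iterate_succ_apply]⟩

/-- The components of the critical hyperplanes pull back to units times monomials. -/
theorem exists_pullback_eq_unit_mul_monomial (hf : AnalyticAt ℂ f 0) (h0 : f 0 = 0)
    {c : (Fin d → ℂ) → (Fin d → ℂ)} {I : Finset (Fin d)} (hc : IsBiholomorphicGerm c)
    (hS : ∀ᶠ x in 𝓝 (0 : Fin d → ℂ), (x ∈ generalizedCriticalSet f ↔ ∃ i ∈ I, c x i = 0))
    {i : Fin d} (hi : i ∈ I) :
    ∃ (n : Fin d → ℕ) (ε : (Fin d → ℂ) → ℂ), AnalyticAt ℂ ε 0 ∧ ε 0 ≠ 0 ∧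
      ∀ᶠ x in 𝓝 0, c (f x) i = ε x * ∏ j ∈ I, c x j ^ n j := by
  have hft : Tendsto f (𝓝 0) (𝓝 0) := by simpa [h0] using hf.continuousAt.tendsto
  have hcf : AnalyticAt ℂ (fun x => c (f x)) 0 :=
    AnalyticAt.comp (by rw [h0]; exact hc.analyticAt) hf
  refine hc.exists_eq_unit_mul_monomial (φ := fun x => c (f x) i) (analyticAt_pi_iff.1 hcf i) ?_ ?_
  -- If `c i ∘ f` vanished identically, `df` would be nowhere onto near `0`. Every point would then
  -- be critical, which a union of hyperplanes does not allow.
  · intro hz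
    have hcrit : ∀ᶠ x in 𝓝 (0 : Fin d → ℂ), x ∈ generalizedCriticalSet f := by
      filter_upwards [hz.eventually_nhds, hft.eventually hc.eventually_fderiv,
        hf.eventually_analyticAt] with x h1 ⟨L, hL⟩ h3
      refine ⟨0, ?_⟩
      rw [Function.iterate_zero, id]
      have h4 : HasFDerivAt (fun x => c (f x) i) ((ContinuousLinearMap.proj i).comp
          ((L : (Fin d → ℂ) →L[ℂ] (Fin d → ℂ)).comp (fderiv ℂ f x))) x :=
        (hasFDerivAt_pi'.1 (hL.comp x h3.differentiableAt.hasFDerivAt)) i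
      have h5 : HasFDerivAt (fun x => c (f x) i) (0 : (Fin d → ℂ) →L[ℂ] ℂ) x :=
        (hasFDerivAt_const (0 : ℂ) x).congr_of_eventuallyEq h1
      have h6 := h4.unique h5
      by_contra hdet
      have h7 : Function.Surjective (fderiv ℂ f x : (Fin d → ℂ) →ₗ[ℂ] (Fin d → ℂ)) := by
        rw [← LinearMap.range_eq_top, ← LinearMap.ker_eq_bot_iff_range_eq_top]
        by_contra hker
        exact hdet (LinearMap.det_eq_zero_iff_ker_ne_bot.2 hker)
      obtain ⟨w, hw⟩ := h7 (L.symm (Pi.single i 1))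
      have h8 := congrArg (fun B : (Fin d → ℂ) →L[ℂ] ℂ => B w) h6
      have h9 : L (fderiv ℂ f x w) i = 0 := h8
      rw [show fderiv ℂ f x w = L.symm (Pi.single i 1) from hw, L.apply_symm_apply] at h9
      simp at h9
    obtain ⟨b, hb, -, hcb⟩ := hc.exists_inverse
    have hall : ∀ᶠ y in 𝓝 (0 : Fin d → ℂ), ∏ j ∈ I, y j = 0 := by
      filter_upwards [hb.tendsto.eventually (hcrit.and hS), hcb] with y ⟨h1, h2⟩ h3
      obtain ⟨j, hj, hj0⟩ := h2.1 h1
      rw [h3] at hj0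
      exact Finset.prod_eq_zero hj hj0
    obtain ⟨j, -, hj⟩ := exists_eventually_eq_zero_of_prod I (fun j _ =>
      (ContinuousLinearMap.proj (R := ℂ) (φ := fun _ : Fin d => ℂ) j).analyticAt 0) hall
    have ht : Tendsto (fun ζ : ℂ => (fun _ : Fin d => ζ)) (𝓝 0) (𝓝 0) :=
      (continuous_pi fun _ => continuous_id).tendsto' _ _ rfl
    obtain ⟨ζ, h1, h2⟩ := (((ht.eventually hj).filter_mono nhdsWithin_le_nhds).and
      (self_mem_nhdsWithin (a := (0 : ℂ)) (s := {0}ᶜ))).exists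
    exact h2 h1
  · filter_upwards [hft.eventually hS, hS] with x h1 h2 h3
    exact h2.1 (mem_generalizedCriticalSet_of_apply (h1.2 ⟨i, hi, h3⟩))

/-- Coordinates `(u, y)` along the generalized critical set: `u` for the periodic hyperplanes, on
which `f` acts as a monomial map, and `y` for the other ones. -/
structure CriticalCoordinates (hf : AnalyticAt ℂ f 0) (h0 : f 0 = 0) where
  r : ℕ
  p : ℕ
  σ : Equiv.Perm (Fin r)
  C : Matrix (Fin r) (Fin p) ℕ
  D : Matrix (Fin p) (Fin p) ℕ
  α : Fin r → ℂ
  β : Fin p → ℂ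
  u : Fin r → analyticAlgebra d
  y : Fin p → analyticAlgebra d
  g : Fin p → analyticAlgebra d
  not_periodic : ∀ (j : Fin p) (m : ℕ), 1 ≤ m →
    (internalAction (σ.permMatrix ℕ) C D ^ m).col (Sum.inr j) ≠ Pi.single (Sum.inr j) 1
  α_ne_zero : ∀ i, α i ≠ 0
  β_ne_zero : ∀ j, β j ≠ 0
  u_zero : ∀ i, (u i).1 0 = 0
  y_zero : ∀ j, (y j).1 0 = 0
  g_zero : ∀ j, (g j).1 0 = 0
  u_map : ∀ i, ∀ᶠ x in 𝓝 0, (u i).1 (f x) = α i * (u (σ⁻¹ i)).1 x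
  y_map : ∀ j, ∀ᶠ x in 𝓝 0, (y j).1 (f x) = β j * matPow (fun i => (u i).1 x) C j *
    matPow (fun i => (y i).1 x) D j * (1 + (g j).1 x)
  linearIndependent : LinearIndependent ℂ
    (Sum.elim (fun i => differential d (u i)) fun j => differential d (y j))
  critical : ∀ᶠ x in 𝓝 0, x ∈ generalizedCriticalSet f ↔
    (∏ i, (u i).1 x) * (∏ j, (y j).1 x) = 0
  pow_mem_span : ∀ j, ∃ n,
    (cotangentMap f ^ n)
      (differential d (y j)) ∈ Submodule.span ℂ (Set.range fun i => differential d (u i))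

section Linearization

variable {ι : Type*} [Fintype ι] [DecidableEq ι]

/-- The cotangent map on differentials of functions that pull back to units times monomials. -/
theorem cotangentMap_differential_of_monomial (hf : AnalyticAt ℂ f 0) (h0 : f 0 = 0)
    {c ε : ι → analyticAlgebra d} {A : Matrix ι ι ℕ} (hc : ∀ i, (c i).1 0 = 0)
    (h : ∀ i, ∀ᶠ x in 𝓝 0, (c i).1 (f x) = (ε i).1 x * ∏ j, (c j).1 x ^ A j i)
    (hA : ∀ i, ∃ j, A j i ≠ 0) (i : ι) :
    cotangentMap f (differential d (c i)) =
      (ε i).1 0 • ∑ k, if A.col i = Pi.single k 1 then differential d (c k) else 0 := by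
  -- The monomial vanishes at `0` because column `i` is non-zero. So only the value of the unit at
  -- `0` matters, and the linear part survives only for a monomial that is a single variable.
  let P : MvPolynomial ι ℂ := MvPolynomial.monomial (Finsupp.equivFunOnFinite.symm (A.col i)) 1
  have hP : ∀ x, (MvPolynomial.aeval c P).1 x = ∏ j, (c j).1 x ^ A j i := by
    intro x
    rw [aeval_apply, MvPolynomial.eval_monomial, Finsupp.prod_fintype _ _ (by simp), one_mul]
    rfl
  have h1 : pullback hf h0 (c i) - ε i * MvPolynomial.aeval c P ∈ vanishingIdeal d ⊤ := by
    rw [mem_vanishingIdeal_top]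
    filter_upwards [h i] with x hx
    change (c i).1 (f x) - (ε i).1 x * (MvPolynomial.aeval c P).1 x = 0
    rw [hx, hP, sub_self]
  rw [← differential_pullback hf h0, differential_congr le_top h1, differential_mul,
    differential_aeval hc, aeval_apply_zero hc]
  have h2 : MvPolynomial.constantCoeff P = 0 := by
    obtain ⟨j, hj⟩ := hA i
    rw [MvPolynomial.constantCoeff_monomial, if_neg]
    intro h
    exact hj (DFunLike.congr_fun h j)
  rw [h2, zero_smul, add_zero]
  congr 1
  refine Finset.sum_congr rfl fun k _ => ?_
  rw [MvPolynomial.coeff_monomial]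
  have h3 : Finsupp.equivFunOnFinite.symm (A.col i) = Finsupp.single k 1 ↔
      A.col i = Pi.single k 1 := by
    rw [Equiv.symm_apply_eq]
    have : Finsupp.equivFunOnFinite (Finsupp.single k 1) = (Pi.single k 1 : ι → ℕ) := by
      ext j; simp [Finsupp.single_apply, Pi.single_apply, eq_comm]
    rw [this]
  simp only [h3]
  split_ifs <;> simp

/-- To first order, a component survives `n` pull-backs only if each successive monomial is a single
variable. The set on the right then has one element, and otherwise the span may be zero. -/
theorem cotangentMap_pow_differential_mem (hf : AnalyticAt ℂ f 0) (h0 : f 0 = 0)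
    {c ε : ι → analyticAlgebra d} {A : Matrix ι ι ℕ} (hc : ∀ i, (c i).1 0 = 0)
    (h : ∀ i, ∀ᶠ x in 𝓝 0, (c i).1 (f x) = (ε i).1 x * ∏ j, (c j).1 x ^ A j i)
    (hA : ∀ i, ∃ j, A j i ≠ 0) (n : ℕ) (i : ι) :
    (cotangentMap f ^ n)
      (differential d (c i)) ∈ Submodule.span ℂ
        ((fun k => differential d (c k)) '' {k | (A ^ n).col i = Pi.single k 1}) := by
  induction n generalizing i with
  | zero =>
    refine Submodule.subset_span ⟨i, ?_, rfl⟩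
    ext j; simp [Matrix.col_apply, Matrix.one_apply, Pi.single_apply]
  | succ n ih =>
    rw [pow_succ (cotangentMap f), Module.End.mul_apply, cotangentMap_differential_of_monomial hf h0 hc h hA, map_smul,
      map_sum]
    refine Submodule.smul_mem _ _ (Submodule.sum_mem _ fun k _ => ?_)
    split_ifs with hk
    · refine Submodule.span_mono (Set.image_mono fun m hm => ?_) (ih k)
      have := col_pow_add (A := A) (a := 1) (by rwa [pow_one]) n
      exact this.trans hm
    · simp

end Linearization

theorem IsBiholomorphicGerm.linearIndependent_differential {c : (Fin d → ℂ) → (Fin d → ℂ)}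
    (hc : IsBiholomorphicGerm c) {c' : Fin d → analyticAlgebra d}
    (hc' : ∀ i x, (c' i).1 x = c x i) : LinearIndependent ℂ fun i => differential d (c' i) := by
  obtain ⟨L, hL⟩ := hc.invertible
  have h1 : ∀ i w, differential d (c' i) w = L w i := by
    intro i w
    have h2 : HasFDerivAt (c' i).1 ((ContinuousLinearMap.proj i).comp
        (L : (Fin d → ℂ) →L[ℂ] (Fin d → ℂ))) 0 := by
      rw [show (c' i).1 = fun x => c x i from funext (hc' i)]
      exact (hasFDerivAt_pi'.1 hL) i
    rw [differential_eq_of_hasFDerivAt h2]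
    rfl
  rw [Fintype.linearIndependent_iff]
  intro a ha i
  have h2 := congrArg (fun ℓ : Module.Dual ℂ (Fin d → ℂ) => ℓ (L.symm (Pi.single i 1))) ha
  simpa [LinearMap.sum_apply, h1, Pi.single_apply] using h2


/-- For a periodic component `c i ∘ f = ε i * c (σ⁻¹ i)`. Putting `u i = c i * exp (θ i)`, the unit
becomes its value `α i` at `0` as soon as `θ (σ⁻¹ i) = log (ε i / α i) + θ i ∘ f`. The non-periodic
components are kept as they are. -/
theorem exists_criticalCoordinates (hf : AnalyticAt ℂ f 0) (h0 : f 0 = 0) {C₀ κ R : ℝ}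
    (hc : ContractsOn f C₀ κ R) (hr : HasSimpleNormalCrossings (generalizedCriticalSet f)) :
    Nonempty (CriticalCoordinates hf h0) := by
  classical
  obtain ⟨Φ, I, hΦ, hS⟩ := hr
  choose n ε₀ hε₀ hε₀0 he₀ using
    fun i : {i // i ∈ I} => exists_pullback_eq_unit_mul_monomial hf h0 hΦ hS i.2
  let A₀ : Matrix {i // i ∈ I} {i // i ∈ I} ℕ := Matrix.of fun j i => n i j
  have hprod₀ : ∀ i x, ∏ j ∈ I, Φ x j ^ n i j = ∏ j : {i // i ∈ I}, Φ x j ^ A₀ j i := fun i x =>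
    (Finset.prod_coe_sort I fun j => Φ x j ^ n i j).symm
  -- A zero column would make `c i ∘ f` a unit, although it vanishes at `0`.
  have hA₀ : ∀ i, ∃ j, A₀ j i ≠ 0 := by
    intro i
    by_contra! hz
    have h1 := (he₀ i).self_of_nhds
    rw [h0, hprod₀, hΦ.map_zero, Finset.prod_eq_one fun j _ => by rw [hz j, pow_zero],
      mul_one] at h1
    exact hε₀0 i h1.symm
  obtain ⟨r, p, e, σ, C, D, hAe, hnp, hdyn⟩ := exists_internalAction_eq hA₀
  set A := internalAction (σ.permMatrix ℕ) C D with hA_def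
  have hAe' : ∀ i j, A i j = A₀ (e i) (e j) := fun i j => by rw [← hAe]; rfl
  let coord : Fin d → analyticAlgebra d := fun i => ⟨fun x => Φ x i, analyticAt_pi_iff.1 hΦ.analyticAt i⟩
  let c : Fin r ⊕ Fin p → analyticAlgebra d := fun i => coord (e i)
  let ε : Fin r ⊕ Fin p → analyticAlgebra d := fun i => ⟨ε₀ (e i), hε₀ (e i)⟩
  have hc0 : ∀ i, (c i).1 0 = 0 := fun i => by
    change Φ 0 _ = 0
    rw [hΦ.map_zero]; rfl
  have hA : ∀ i, ∃ j, A j i ≠ 0 := fun i => by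
    obtain ⟨j, hj⟩ := hA₀ (e i)
    exact ⟨e.symm j, by rwa [hAe', Equiv.apply_symm_apply]⟩
  have hmap : ∀ i, ∀ᶠ x in 𝓝 0, (c i).1 (f x) = (ε i).1 x * ∏ j, (c j).1 x ^ A j i := by
    intro i
    filter_upwards [he₀ (e i)] with x hx
    change Φ (f x) (e i) = ε₀ (e i) x * ∏ j, Φ x (e j) ^ A j i
    rw [hx, hprod₀, ← Equiv.prod_comp e]
    simp only [hAe']
  have hli : LinearIndependent ℂ fun i => differential d (c i) :=
    (hΦ.linearIndependent_differential (c' := coord) fun _ _ => rfl).comp (fun i => (e i : Fin d))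
      (Subtype.val_injective.comp e.injective)
  have hft : Tendsto f (𝓝 0) (𝓝 0) := by simpa [h0] using hf.continuousAt.tendsto
  -- linearization of the units of the periodic hyperplanes
  let α : Fin r → ℂ := fun i => (ε (Sum.inl i)).1 0
  have hα : ∀ i, α i ≠ 0 := fun i => hε₀0 _
  have hψ : AnalyticAt ℂ (fun x i => Complex.log ((ε (Sum.inl i)).1 x / α i)) 0 := by
    rw [analyticAt_pi_iff]
    intro i
    refine AnalyticAt.clog ((hε₀ _).div analyticAt_const (hα i)) ?_
    rw [div_self (hα i)]
    exact Complex.one_mem_slitPlane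
  have hψ0 : (fun i => Complex.log ((ε (Sum.inl i)).1 0 / α i)) = (0 : Fin r → ℂ) := by
    ext i
    change Complex.log ((ε (Sum.inl i)).1 0 / (ε (Sum.inl i)).1 0) = 0
    rw [div_self (hα i), Complex.log_one]
  -- The system for `θ` is the cohomological equation with `N` a permutation of the coordinates.
  -- Since `‖N‖ ≤ 1`, order `K = 1`, that is `ψ 0 = 0`, is enough.
  let N : (Fin r → ℂ) →L[ℂ] (Fin r → ℂ) :=
    ContinuousLinearMap.pi fun i => ContinuousLinearMap.proj (σ i)
  have hN : ‖N‖ ≤ 1 := ContinuousLinearMap.opNorm_le_bound _ zero_le_one fun w => by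
    rw [one_mul, pi_norm_le_iff_of_nonneg (norm_nonneg w)]
    exact fun i => norm_le_pi_norm w (σ i)
  obtain ⟨θ, hθ, hθO, hθe⟩ := exists_cohomological hc hf h0 hψ (K := 1) (by
    have := hψ.differentiableAt.isBigO_sub
    rw [hψ0] at this
    simpa using this.norm_right) N (by
    rw [pow_one]
    exact (mul_le_of_le_one_left hc.κ_pos.le hN).trans_lt hc.κ_lt_one)
  have hθ0 : θ 0 = 0 := by simpa using hθO.eq_zero_imp.self_of_nhds
  have hθi : ∀ i, AnalyticAt ℂ (fun x => θ x i) 0 := fun i => analyticAt_pi_iff.1 hθ i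
  let E : Fin r → analyticAlgebra d := fun i => ⟨fun x => Complex.exp (θ x i), (hθi i).cexp⟩
  have hE0 : ∀ i, (E i).1 0 = 1 := fun i => by
    change Complex.exp (θ 0 i) = 1
    rw [hθ0]; simp
  have hEne : ∀ i x, (E i).1 x ≠ 0 := fun i x => Complex.exp_ne_zero _
  let u : Fin r → analyticAlgebra d := fun i => c (Sum.inl i) * E i
  have hu : ∀ i x, (u i).1 x = (c (Sum.inl i)).1 x * (E i).1 x := fun _ _ => rfl
  have hu0 : ∀ i, (u i).1 0 = 0 := fun i => by rw [hu, hc0, zero_mul]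
  have hdu : ∀ i, differential d (u i) = differential d (c (Sum.inl i)) := fun i => by
    rw [differential_mul, hc0, zero_smul, zero_add, hE0, one_smul]
  have hdu' : (fun i => differential d (u i)) = fun i => differential d (c (Sum.inl i)) :=
    funext hdu
  let β : Fin p → ℂ := fun j => (ε (Sum.inr j)).1 0
  have hβ : ∀ j, β j ≠ 0 := fun j => hε₀0 _
  -- Replacing `c` by `u = c E` inside the monomial costs the factor `∏ E l ^ C l j`, which is
  -- divided out of the normalized unit.
  let G : Fin p → (Fin d → ℂ) → ℂ := fun j x =>
    (ε (Sum.inr j)).1 x / β j * (∏ l, (E l).1 x ^ C l j)⁻¹ - 1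
  have hG : ∀ j, AnalyticAt ℂ (G j) 0 := fun j => by
    refine (((hε₀ _).div analyticAt_const (hβ j)).mul (AnalyticAt.inv ?_ ?_)).sub analyticAt_const
    · exact Finset.analyticAt_fun_prod _ fun l _ => AnalyticAt.pow (E l).2 _
    · exact Finset.prod_ne_zero_iff.2 fun l _ => pow_ne_zero _ (hEne l 0)
  refine ⟨{ r := r, p := p, σ := σ, C := C, D := D, α := α, β := β, u := u,
            y := fun j => c (Sum.inr j), g := fun j => ⟨G j, hG j⟩, not_periodic := hnp,
            α_ne_zero := hα, β_ne_zero := hβ, u_zero := hu0, y_zero := fun j => hc0 _,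
            g_zero := fun j => ?_, u_map := fun i => ?_, y_map := fun j => ?_,
            linearIndependent := ?_, critical := ?_, pow_mem_span := fun j => ?_ }⟩
  · change (ε (Sum.inr j)).1 0 / (ε (Sum.inr j)).1 0 * (∏ l, (E l).1 0 ^ C l j)⁻¹ - 1 = 0
    rw [div_self (hβ j)]
    simp [hE0]
  · have hεc := (hε₀ (e (Sum.inl i))).continuousAt.eventually_ne (hε₀0 _)
    filter_upwards [hmap (Sum.inl i), hθe, hεc] with x h1 h2 h3
    have h4 : ∏ j, (c j).1 x ^ A j (Sum.inl i) = (c (Sum.inl (σ⁻¹ i))).1 x := by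
      rw [Fintype.prod_sum_type]
      have h5 : ∏ j, (c (Sum.inr j)).1 x ^ A (Sum.inr j) (Sum.inl i) = 1 :=
        Finset.prod_eq_one fun j _ => by
          rw [hA_def, internalAction, Matrix.fromBlocks_apply₂₁, Matrix.zero_apply, pow_zero]
      have h6 := matPow_permMatrix σ (fun l => (c (Sum.inl l)).1 x) i
      rw [h5, mul_one, ← h6]
      rfl
    have h7 : θ x (σ⁻¹ i) = Complex.log ((ε (Sum.inl i)).1 x / α i) + θ (f x) i := by
      have := congrFun h2 (σ⁻¹ i)
      simpa [N] using this
    rw [hu, hu, h1, h4]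
    change _ * _ * Complex.exp (θ (f x) i) = α i * (_ * Complex.exp (θ x (σ⁻¹ i)))
    rw [h7, Complex.exp_add, Complex.exp_log (div_ne_zero h3 (hα i))]
    have := hα i
    field_simp
    exact mul_comm _ _
  · filter_upwards [hmap (Sum.inr j)] with x h1
    rw [h1, Fintype.prod_sum_type]
    have h2 : matPow (fun i => (u i).1 x) C j = (∏ l, (c (Sum.inl l)).1 x ^ C l j) *
        ∏ l, (E l).1 x ^ C l j := by
      simp only [matPow, hu, mul_pow, Finset.prod_mul_distrib]
    have h3 : ∏ l, (E l).1 x ^ C l j ≠ 0 :=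
      Finset.prod_ne_zero_iff.2 fun l _ => pow_ne_zero _ (hEne l x)
    have h4 := hβ j
    rw [h2]
    change (ε (Sum.inr j)).1 x * ((∏ l, (c (Sum.inl l)).1 x ^ C l j) *
      ∏ l, (c (Sum.inr l)).1 x ^ D l j) = β j * ((∏ l, (c (Sum.inl l)).1 x ^ C l j) *
      ∏ l, (E l).1 x ^ C l j) * (∏ l, (c (Sum.inr l)).1 x ^ D l j) *
      (1 + ((ε (Sum.inr j)).1 x / β j * (∏ l, (E l).1 x ^ C l j)⁻¹ - 1))
    field_simp
    ring
  · convert hli using 1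
    ext i : 1
    rcases i with i | j
    · exact hdu i
    · rfl
  · filter_upwards [hS] with x hx
    rw [hx, mul_eq_zero, Finset.prod_eq_zero_iff, Finset.prod_eq_zero_iff]
    constructor
    · rintro ⟨i, hi, hi0⟩
      rcases hk : e.symm ⟨i, hi⟩ with k | k
      · refine Or.inl ⟨k, Finset.mem_univ _, ?_⟩
        rw [hu]
        have : (c (Sum.inl k)).1 x = Φ x i := by
          change Φ x (e (Sum.inl k)) = _
          rw [← hk, Equiv.apply_symm_apply]
        rw [this, hi0, zero_mul]
      · refine Or.inr ⟨k, Finset.mem_univ _, ?_⟩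
        change Φ x (e (Sum.inr k)) = 0
        rw [← hk, Equiv.apply_symm_apply]
        exact hi0
    · rintro (⟨k, -, hk⟩ | ⟨k, -, hk⟩)
      · rw [hu] at hk
        exact ⟨_, (e (Sum.inl k)).2, (mul_eq_zero.1 hk).resolve_right (hEne k x)⟩
      · exact ⟨_, (e (Sum.inr k)).2, hk⟩
  -- After `m` steps either no basis column is left and `dy` is killed, or the column is a periodic
  -- index and `dy` lands in the span of the `du`.
  · obtain ⟨m, hm⟩ := hdyn (Sum.inr j)
    refine ⟨m, ?_⟩
    have h1 := cotangentMap_pow_differential_mem hf h0 hc0 hmap hA m (Sum.inr j)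
    refine Submodule.span_mono ?_ h1
    rw [hdu']
    rintro _ ⟨k, hk, rfl⟩
    rcases hm with hm | ⟨l, hl⟩
    · exact absurd hk (hm k)
    · have hkl : k = Sum.inl l := by
        have h2 := congrFun (hl.symm.trans hk) (Sum.inl l)
        rw [Pi.single_eq_same, Pi.single_apply] at h2
        by_contra hne
        rw [if_neg (Ne.symm hne)] at h2
        exact one_ne_zero h2
      rw [hkl]
      exact ⟨l, rfl⟩

/-! ### Coordinates with resonant polynomial dynamics -/

/-- A linearly independent family extends to a basis by generalized eigenvectors. -/
theorem exists_basis_extension_genEigenvectors {V : Type*} [AddCommGroup V] [Module ℂ V]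
    [FiniteDimensional ℂ V] (L : Module.End ℂ V) {r : ℕ} {w : Fin r → V}
    (hw : LinearIndependent ℂ w) :
    ∃ (e q : ℕ) (μ : Fin e → ℂ) (v : Fin e → V) (z : Fin q → V),
      (∀ k, μ k ≠ 0) ∧ (∀ k, v k ∈ L.maxGenEigenspace (μ k)) ∧
      (∀ k, z k ∈ L.maxGenEigenspace 0) ∧
      LinearIndependent ℂ (Sum.elim (Sum.elim w v) z) ∧
      Submodule.span ℂ (Set.range (Sum.elim (Sum.elim w v) z)) = ⊤ := by
  classical
  -- The `w i` need not be generalized eigenvectors: the `du` are only permuted up to scalars. So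
  -- the extension takes place in the family of the `w i` together with all generalized
  -- eigenvectors, which spans.
  let J := Fin r ⊕ {x : V // ∃ a, x ∈ L.maxGenEigenspace a}
  let F : J → V := Sum.elim w Subtype.val
  have hs : LinearIndepOn ℂ F (Set.range Sum.inl) := by
    rw [linearIndepOn_range_iff Sum.inl_injective]
    exact hw
  obtain ⟨b, -, hsb, hspan, hb⟩ := exists_linearIndepOn_extension hs (Set.subset_univ _)
  have htop : Submodule.span ℂ (F '' b) = ⊤ := by
    rw [eq_top_iff, ← Module.End.iSup_maxGenEigenspace_eq_top L, iSup_le_iff]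
    intro a x hx
    exact hspan ⟨Sum.inr ⟨x, a, hx⟩, trivial, rfl⟩
  choose χ hχ using fun x : {x : V // ∃ a, x ∈ L.maxGenEigenspace a} => x.2
  have hbfin : Finite b := hb.linearIndependent.finite
  have hinj : Function.Injective fun x : {x // Sum.inr x ∈ b} => (⟨Sum.inr x.1, x.2⟩ : b) :=
    fun x y h => Subtype.ext (Sum.inr_injective (congrArg Subtype.val h))
  have hfin : Finite {x // Sum.inr x ∈ b} := Finite.of_injective _ hinj
  have := Fintype.ofFinite {x // Sum.inr x ∈ b}
  let eb := Fintype.equivFin {x : {x // Sum.inr x ∈ b} // χ x.1 ≠ 0}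
  let eq := Fintype.equivFin {x : {x // Sum.inr x ∈ b} // ¬ χ x.1 ≠ 0}
  let v := fun k => (eb.symm k).1.1
  let z := fun k => (eq.symm k).1.1
  let G : (Fin r ⊕ Fin _) ⊕ Fin _ → b := Sum.elim (Sum.elim (fun i => ⟨Sum.inl i, hsb ⟨i, rfl⟩⟩)
    fun k => ⟨Sum.inr (v k), (eb.symm k).1.2⟩) fun k => ⟨Sum.inr (z k), (eq.symm k).1.2⟩
  have hG : Sum.elim (Sum.elim w fun k => (v k).1) (fun k => (z k).1) = fun i => F (G i) := by
    ext1 i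
    rcases i with (i | i) | i <;> rfl
  have hGinj : Function.Injective G := by
    rintro ((i | i) | i) ((j | j) | j) h <;>
      simp only [G, Sum.elim_inl, Sum.elim_inr, Subtype.mk.injEq, reduceCtorEq] at h
    · rw [Sum.inl_injective h]
    · rw [eb.symm.injective (Subtype.ext (Subtype.ext (Sum.inr_injective h)))]
    · exact absurd (show χ (z j) ≠ 0 from Sum.inr_injective h ▸ (eb.symm i).2) (eq.symm j).2
    · exact absurd (show χ (z i) ≠ 0 from (Sum.inr_injective h).symm ▸ (eb.symm j).2) (eq.symm i).2
    · rw [eq.symm.injective (Subtype.ext (Subtype.ext (Sum.inr_injective h)))]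
  have hGsurj : ∀ x ∈ b, ∃ i, (G i).1 = x := by
    rintro (i | x) hx
    · exact ⟨Sum.inl (Sum.inl i), rfl⟩
    · by_cases hχx : χ x ≠ 0
      · refine ⟨Sum.inl (Sum.inr (eb ⟨⟨x, hx⟩, hχx⟩)), ?_⟩
        change Sum.inr (eb.symm (eb _)).1.1 = _
        rw [Equiv.symm_apply_apply]
      · refine ⟨Sum.inr (eq ⟨⟨x, hx⟩, hχx⟩), ?_⟩
        change Sum.inr (eq.symm (eq _)).1.1 = _
        rw [Equiv.symm_apply_apply]
  refine ⟨_, _, fun k => χ (v k), fun k => (v k).1, fun k => (z k).1, fun k => (eb.symm k).2,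
    fun k => hχ _, fun k => ?_, ?_, ?_⟩
  · have h1 := hχ (z k)
    rwa [not_not.1 (eq.symm k).2] at h1
  · rw [hG]
    exact hb.linearIndependent.comp G hGinj
  · rw [hG, ← htop]
    congr 1
    ext y
    constructor
    · rintro ⟨i, rfl⟩
      exact ⟨_, (G i).2, rfl⟩
    · rintro ⟨x, hx, rfl⟩
      obtain ⟨i, hi⟩ := hGsurj x hx
      exact ⟨i, by rw [← hi]⟩

/-- If `a` were not an eigenvalue, `df₀ - a` would be onto and its transpose injective, along with
all powers of the transpose. -/
theorem hasEigenvalue_of_mem_maxGenEigenspace {a : ℂ} {ℓ : Module.Dual ℂ (Fin d → ℂ)}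
    (hℓ : ℓ ∈ (cotangentMap f).maxGenEigenspace a) (hne : ℓ ≠ 0) :
    Module.End.HasEigenvalue (fderiv ℂ f 0 : (Fin d → ℂ) →ₗ[ℂ] (Fin d → ℂ)) a := by
  set A : Module.End ℂ (Fin d → ℂ) := (fderiv ℂ f 0 : (Fin d → ℂ) →ₗ[ℂ] (Fin d → ℂ)) with hA
  by_contra hno
  have hker : LinearMap.ker (A - algebraMap ℂ (Module.End ℂ (Fin d → ℂ)) a) = ⊥ := by
    rw [Module.End.hasEigenvalue_iff, not_not, Module.End.eigenspace_def] at hno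
    exact hno
  have hsurj := LinearMap.range_eq_top.1 (LinearMap.ker_eq_bot_iff_range_eq_top.1 hker)
  have hinj : ∀ ℓ : Module.Dual ℂ (Fin d → ℂ), (cotangentMap f - a • 1) ℓ = 0 → ℓ = 0 := by
    intro ℓ h
    ext1 i
    obtain ⟨x, hx⟩ := hsurj (Pi.single i 1)
    have h1 := congrArg (fun m : Module.Dual ℂ (Fin d → ℂ) => m x) h
    have h2 : ℓ (A x) - a * ℓ x = 0 := h1
    have h3 : A x - a • x = Pi.single i 1 := by simpa [Algebra.algebraMap_eq_smul_one] using hx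
    ext
    simp only [LinearMap.coe_comp, Function.comp_apply, LinearMap.single_apply]
    rw [← h3, map_sub, map_smul, smul_eq_mul, h2]
    rfl
  obtain ⟨k, hk⟩ := (Module.End.mem_maxGenEigenspace _ _ _).1 hℓ
  induction k with
  | zero => exact hne (by simpa using hk)
  | succ k ih =>
    rw [pow_succ', Module.End.mul_apply] at hk
    exact ih (hinj _ hk)

theorem ContractsOn.iterate {E : Type*} [NormedAddCommGroup E] {f : E → E} {C κ R : ℝ}
    (h : ContractsOn f C κ R) {m : ℕ} (hm : m ≠ 0) : ContractsOn f^[m] C (κ ^ m) R :=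
  ⟨h.C_pos, pow_pos h.κ_pos m, pow_lt_one₀ h.κ_pos.le h.κ_lt_one hm, h.R_pos, fun x hx n => by
    rw [← Function.iterate_mul, ← pow_mul]
    exact h.norm_iterate_le x hx _⟩

namespace CriticalCoordinates

variable {hf : AnalyticAt ℂ f 0} {h0 : f 0 = 0} (cc : CriticalCoordinates hf h0)

/-- The order of the permutation of the periodic hyperplanes. -/
noncomputable def η : ℕ := orderOf (cc.σ.permMatrix ℕ)

theorem η_ne_zero : cc.η ≠ 0 := by
  unfold η
  rw [orderOf_permMatrix]
  exact (orderOf_pos cc.σ).ne'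

/-- The eigenvalues of the first iterate of `f` that is diagonal in the periodic coordinates. -/
noncomputable def ξ (i : Fin cc.r) : ℂ := ∏ k ∈ Finset.range cc.η, cc.α ((cc.σ⁻¹ ^ k) i)

theorem ξ_ne_zero (i : Fin cc.r) : cc.ξ i ≠ 0 :=
  Finset.prod_ne_zero_iff.2 fun _ _ => cc.α_ne_zero _

theorem u_iterate {C κ R : ℝ} (hc : ContractsOn f C κ R) (i : Fin cc.r) :
    ∀ᶠ x in 𝓝 0, (cc.u i).1 (f^[cc.η] x) = cc.ξ i * (cc.u i).1 x := by
  filter_upwards [hc.eventually_forall_iterate (eventually_all.2 cc.u_map)] with x hx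
  have h1 : ∀ n, (fun i => (cc.u i).1 (f^[n] x)) =
      (fun (w : Fin cc.r → ℂ) i => cc.α i * w (cc.σ⁻¹ i))^[n] fun i => (cc.u i).1 x := by
    intro n
    induction n with
    | zero => rfl
    | succ n ih =>
      rw [Function.iterate_succ_apply' fun (w : Fin cc.r → ℂ) i => cc.α i * w (cc.σ⁻¹ i), ← ih]
      ext i
      rw [Function.iterate_succ_apply', hx n i]
  have h2 := congrFun (h1 cc.η) i
  rw [iterate_monomial] at h2
  rw [h2, ξ]
  congr 2
  have h3 : cc.σ⁻¹ ^ cc.η = 1 := by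
    rw [η, orderOf_permMatrix, inv_pow, pow_orderOf_eq_one, inv_one]
  rw [h3]; rfl

theorem isGenEigenjet_u {C κ R : ℝ} (hc : ContractsOn f C κ R) (K : ℕ∞) (i : Fin cc.r) :
    IsGenEigenjet (analyticAt_iterate hf h0 cc.η) (Function.iterate_fixed h0 cc.η) K (cc.ξ i)
      (cc.u i) := by
  refine IsGenEigenjet.mono le_top (IsGenEigenjet.of_apply_sub ?_)
  rw [mem_vanishingIdeal_top]
  filter_upwards [cc.u_iterate hc i] with x hx
  change (cc.u i).1 (f^[cc.η] x) - cc.ξ i * (cc.u i).1 x = 0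
  rw [hx, sub_self]

theorem differential_u_ne_zero (i : Fin cc.r) : differential d (cc.u i) ≠ 0 :=
  cc.linearIndependent.ne_zero (Sum.inl i)

/-- Otherwise `u i`, multiplied by `ξ i` under the contracting map `f^[η]`, would have zero germ,
contrary to `du i ≠ 0`. -/
theorem norm_ξ_lt_one {C κ R : ℝ} (hc : ContractsOn f C κ R) (i : Fin cc.r) : ‖cc.ξ i‖ < 1 := by
  by_contra! hge
  refine cc.differential_u_ne_zero i (differential_eq_zero_of_mem (vanishingIdeal_anti le_top
    (mem_vanishingIdeal_top.2 ?_)))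
  have hc' := hc.iterate cc.η_ne_zero
  refine eventually_eq_zero_of_comp_eq_smul hc' (K := 1) (mem_vanishingIdeal_natCast.1
    (mem_vanishingIdeal_one (cc.u_zero i))) ?_ (cc.u_iterate hc i)
  rw [pow_one]
  exact hc'.κ_lt_one.trans_le hge

end CriticalCoordinates

/-- Functions with independent differentials that span the cotangent space generate all jets. -/
theorem exists_aeval_sub_mem {ι : Type*} [Fintype ι] {c : ι → analyticAlgebra d}
    (h0 : ∀ i, (c i).1 0 = 0) (hli : LinearIndependent ℂ fun i => differential d (c i))
    (hspan : Submodule.span ℂ (Set.range fun i => differential d (c i)) = ⊤) (K : ℕ)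
    (φ : analyticAlgebra d) :
    ∃ P : MvPolynomial ι ℂ, φ - MvPolynomial.aeval c P ∈ vanishingIdeal d K := by
  have hcard : Fintype.card ι = d := by
    rw [← Module.finrank_eq_card_basis (Module.Basis.mk hli hspan.ge), Subspace.dual_finrank_eq,
      Module.finrank_fin_fun]
  let e : ι ≃ Fin d := Fintype.equivFinOfCardEq hcard
  let c' : Fin d → analyticAlgebra d := fun j => c (e.symm j)
  have hd : HasFDerivAt (fun x j => (c' j).1 x) (ContinuousLinearMap.pi fun j =>
      LinearMap.toContinuousLinearMap (differential d (c' j))) 0 :=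
    hasFDerivAt_pi.2 fun j => hasFDerivAt_differential (c' j)
  have hb : IsBiholomorphicGerm fun x j => (c' j).1 x := by
    refine isBiholomorphicGerm_of_finrank (AnalyticAt.pi fun j => (c' j).2)
      (funext fun j => h0 _) (Module.finrank_fin_fun ℂ) fun w hw => ?_
    rw [hd.fderiv] at hw
    refine eq_zero_of_forall_mem_span hspan ?_
    rintro _ ⟨i, rfl⟩
    have h1 := congrFun hw (e i)
    change differential d (c (e.symm (e i))) w = 0 at h1
    rwa [e.symm_apply_apply] at h1
  obtain ⟨S, -, hS⟩ := hb.exists_polynomial_jets (c' := c') (fun _ _ => rfl) K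
  obtain ⟨P, -, hP⟩ := hS φ
  refine ⟨MvPolynomial.rename e.symm P, ?_⟩
  rw [MvPolynomial.aeval_rename]
  exact hP

section Quotient

variable {A ι : Type*} [CommRing A] [Algebra ℂ A] {I : Ideal A}
  {T : A ⧸ I →ₐ[ℂ] A ⧸ I} {c : ι → A} {χ : ι → ℂ} {a : ℂ} {P : MvPolynomial ι ℂ}

theorem mk_aeval (P : MvPolynomial ι ℂ) : Ideal.Quotient.mkₐ ℂ I (MvPolynomial.aeval c P) =
    MvPolynomial.aeval (fun i => Ideal.Quotient.mkₐ ℂ I (c i)) P :=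
  MvPolynomial.comp_aeval_apply c (Ideal.Quotient.mkₐ ℂ I) P

variable [Fintype ι]

theorem mk_aeval_mem_maxGenEigenspace
    (hc : ∀ i, Ideal.Quotient.mkₐ ℂ I (c i) ∈ Module.End.maxGenEigenspace T.toLinearMap (χ i))
    (hP : ∀ n ∈ P.support, ∏ i, χ i ^ n i = a) : Ideal.Quotient.mkₐ ℂ I (MvPolynomial.aeval c P) ∈
      Module.End.maxGenEigenspace T.toLinearMap a := by
  rw [mk_aeval]
  exact aeval_mem_maxGenEigenspace hc hP

theorem exists_resonant_aeval_sub_mem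
    (hc : ∀ i, Ideal.Quotient.mkₐ ℂ I (c i) ∈ Module.End.maxGenEigenspace T.toLinearMap (χ i))
    (hP : Ideal.Quotient.mkₐ ℂ I (MvPolynomial.aeval c P) ∈
      Module.End.maxGenEigenspace T.toLinearMap a) :
    ∃ Q : MvPolynomial ι ℂ, MvPolynomial.aeval c P - MvPolynomial.aeval c Q ∈ I ∧
      ∀ n ∈ Q.support, ∏ i, χ i ^ n i = a := by
  rw [mk_aeval] at hP
  obtain ⟨Q, hQ, hres⟩ := exists_resonant_aeval_eq hc hP
  refine ⟨Q, ?_, hres⟩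
  rw [← Ideal.Quotient.eq, ← Ideal.Quotient.mkₐ_eq_mk ℂ, mk_aeval, mk_aeval]
  exact hQ.symm

end Quotient

section Aeval

variable {hf : AnalyticAt ℂ f 0} {h0 : f 0 = 0} {ι : Type*} [Fintype ι]
  {c : ι → analyticAlgebra d} {χ : ι → ℂ} {K : ℕ∞} {a : ℂ}

theorem IsGenEigenjet.aeval (hc : ∀ i, IsGenEigenjet hf h0 K (χ i) (c i)) {P : MvPolynomial ι ℂ}
    (hP : ∀ n ∈ P.support, ∏ i, χ i ^ n i = a) :
    IsGenEigenjet hf h0 K a (MvPolynomial.aeval c P) :=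
  mk_aeval_mem_maxGenEigenspace hc hP

/-- A generalized eigenjet is a polynomial with only resonant monomials in coordinates that are
generalized eigenjets. -/
theorem IsGenEigenjet.exists_resonant {K : ℕ} (hc : ∀ i, IsGenEigenjet hf h0 K (χ i) (c i))
    (hz : ∀ i, (c i).1 0 = 0) (hli : LinearIndependent ℂ fun i => differential d (c i))
    (hspan : Submodule.span ℂ (Set.range fun i => differential d (c i)) = ⊤)
    {φ : analyticAlgebra d} (hφ : IsGenEigenjet hf h0 K a φ) :
    ∃ Q : MvPolynomial ι ℂ, φ - MvPolynomial.aeval c Q ∈ vanishingIdeal d K ∧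
      ∀ n ∈ Q.support, ∏ i, χ i ^ n i = a := by
  obtain ⟨P, hP⟩ := exists_aeval_sub_mem hz hli hspan K φ
  obtain ⟨Q, hQ, hres⟩ := exists_resonant_aeval_sub_mem hc (hφ.congr hP)
  refine ⟨Q, ?_, hres⟩
  rw [← sub_add_sub_cancel]
  exact Ideal.add_mem _ hP hQ

end Aeval

/-- A polynomial all of whose monomials satisfy `∏ χ i ^ n i = a ≠ 0` does not involve the
variables with `χ i = 0`. -/
theorem exists_rename_inl_eq {ι κ : Type*} [Fintype ι] [Fintype κ] {χ : ι → ℂ} {a : ℂ}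
    (ha : a ≠ 0) {Q : MvPolynomial (ι ⊕ κ) ℂ}
    (hQ : ∀ n ∈ Q.support, ∏ i, (Sum.elim χ 0 : ι ⊕ κ → ℂ) i ^ n i = a) :
    ∃ ρ : MvPolynomial ι ℂ, MvPolynomial.rename Sum.inl ρ = Q ∧
      ∀ n ∈ ρ.support, ∏ i, χ i ^ n i = a := by
  classical
  have hv : (Q.vars : Set (ι ⊕ κ)) ⊆ Set.range Sum.inl := by
    intro i hi
    obtain ⟨n, hn, hni⟩ := MvPolynomial.mem_vars_iff_mem_support i |>.1 hi
    rcases i with i | i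
    · exact ⟨i, rfl⟩
    · refine absurd ((hQ n hn).symm.trans (Finset.prod_eq_zero (Finset.mem_univ (Sum.inr i)) ?_)) ha
      exact zero_pow (Finsupp.mem_support_iff.1 hni)
  obtain ⟨ρ, rfl⟩ := MvPolynomial.exists_rename_eq_of_vars_subset_range Q Sum.inl
    Sum.inl_injective hv
  refine ⟨ρ, rfl, fun n hn => ?_⟩
  have h1 := hQ (n.mapDomain Sum.inl) (by
    rw [MvPolynomial.support_rename_of_injective Sum.inl_injective]
    exact Finset.mem_image_of_mem _ hn)
  rw [Fintype.prod_sum_type] at h1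
  simpa [Finsupp.mapDomain_apply Sum.inl_injective, Finsupp.mapDomain_of_notMem_range] using h1

/-- Lifting goes from covector to `K`-jet to germ. The condition `a ≠ 0` allows a `K` with `κ ^ K <
‖a‖`. -/
theorem exists_isGenEigenjet_top_differential_eq (hf : AnalyticAt ℂ f 0) (h0 : f 0 = 0)
    {C κ R : ℝ} (hc : ContractsOn f C κ R) {a : ℂ} (ha : a ≠ 0) (ha1 : a ≠ 1)
    {ℓ : Module.Dual ℂ (Fin d → ℂ)} (hℓ : ℓ ∈ (cotangentMap f).maxGenEigenspace a) :
    ∃ φ, IsGenEigenjet hf h0 ⊤ a φ ∧ differential d φ = ℓ ∧ φ.1 0 = 0 := by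
  obtain ⟨K, hK, hK2⟩ := (((tendsto_pow_atTop_nhds_zero_of_lt_one hc.κ_pos.le
    hc.κ_lt_one).eventually_lt_const (norm_pos_iff.2 ha)).and (eventually_ge_atTop 2)).exists
  obtain ⟨ψ, hψ, rfl⟩ := exists_isGenEigenjet_differential_eq hf h0 hK2 hℓ
  obtain ⟨φ, hφψ, hφ⟩ := hψ.exists_lift hc hK
  exact ⟨φ, hφ, (differential_congr (by exact_mod_cast hK2) hφψ).symm,
    hφ.apply_zero le_top ha1⟩

namespace CriticalCoordinates

variable {hf : AnalyticAt ℂ f 0} {h0 : f 0 = 0}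

/-- Coordinates `v` completing `u` to coordinates of the invertible part of `f`, in which `f` is
polynomial with only primary resonant monomials. -/
structure ResonantCoordinates (cc : CriticalCoordinates hf h0) where
  e : ℕ
  q : ℕ
  μ : Fin e → ℂ
  v : Fin e → analyticAlgebra d
  ρ : Fin e → MvPolynomial (Fin cc.r ⊕ Fin e) ℂ
  w : Fin q → Module.Dual ℂ (Fin d → ℂ)
  μ_ne_zero : ∀ k, μ k ≠ 0
  norm_μ_lt_one : ∀ k, ‖μ k‖ < 1
  hasEigenvalue : ∀ k, Module.End.HasEigenvalue
    (fderiv ℂ f 0 : (Fin d → ℂ) →ₗ[ℂ] (Fin d → ℂ)) (μ k)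
  differential_v_mem : ∀ k, differential d (v k) ∈ (cotangentMap f).maxGenEigenspace (μ k)
  w_mem : ∀ k, w k ∈ (cotangentMap f).maxGenEigenspace 0
  linearIndependent : LinearIndependent ℂ
    (Sum.elim (Sum.elim (fun i => differential d (cc.u i)) fun k => differential d (v k)) w)
  span_eq_top : Submodule.span ℂ (Set.range
    (Sum.elim (Sum.elim (fun i => differential d (cc.u i)) fun k => differential d (v k)) w)) = ⊤
  v_zero : ∀ k, (v k).1 0 = 0
  v_map : ∀ k, ∀ᶠ x in 𝓝 0, (v k).1 (f x) = μ k * (v k).1 x +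
    MvPolynomial.eval (Sum.elim (fun i => (cc.u i).1 x) fun k => (v k).1 x) (ρ k)
  constantCoeff_ρ : ∀ k, MvPolynomial.constantCoeff (ρ k) = 0
  resonant : ∀ k, ∀ n ∈ (ρ k).support, IsPrimaryResonant cc.η cc.ξ μ k n

/-- The defect `f^* v_k - μ_k v_k` is expanded in coordinates that are all generalized eigenjets.
Passing to the `η`-th iterate is what makes the `u i` such, with eigenvalue `ξ i`, and it is the
reason for the exponent `η` in the resonance condition. -/
theorem exists_resonantCoordinates (cc : CriticalCoordinates hf h0) {C κ R : ℝ}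
    (hc : ContractsOn f C κ R) (hcon : ∀ a : ℂ, Module.End.HasEigenvalue
      (fderiv ℂ f 0 : (Fin d → ℂ) →ₗ[ℂ] (Fin d → ℂ)) a → ‖a‖ < 1) :
    Nonempty cc.ResonantCoordinates := by
  have hu : LinearIndependent ℂ fun i => differential d (cc.u i) :=
    cc.linearIndependent.comp Sum.inl Sum.inl_injective
  obtain ⟨e, q, μ, l, w, hμ0, hl, hw, hli, hspan⟩ :=
    exists_basis_extension_genEigenvectors (cotangentMap f) hu
  have hμe : ∀ k, Module.End.HasEigenvalue
      (fderiv ℂ f 0 : (Fin d → ℂ) →ₗ[ℂ] (Fin d → ℂ)) (μ k) := fun k =>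
    hasEigenvalue_of_mem_maxGenEigenspace (hl k) (hli.ne_zero (Sum.inl (Sum.inr k)))
  have hμ1 : ∀ k, ‖μ k‖ < 1 := fun k => hcon _ (hμe k)
  have hne : ∀ {a : ℂ}, ‖a‖ < 1 → a ≠ 1 := by
    rintro a ha rfl
    simp at ha
  choose v hv hvl hv0 using fun k =>
    exists_isGenEigenjet_top_differential_eq hf h0 hc (hμ0 k) (hne (hμ1 k)) (hl k)
  obtain rfl : (fun k => differential d (v k)) = l := funext hvl
  obtain ⟨K, hK, hK2⟩ := ((eventually_all.2 fun k => (tendsto_pow_atTop_nhds_zero_of_lt_one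
    hc.κ_pos.le hc.κ_lt_one).eventually_lt_const (norm_pos_iff.2 (hμ0 k))).and
    (eventually_ge_atTop 2)).exists
  -- For eigenvalue `0` nothing lifts to germs. These jets only serve to complete a coordinate
  -- system, and they drop out of `ρ`.
  choose z hz hzw using fun k => exists_isGenEigenjet_differential_eq hf h0 hK2 (hw k)
  obtain rfl : (fun k => differential d (z k)) = w := funext hzw
  have hK1 : (1 : ℕ∞) ≤ K := by exact_mod_cast one_le_two.trans hK2
  let c : (Fin cc.r ⊕ Fin e) ⊕ Fin q → analyticAlgebra d := Sum.elim (Sum.elim cc.u v) z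
  have hcD : (fun i => differential d (c i)) = Sum.elim (Sum.elim (fun i => differential d (cc.u i))
      fun k => differential d (v k)) fun k => differential d (z k) := by
    ext1 i
    rcases i with (i | i) | i <;> rfl
  have hc0 : ∀ i, (c i).1 0 = 0 := by
    rintro ((i | i) | i)
    · exact cc.u_zero i
    · exact hv0 i
    · exact (hz i).apply_zero hK1 zero_ne_one
  let χ : Fin cc.r ⊕ Fin e → ℂ := Sum.elim cc.ξ fun k => μ k ^ cc.η
  have hcχ : ∀ i, IsGenEigenjet (analyticAt_iterate hf h0 cc.η) (Function.iterate_fixed h0 cc.η)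
      K ((Sum.elim χ 0 : (Fin cc.r ⊕ Fin e) ⊕ Fin q → ℂ) i) (c i) := by
    rintro ((i | i) | i)
    · exact cc.isGenEigenjet_u hc K i
    · exact ((hv i).mono le_top).iterate _
    · have h1 := (hz i).iterate cc.η
      rwa [zero_pow cc.η_ne_zero] at h1
  have huvχ : ∀ i, IsGenEigenjet (analyticAt_iterate hf h0 cc.η) (Function.iterate_fixed h0 cc.η)
      ⊤ (χ i) (Sum.elim cc.u v i) := by
    rintro (i | i)
    · exact cc.isGenEigenjet_u hc ⊤ i
    · exact (hv i).iterate _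
  have hφ : ∀ k, IsGenEigenjet (analyticAt_iterate hf h0 cc.η) (Function.iterate_fixed h0 cc.η)
      ⊤ (μ k ^ cc.η) (pullback hf h0 (v k) - μ k • v k) := fun k =>
    ((hv k).apply_sub).iterate _
  have key : ∀ k, ∃ ρ : MvPolynomial (Fin cc.r ⊕ Fin e) ℂ,
      pullback hf h0 (v k) - μ k • v k - MvPolynomial.aeval (Sum.elim cc.u v) ρ ∈
        vanishingIdeal d ⊤ ∧ ∀ n ∈ ρ.support, ∏ i, χ i ^ n i = μ k ^ cc.η := by
    intro k
    obtain ⟨Q, hQ, hQres⟩ := IsGenEigenjet.exists_resonant hcχ hc0 (hcD ▸ hli) (hcD ▸ hspan)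
      ((hφ k).mono le_top)
    obtain ⟨ρ, rfl, hρ⟩ := exists_rename_inl_eq (pow_ne_zero _ (hμ0 k)) hQres
    refine ⟨ρ, ?_, hρ⟩
    rw [MvPolynomial.aeval_rename] at hQ
    -- Defect and `ρ_k(u, v)` are both generalized eigengerms for `μ_k ^ η` and agree to order `K`,
    -- hence as germs.
    refine IsGenEigenjet.mem_top_of_mem (hc.iterate cc.η_ne_zero) ?_
      ((hφ k).sub (IsGenEigenjet.aeval huvχ hρ)) hQ
    rw [norm_pow, ← pow_mul, mul_comm, pow_mul]
    exact pow_lt_pow_left₀ (hK k) (pow_nonneg hc.κ_pos.le _) cc.η_ne_zero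
  choose ρ hρ hres using key
  refine ⟨⟨e, q, μ, v, ρ, _, hμ0, hμ1, hμe, hl, hw, hli, hspan, hv0, fun k => ?_, fun k => ?_,
    fun k n hn => ?_⟩⟩
  · filter_upwards [mem_vanishingIdeal_top.1 (hρ k)] with x hx
    have h1 : (v k).1 (f x) - μ k * (v k).1 x -
      (MvPolynomial.aeval (Sum.elim cc.u v) (ρ k)).1 x = 0 := hx
    rw [aeval_apply, sub_eq_zero, sub_eq_iff_eq_add'] at h1
    rw [h1, show (fun i => (Sum.elim cc.u v i).1 x) =
      Sum.elim (fun i => (cc.u i).1 x) fun k => (v k).1 x from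
      funext fun i => by rcases i with i | i <;> rfl]
  -- A constant term would be resonant only if `μ_k ^ η = 1`.
  · rw [MvPolynomial.constantCoeff_eq]
    by_contra h
    have h1 := hres k 0 (MvPolynomial.mem_support_iff.2 h)
    simp only [Finsupp.coe_zero, Pi.zero_apply, pow_zero, Finset.prod_const_one] at h1
    have h2 := pow_lt_one₀ (norm_nonneg (μ k)) (hμ1 k) cc.η_ne_zero
    rw [← norm_pow, ← h1, norm_one] at h2
    exact h2.false
  · have h1 := hres k n hn
    rw [Fintype.prod_sum_type] at h1
    simpa only [IsPrimaryResonant, pow_mul] using! h1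

end CriticalCoordinates

/-! ### The stable range and nilpotency -/

section LinearAlgebra

variable {V : Type*} [AddCommGroup V] [Module ℂ V]

theorem exists_complementary_family [FiniteDimensional ℂ V] {ι : Type*} {w : ι → V}
    (hw : LinearIndependent ℂ w) : ∃ (t : ℕ) (z : Fin t → V), LinearIndependent ℂ (Sum.elim w z) ∧
      Submodule.span ℂ (Set.range (Sum.elim w z)) = ⊤ := by
  obtain ⟨W, hW⟩ := Submodule.exists_isCompl (Submodule.span ℂ (Set.range w))
  let b := Module.finBasis ℂ W
  have hb : Submodule.span ℂ (Set.range fun i => (b i : V)) = W := by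
    have h1 := congrArg (Submodule.map W.subtype) b.span_eq
    rwa [Submodule.map_span, Submodule.map_subtype_top, ← Set.range_comp] at h1
  refine ⟨_, fun i => (b i : V), LinearIndependent.sum_type hw
    (b.linearIndependent.map' W.subtype W.ker_subtype) ?_, ?_⟩
  · rw [hb]
    exact hW.disjoint
  · rw [Set.Sum.elim_range, Submodule.span_union, hb]
    exact hW.sup_eq_top

/-- `X ^ n` and `(X - a) ^ k` are coprime; a Bézout relation applied to `x`, which is killed by `(L
- a) ^ k`, exhibits a preimage under `L ^ n`. -/
theorem mem_range_pow_of_mem_maxGenEigenspace {L : Module.End ℂ V} {a : ℂ} (ha : a ≠ 0) {x : V}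
    (hx : x ∈ L.maxGenEigenspace a) (n : ℕ) : x ∈ LinearMap.range (L ^ n) := by
  obtain ⟨k, hk⟩ := (Module.End.mem_maxGenEigenspace _ _ _).1 hx
  have hcop : IsCoprime (Polynomial.X ^ n : Polynomial ℂ)
      ((Polynomial.X - Polynomial.C a) ^ k) := by
    refine IsCoprime.pow ?_
    have h1 := Polynomial.isCoprime_X_sub_C_of_isUnit_sub (a := (0 : ℂ)) (b := a)
      (by simpa using ha)
    simpa using h1
  obtain ⟨p, q, hpq⟩ := hcop
  have h1 := congrArg (fun P => Polynomial.aeval L P x) hpq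
  simp only [map_add, map_mul, map_pow, Polynomial.aeval_X, map_sub, Polynomial.aeval_C, map_one,
    LinearMap.add_apply, Module.End.mul_apply, Module.End.one_apply,
    Algebra.algebraMap_eq_smul_one, hk, map_zero, add_zero] at h1
  rw [← Module.End.mul_apply] at h1
  have hcomm : Polynomial.aeval L p * L ^ n = L ^ n * Polynomial.aeval L p := by
    simpa only [map_mul, map_pow, Polynomial.aeval_X] using
      congrArg (Polynomial.aeval L) (mul_comm p (Polynomial.X ^ n))
  rw [hcomm, Module.End.mul_apply] at h1
  exact ⟨_, h1⟩

theorem pow_finrank_apply_eq_zero [FiniteDimensional ℂ V] {L : Module.End ℂ V} {x : V}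
    (hx : x ∈ L.maxGenEigenspace 0) : (L ^ Module.finrank ℂ V) x = 0 := by
  rw [Module.End.maxGenEigenspace_eq_genEigenspace_finrank, Module.End.mem_genEigenspace_nat] at hx
  simpa using hx

/-- A vector of `range (L ^ n)` that is mapped by a power of `L` into a subspace on which `L` is
onto lies in that subspace. -/
theorem mem_of_pow_apply_mem [FiniteDimensional ℂ V] {L : Module.End ℂ V} {U : Submodule ℂ V}
    (hU : U ≤ U.map L) {x : V} (hx : x ∈ LinearMap.range (L ^ Module.finrank ℂ V)) {N : ℕ}
    (hN : (L ^ N) x ∈ U) : x ∈ U := by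
  have hUN : ∀ n, U ≤ U.map (L ^ n) := by
    intro n
    induction n with
    | zero => simp [Module.End.one_eq_id]
    | succ n ih =>
      refine hU.trans ?_
      rw [pow_succ', Module.End.mul_eq_comp, Submodule.map_comp]
      exact Submodule.map_mono ih
  -- `y ∈ U` has the same image as `x` under `L ^ N`. Both lie in the stable range, where `L` is
  -- injective, so they coincide.
  obtain ⟨y, hy, hxy⟩ := hUN N hN
  obtain ⟨y', -, rfl⟩ := hUN (Module.finrank ℂ V) hy
  obtain ⟨x', rfl⟩ := hx
  have h1 : x' - y' ∈ L.maxGenEigenspace 0 := by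
    rw [Module.End.mem_maxGenEigenspace]
    refine ⟨N + Module.finrank ℂ V, ?_⟩
    rw [zero_smul, sub_zero, pow_add, Module.End.mul_apply, map_sub, map_sub, hxy, sub_self]
  have h2 := pow_finrank_apply_eq_zero h1
  rw [map_sub, sub_eq_zero] at h2
  rwa [h2]

/-- The generalized eigenvectors of a basis with non-zero eigenvalue span the stable range. -/
theorem span_eq_range_pow_finrank [FiniteDimensional ℂ V] {L : Module.End ℂ V} {ι κ : Type*}
    {w : ι → V} {z : κ → V} (hw : ∀ i, w i ∈ LinearMap.range (L ^ Module.finrank ℂ V))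
    (hz : ∀ i, z i ∈ L.maxGenEigenspace 0) (hspan : Submodule.span ℂ (Set.range (Sum.elim w z)) = ⊤) :
    Submodule.span ℂ (Set.range w) = LinearMap.range (L ^ Module.finrank ℂ V) := by
  have hle : Submodule.span ℂ (Set.range w) ≤ LinearMap.range (L ^ Module.finrank ℂ V) := by
    rw [Submodule.span_le]
    rintro _ ⟨i, rfl⟩
    exact hw i
  refine le_antisymm hle fun x hx => ?_
  have hx' : x ∈ Submodule.span ℂ (Set.range w) ⊔ Submodule.span ℂ (Set.range z) := by
    rw [← Submodule.span_union, ← Set.Sum.elim_range, hspan]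
    trivial
  obtain ⟨a, ha, b, hb, rfl⟩ := Submodule.mem_sup.1 hx'
  have hbz : b ∈ L.maxGenEigenspace 0 := by
    refine (Submodule.span_le (p := L.maxGenEigenspace 0)).2 ?_ hb
    rintro _ ⟨i, rfl⟩
    exact hz i
  obtain ⟨c, hc⟩ : b ∈ LinearMap.range (L ^ Module.finrank ℂ V) := by
    simpa using Submodule.sub_mem _ hx (hle ha)
  have hcz : c ∈ L.maxGenEigenspace 0 := by
    rw [Module.End.mem_maxGenEigenspace]
    refine ⟨Module.finrank ℂ V + Module.finrank ℂ V, ?_⟩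
    rw [zero_smul, sub_zero, pow_add, Module.End.mul_apply, hc, pow_finrank_apply_eq_zero hbz]
  rw [← hc, pow_finrank_apply_eq_zero hcz, add_zero]
  exact ha

/-- If `L` acts on independent vectors modulo an invariant subspace by a matrix with `k`-th row
`μ k • e k + N k`, and the `k`-th vector is a generalized eigenvector for `μ k`, then `N` is
nilpotent. -/
theorem isNilpotent_of_mem_maxGenEigenspace {L : Module.End ℂ V} {U : Submodule ℂ V}
    (hU : U ≤ U.comap L) {e : ℕ} {μ : Fin e → ℂ} {v : Fin e → V} {N : Matrix (Fin e) (Fin e) ℂ}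
    (hli : LinearIndependent ℂ fun k => U.mkQ (v k)) (hv : ∀ k, v k ∈ L.maxGenEigenspace (μ k))
    (hN : ∀ k, L (v k) - (μ k • v k + ∑ l, N k l • v l) ∈ U) : IsNilpotent N := by
  classical
  let π : (Fin e → ℂ) →ₗ[ℂ] V ⧸ U := Fintype.linearCombination ℂ fun k => U.mkQ (v k)
  have hπe : ∀ k, π (Pi.single k 1) = U.mkQ (v k) := fun k => by
    simp [π, Fintype.linearCombination_apply_single]
  have hπ : Function.Injective π := by
    rwa [linearIndependent_iff_injective_fintypeLinearCombination] at hli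
  -- `S + Nᵀ` models the action of `L` modulo `U` on the span of the `v k`, and `S` is its
  -- semisimple part; the transpose appears because the rows of `N` hold the coefficients.
  let S : Module.End ℂ (Fin e → ℂ) := Matrix.toLin' (Matrix.diagonal μ)
  let T : Module.End ℂ (Fin e → ℂ) := S + Matrix.toLin' N.transpose
  have hS : ∀ k, S (Pi.single k 1) = μ k • Pi.single k 1 := fun k => by
    ext l
    rcases eq_or_ne l k with rfl | h <;> simp [S, Matrix.mulVec_diagonal, *]
  have hT : ∀ a, π (T a) = U.mapQ U L hU (π a) := by
    suffices h : π ∘ₗ T = U.mapQ U L hU ∘ₗ π from fun a => LinearMap.congr_fun h a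
    refine (Pi.basisFun ℂ (Fin e)).ext fun k => ?_
    rw [Pi.basisFun_apply, LinearMap.comp_apply, LinearMap.comp_apply, hπe,
      Submodule.mkQ_apply, Submodule.mapQ_apply, LinearMap.add_apply, hS, map_add, map_smul, hπe,
      (Submodule.Quotient.eq U).2 (hN k)]
    have h1 : Matrix.toLin' N.transpose (Pi.single k 1) = fun l => N k l := by
      ext l; simp
    rw [h1]
    simp only [π, Fintype.linearCombination_apply, ← Submodule.mkQ_apply, map_add, map_smul,
      map_sum]
  have hmem : ∀ k, (Pi.basisFun ℂ (Fin e)) k ∈ T.maxGenEigenspace (μ k) := by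
    intro k
    rw [Pi.basisFun_apply]
    refine mem_maxGenEigenspace_of_map_mem hT hπ ?_
    rw [hπe]
    exact map_mem_maxGenEigenspace (π := U.mkQ) (fun x => rfl) (hv k)
  have h2 := isNilpotent_sub_of_basis _ hmem (S := S) fun k => by rw [Pi.basisFun_apply, hS]
  rw [add_sub_cancel_left, Matrix.isNilpotent_toLin'_iff] at h2
  exact Matrix.isNilpotent_transpose_iff.1 h2

end LinearAlgebra

/-! ### Independence of the differentials and dimensions -/

theorem cotangentMap_pow (f : (Fin d → ℂ) → (Fin d → ℂ)) (n : ℕ) : cotangentMap f ^ n =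
    ((fderiv ℂ f 0 : (Fin d → ℂ) →ₗ[ℂ] (Fin d → ℂ)) ^ n).dualMap := by
  induction n with
  | zero => exact LinearMap.dualMap_id.symm
  | succ n ih => rw [pow_succ, pow_succ', ih]; rfl

theorem finrank_range_cotangentMap_pow (f : (Fin d → ℂ) → (Fin d → ℂ)) (n : ℕ) :
    Module.finrank ℂ (LinearMap.range (cotangentMap f ^ n)) = Module.finrank ℂ
      (LinearMap.range ((fderiv ℂ f 0 : (Fin d → ℂ) →ₗ[ℂ] (Fin d → ℂ)) ^ n)) := by
  rw [cotangentMap_pow]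
  exact LinearMap.finrank_range_dualMap_eq_finrank_range _

theorem finrank_dual (d : ℕ) : Module.finrank ℂ (Module.Dual ℂ (Fin d → ℂ)) = d := by
  rw [Subspace.dual_finrank_eq, Module.finrank_fin_fun]

namespace CriticalCoordinates

variable {hf : AnalyticAt ℂ f 0} {h0 : f 0 = 0} (cc : CriticalCoordinates hf h0)

/-- The span of the differentials of the periodic coordinates. -/
noncomputable def periodicSpan : Submodule ℂ (Module.Dual ℂ (Fin d → ℂ)) :=
  Submodule.span ℂ (Set.range fun i => differential d (cc.u i))

theorem cotangentMap_differential_u (i : Fin cc.r) : cotangentMap f (differential d (cc.u i)) =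
    cc.α i • differential d (cc.u (cc.σ⁻¹ i)) := by
  rw [← differential_pullback hf h0, ← map_smul]
  refine differential_congr (K := ⊤) le_top (mem_vanishingIdeal_top.2 ?_)
  filter_upwards [cc.u_map i] with x hx
  change (cc.u i).1 (f x) - cc.α i * (cc.u (cc.σ⁻¹ i)).1 x = 0
  rw [hx, sub_self]

theorem periodicSpan_le_comap : cc.periodicSpan ≤ cc.periodicSpan.comap (cotangentMap f) := by
  refine Submodule.span_le.2 ?_
  rintro _ ⟨i, rfl⟩
  change cotangentMap f (differential d (cc.u i)) ∈ cc.periodicSpan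
  rw [cotangentMap_differential_u]
  exact Submodule.smul_mem _ _ (Submodule.subset_span ⟨_, rfl⟩)

theorem periodicSpan_le_map : cc.periodicSpan ≤ cc.periodicSpan.map (cotangentMap f) := by
  refine Submodule.span_le.2 ?_
  rintro _ ⟨i, rfl⟩
  refine ⟨(cc.α (cc.σ i))⁻¹ • differential d (cc.u (cc.σ i)),
    Submodule.smul_mem _ _ (Submodule.subset_span ⟨_, rfl⟩), ?_⟩
  rw [map_smul, cotangentMap_differential_u, smul_smul, inv_mul_cancel₀ (cc.α_ne_zero _), one_smul]
  exact congrArg (fun i => differential d (cc.u i)) (cc.σ.symm_apply_apply i)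

theorem differential_u_mem_range_pow (n : ℕ) (i : Fin cc.r) :
    differential d (cc.u i) ∈ LinearMap.range (cotangentMap f ^ n) := by
  induction n generalizing i with
  | zero => exact ⟨_, rfl⟩
  | succ n ih =>
    obtain ⟨x, hx⟩ := ih (cc.σ i)
    refine ⟨(cc.α (cc.σ i))⁻¹ • x, ?_⟩
    rw [pow_succ', Module.End.mul_apply, map_smul, hx, map_smul, cotangentMap_differential_u,
      smul_smul, inv_mul_cancel₀ (cc.α_ne_zero _), one_smul]
    exact congrArg (fun i => differential d (cc.u i)) (cc.σ.symm_apply_apply i)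

/-- A covector of the stable range that is a combination of the `dy` lies in the span of
the `du`. -/
theorem exists_pow_mem_periodicSpan {x : Module.Dual ℂ (Fin d → ℂ)}
    (hx : x ∈ Submodule.span ℂ (Set.range fun j => differential d (cc.y j))) :
    ∃ N, (cotangentMap f ^ N) x ∈ cc.periodicSpan := by
  choose n hn using cc.pow_mem_span
  refine ⟨∑ j, n j, ?_⟩
  have hU : ∀ m, ∀ x ∈ cc.periodicSpan, (cotangentMap f ^ m) x ∈ cc.periodicSpan := by
    intro m
    induction m with
    | zero => exact fun x hx => hx
    | succ m ih =>
      intro x hx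
      rw [pow_succ, Module.End.mul_apply]
      exact ih _ (cc.periodicSpan_le_comap hx)
  refine (Submodule.span_le (p := cc.periodicSpan.comap (cotangentMap f ^ ∑ j, n j))).2 ?_ hx
  rintro _ ⟨j, rfl⟩
  change (cotangentMap f ^ ∑ j, n j) (differential d (cc.y j)) ∈ cc.periodicSpan
  rw [← Finset.sum_erase_add _ _ (Finset.mem_univ j), pow_add, Module.End.mul_apply]
  exact hU _ _ (hn j)

namespace ResonantCoordinates

variable {cc} (rc : cc.ResonantCoordinates)

/-- The differentials of the coordinates `u` and `v`. -/
noncomputable def duv : Fin cc.r ⊕ Fin rc.e → Module.Dual ℂ (Fin d → ℂ) :=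
  Sum.elim (fun i => differential d (cc.u i)) fun k => differential d (rc.v k)

theorem linearIndependent_duv : LinearIndependent ℂ rc.duv :=
  rc.linearIndependent.comp Sum.inl Sum.inl_injective

/-- The `du` are in the range of every power because the cotangent map permutes them up to non-zero
scalars, the `dv` because their eigenvalues are non-zero; the remaining basis vectors are nilpotent
directions. -/
theorem span_duv : Submodule.span ℂ (Set.range rc.duv) =
    LinearMap.range (cotangentMap f ^ d) := by
  have h1 := span_eq_range_pow_finrank (L := cotangentMap f) (w := rc.duv) (z := rc.w) ?_ rc.w_mem
    rc.span_eq_top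
  · rwa [finrank_dual] at h1
  · rintro (i | k)
    · exact cc.differential_u_mem_range_pow _ i
    · exact mem_range_pow_of_mem_maxGenEigenspace (rc.μ_ne_zero k) (rc.differential_v_mem k) _

theorem card_eq_finrank : cc.r + rc.e = Module.finrank ℂ
    (LinearMap.range ((fderiv ℂ f 0 : (Fin d → ℂ) →ₗ[ℂ] (Fin d → ℂ)) ^ d)) := by
  rw [← finrank_range_cotangentMap_pow, ← rc.span_duv,
    finrank_span_eq_card rc.linearIndependent_duv]
  simp

/-- A covector in both spans lies in the stable range, and a power of the cotangent map sends it
into the span of the `du`. That span is mapped onto itself, so the covector already belonged to it,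
and the `du` are independent of the `dy`. -/
theorem linearIndependent_duv_dy : LinearIndependent ℂ
    (Sum.elim rc.duv fun j => differential d (cc.y j)) := by
  obtain ⟨-, hy, hdisj⟩ := linearIndependent_sum.1 cc.linearIndependent
  refine LinearIndependent.sum_type rc.linearIndependent_duv hy ?_
  rw [Submodule.disjoint_def] at hdisj ⊢
  intro x hx hxy
  refine hdisj x ?_ hxy
  obtain ⟨N, hN⟩ := cc.exists_pow_mem_periodicSpan hxy
  rw [rc.span_duv] at hx
  refine mem_of_pow_apply_mem cc.periodicSpan_le_map ?_ hN
  rwa [finrank_dual]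

/-- Vectors annihilated by all `du` and `dv` are annihilated by the `d`-th power of the linear part
of `f`. -/
theorem pow_apply_eq_zero {w : Fin d → ℂ} (hw : ∀ i, rc.duv i w = 0) :
    ((fderiv ℂ f 0 : (Fin d → ℂ) →ₗ[ℂ] (Fin d → ℂ)) ^ d) w = 0 := by
  refine (Module.forall_dual_apply_eq_zero_iff ℂ _).1 fun ℓ => ?_
  have h1 : (cotangentMap f ^ d) ℓ ∈ Submodule.span ℂ (Set.range rc.duv) := by
    rw [rc.span_duv]
    exact ⟨ℓ, rfl⟩
  have h2 : ∀ m ∈ Submodule.span ℂ (Set.range rc.duv), m w = 0 := by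
    intro m hm
    refine (Submodule.span_le (p := LinearMap.ker (LinearMap.applyₗ (R := ℂ) (M₂ := ℂ) w))).2 ?_ hm
    rintro _ ⟨i, rfl⟩
    exact hw i
  have h3 := h2 _ h1
  rwa [cotangentMap_pow] at h3

/-- Modulo the span of the `du`, the cotangent map acts on the `dv` as the diagonal of `μ` plus this
matrix, while each `dv k` is a generalized eigenvector for `μ k`. -/
theorem isNilpotent_linear_part : IsNilpotent
    (Matrix.of fun k l : Fin rc.e => (rc.ρ k).coeff (Finsupp.single (Sum.inr l) 1)) := by
  refine isNilpotent_of_mem_maxGenEigenspace (v := fun k => differential d (rc.v k))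
    cc.periodicSpan_le_comap ?_ rc.differential_v_mem fun k => ?_
  · obtain ⟨-, hv, hdisj⟩ := linearIndependent_sum.1 rc.linearIndependent_duv
    refine hv.map ?_
    rw [Submodule.ker_mkQ]
    exact hdisj.symm
  · let c : Fin cc.r ⊕ Fin rc.e → analyticAlgebra d := Sum.elim cc.u rc.v
    have hc : ∀ i, (c i).1 0 = 0 := by
      rintro (i | i)
      · exact cc.u_zero i
      · exact rc.v_zero i
    have h1 : differential d (pullback hf h0 (rc.v k)) =
        differential d (rc.μ k • rc.v k + MvPolynomial.aeval c (rc.ρ k)) := by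
      refine differential_congr (K := ⊤) le_top (mem_vanishingIdeal_top.2 ?_)
      filter_upwards [rc.v_map k] with x hx
      change (rc.v k).1 (f x) - (rc.μ k * (rc.v k).1 x +
        (MvPolynomial.aeval c (rc.ρ k)).1 x) = 0
      rw [hx, aeval_apply, show (fun i => (c i).1 x) =
        Sum.elim (fun i => (cc.u i).1 x) fun k => (rc.v k).1 x from
        funext fun i => by rcases i with i | i <;> rfl, sub_self]
    rw [differential_pullback, map_add, map_smul, differential_aeval hc, Fintype.sum_sum_type] at h1
    have h2 : cotangentMap f (differential d (rc.v k)) - (rc.μ k • differential d (rc.v k) +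
        ∑ l, (rc.ρ k).coeff (Finsupp.single (Sum.inr l) 1) • differential d (rc.v l)) =
        ∑ i, (rc.ρ k).coeff (Finsupp.single (Sum.inl i) 1) • differential d (cc.u i) := by
      rw [h1]
      simp only [c, Sum.elim_inl, Sum.elim_inr]
      abel
    simp only [Matrix.of_apply]
    rw [h2]
    exact Submodule.sum_mem _ fun i _ => Submodule.smul_mem _ _ (Submodule.subset_span ⟨i, rfl⟩)

end ResonantCoordinates

end CriticalCoordinates

/-! ### The coordinate map and its fibre -/

section CoordinateMap

variable {r e p t : ℕ} (u : Fin r → analyticAlgebra d) (v : Fin e → analyticAlgebra d)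
  (y : Fin p → analyticAlgebra d) (z : Fin t → analyticAlgebra d)

/-- The map with components `u`, `v`, `y`, `z`. -/
def coordinateMap (x : Fin d → ℂ) : Coord r e p t :=
  (fun i => (u i).1 x, fun k => (v k).1 x, fun j => (y j).1 x, fun l => (z l).1 x)

variable {u v y z}

theorem analyticAt_coordinateMap : AnalyticAt ℂ (coordinateMap u v y z) 0 :=
  (AnalyticAt.pi fun i => (u i).2).prod ((AnalyticAt.pi fun k => (v k).2).prod
    ((AnalyticAt.pi fun j => (y j).2).prod (AnalyticAt.pi fun l => (z l).2)))

theorem hasFDerivAt_coordinateMap : HasFDerivAt (coordinateMap u v y z)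
    ((ContinuousLinearMap.pi fun i => LinearMap.toContinuousLinearMap (differential d (u i))).prod
      ((ContinuousLinearMap.pi fun k => LinearMap.toContinuousLinearMap (differential d (v k))).prod
      ((ContinuousLinearMap.pi fun j => LinearMap.toContinuousLinearMap (differential d (y j))).prod
      (ContinuousLinearMap.pi fun l => LinearMap.toContinuousLinearMap (differential d (z l)))))) 0 :=
  (hasFDerivAt_pi.2 fun i => hasFDerivAt_differential (u i)).prodMk
    ((hasFDerivAt_pi.2 fun i => hasFDerivAt_differential (v i)).prodMk
    ((hasFDerivAt_pi.2 fun i => hasFDerivAt_differential (y i)).prodMk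
    (hasFDerivAt_pi.2 fun i => hasFDerivAt_differential (z i))))

theorem isBiholomorphicGerm_coordinateMap (hu : ∀ i, (u i).1 0 = 0) (hv : ∀ k, (v k).1 0 = 0)
    (hy : ∀ j, (y j).1 0 = 0) (hz : ∀ l, (z l).1 0 = 0) (hd : r + e + p + t = d)
    (hspan : Submodule.span ℂ (Set.range (Sum.elim (Sum.elim (Sum.elim
      (fun i => differential d (u i)) fun k => differential d (v k)) fun j => differential d (y j))
      fun l => differential d (z l))) = ⊤) : IsBiholomorphicGerm (coordinateMap u v y z) := by
  refine isBiholomorphicGerm_of_finrank analyticAt_coordinateMap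
    (Prod.ext (funext hu) (Prod.ext (funext hv) (Prod.ext (funext hy) (funext hz)))) ?_
    fun w hw => ?_
  · simp only [Module.finrank_prod, Module.finrank_fin_fun]
    omega
  · rw [hasFDerivAt_coordinateMap.fderiv] at hw
    refine eq_zero_of_forall_mem_span hspan ?_
    rintro _ ⟨((i | i) | i) | i, rfl⟩
    · exact congrFun (congrArg Prod.fst hw) i
    · exact congrFun (congrArg (fun X => X.2.1) hw) i
    · exact congrFun (congrArg (fun X => X.2.2.1) hw) i
    · exact congrFun (congrArg (fun X => X.2.2.2) hw) i

end CoordinateMap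

/-- The inclusion of the fibre `{u = v = y = 0}`. -/
noncomputable def fibreInclusion (r e p t : ℕ) : (Fin t → ℂ) →L[ℂ] Coord r e p t :=
  (ContinuousLinearMap.inr ℂ _ _).comp ((ContinuousLinearMap.inr ℂ _ _).comp
    (ContinuousLinearMap.inr ℂ _ _))

/-- If `f` maps a fibre parametrized by `J` to itself by a map with differential `N`, and a power of
the differential of `f` vanishes on the fibre, then `N` is nilpotent. -/
theorem isNilpotent_of_semiconj {E G : Type*} [NormedAddCommGroup E] [NormedSpace ℂ E]
    [NormedAddCommGroup G] [NormedSpace ℂ G] {A : E →L[ℂ] E} {N : G →L[ℂ] G} {J : G →L[ℂ] E}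
    (hJ : Function.Injective J) (hAJ : ∀ w, A (J w) = J (N w)) {n : ℕ}
    (hn : ∀ w, ((A : E →ₗ[ℂ] E) ^ n) (J w) = 0) : IsNilpotent N := by
  have h1 : ∀ m w, ((A : E →ₗ[ℂ] E) ^ m) (J w) = J ((N ^ m) w) := by
    intro m
    induction m with
    | zero => exact fun w => rfl
    | succ m ih =>
      intro w
      rw [pow_succ, pow_succ, Module.End.mul_apply]
      refine Eq.trans ?_ (ih (N w))
      rw [← hAJ]
      rfl
  refine ⟨n, ContinuousLinearMap.ext fun w => hJ ?_⟩
  rw [← h1, hn]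
  exact (map_zero J).symm

end RigidGerm

/-! ### Assembly of the normal form -/

open RigidGerm in
theorem mainTheorem3 (d : ℕ) (f : (Fin d → ℂ) → (Fin d → ℂ))
    (hf : RigidGerm.IsContractingRigidGerm f) :
    ∃ (r e p t : ℕ) (α ξ : Fin r → ℂ) (μ : Fin e → ℂ) (β : Fin p → ℂ)
      (B : Matrix (Fin r) (Fin r) ℕ) (C : Matrix (Fin r) (Fin p) ℕ) (D : Matrix (Fin p) (Fin p) ℕ)
      (ρ : Fin e → MvPolynomial (Fin r ⊕ Fin e) ℂ)
      (g : RigidGerm.Coord r e p t → (Fin p → ℂ)) (h : RigidGerm.Coord r e p t → (Fin t → ℂ)),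
      -- the dimensions: `s = r + e` is the number of non-zero eigenvalues of `df₀`
      r + e + p + t = d ∧
      r + e = Module.finrank ℂ
        (LinearMap.range ((fderiv ℂ f 0 : (Fin d → ℂ) →ₗ[ℂ] (Fin d → ℂ)) ^ d)) ∧
      -- the coefficients
      (∀ i, α i ≠ 0) ∧ (∀ k, 0 < ‖μ k‖ ∧ ‖μ k‖ < 1) ∧ (∀ j, β j ≠ 0) ∧
      -- `u` gives the periodic components, `y` the non-periodic ones
      RigidGerm.IsPermutationMatrix B ∧
      (∀ (j : Fin p) (m : ℕ), 1 ≤ m →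
        (RigidGerm.internalAction B C D ^ m).col (Sum.inr j) ≠ Pi.single (Sum.inr j) 1) ∧
      -- the germs `ρ`, `g`, `h`
      (∀ k, MvPolynomial.constantCoeff (ρ k) = 0) ∧
      AnalyticAt ℂ g 0 ∧ g 0 = 0 ∧ AnalyticAt ℂ h 0 ∧ h 0 = 0 ∧
      -- the conjugacy and the generalized critical set of the normal form
      RigidGerm.AnalyticallyConjugated f (RigidGerm.normalForm α μ β B C D ρ g h) ∧
      (∀ᶠ x : RigidGerm.Coord r e p t in 𝓝 0,
        x ∈ RigidGerm.generalizedCriticalSet (RigidGerm.normalForm α μ β B C D ρ g h) ↔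
          (∏ i, x.1 i) * (∏ j, x.2.2.1 j) = 0) ∧
      -- the linear part
      (∀ k, Module.End.HasEigenvalue
        (fderiv ℂ f 0 : (Fin d → ℂ) →ₗ[ℂ] (Fin d → ℂ)) (μ k)) ∧
      IsNilpotent (fderiv ℂ (fun z : Fin t → ℂ => h (0, 0, 0, z)) 0) ∧
      IsNilpotent (Matrix.of fun k l : Fin e => (ρ k).coeff (Finsupp.single (Sum.inr l) 1)) ∧
      -- `ρ` has only primary resonant monomials
      RigidGerm.IsIterateEigenvalues α B ξ ∧ (∀ i, 0 < ‖ξ i‖ ∧ ‖ξ i‖ < 1) ∧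
      (∀ k, ∀ n ∈ (ρ k).support, RigidGerm.IsPrimaryResonant (orderOf B) ξ μ k n) := by
  have hfan := hf.analyticAt
  have h0 := hf.map_zero
  obtain ⟨κ₀, κ, R, hc⟩ := exists_contractsOn hfan.differentiableAt.hasFDerivAt h0 hf.contracting
  obtain ⟨cc⟩ := exists_criticalCoordinates hfan h0 hc hf.rigid
  obtain ⟨rc⟩ := cc.exists_resonantCoordinates hc hf.contracting
  -- Nothing is required of the last coordinates beyond completing the basis, so linear functionals
  -- suffice.
  obtain ⟨t, z, hli, hspan⟩ := exists_complementary_family rc.linearIndependent_duv_dy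
  have hd : cc.r + rc.e + cc.p + t = d := by
    have h1 := Module.finrank_eq_card_basis (Module.Basis.mk hli hspan.ge)
    rw [finrank_dual] at h1
    simpa using h1.symm
  let Φ := coordinateMap cc.u rc.v cc.y fun l => ofDual (z l)
  have hΦ : IsBiholomorphicGerm Φ := by
    refine isBiholomorphicGerm_coordinateMap cc.u_zero rc.v_zero cc.y_zero
      (fun l => map_zero (z l)) hd ?_
    simpa only [differential_ofDual] using! hspan
  obtain ⟨Ψ, hΨ, hΨΦ, hΦΨ⟩ := hΦ.exists_inverse
  let g : Coord cc.r rc.e cc.p t → (Fin cc.p → ℂ) := fun X j => (cc.g j).1 (Ψ X)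
  let h : Coord cc.r rc.e cc.p t → (Fin t → ℂ) := fun X l => z l (f (Ψ X))
  let F := normalForm cc.α rc.μ cc.β (cc.σ.permMatrix ℕ) cc.C cc.D rc.ρ g h
  have hh : AnalyticAt ℂ h 0 := AnalyticAt.pi fun l =>
    AnalyticAt.comp ((LinearMap.toContinuousLinearMap (z l)).analyticAt (f (Ψ 0)))
      (AnalyticAt.comp (by rwa [hΨ.map_zero]) hΨ.analyticAt)
  have hconj : ∀ᶠ x in 𝓝 0, Φ (f x) = F (Φ x) := by
    filter_upwards [eventually_all.2 cc.u_map, eventually_all.2 rc.v_map, eventually_all.2 cc.y_map,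
      hΨΦ] with x hu hv hy hx
    refine Prod.ext (funext fun i => ?_) (Prod.ext (funext fun k => hv k)
      (Prod.ext (funext fun j => ?_) (funext fun l => ?_)))
    · change (cc.u i).1 (f x) = cc.α i * matPow (fun i => (cc.u i).1 x) (cc.σ.permMatrix ℕ) i
      rw [hu i, matPow_permMatrix]
    · refine (hy j).trans ?_
      change _ = _ * (1 + (cc.g j).1 (Ψ (Φ x)))
      rw [hx]
      rfl
    · change z l (f x) = z l (f (Ψ (Φ x)))
      rw [hx]
  have hft : Tendsto f (𝓝 0) (𝓝 0) := by simpa [h0] using hfan.continuousAt.tendsto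
  have hF : AnalyticAt ℂ F 0 := by
    -- `F` inherits analyticity from the conjugacy, with no check of its components.
    have h1 : AnalyticAt ℂ (Φ ∘ f ∘ Ψ) 0 := by
      refine AnalyticAt.comp ?_ (AnalyticAt.comp (by rwa [hΨ.map_zero]) hΨ.analyticAt)
      rw [Function.comp_apply, hΨ.map_zero, h0]
      exact hΦ.analyticAt
    refine h1.congr ?_
    filter_upwards [hΨ.tendsto.eventually hconj, hΦΨ] with X hX hX'
    rw [Function.comp_apply, Function.comp_apply, hX, hX']
  have hcrit : ∀ᶠ X in 𝓝 0, X ∈ generalizedCriticalSet F ↔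
      (∏ i, X.1 i) * (∏ j, X.2.2.1 j) = 0 := by
    filter_upwards [hΨ.tendsto.eventually
      (eventually_mem_generalizedCriticalSet_iff hfan h0 hc hF hΦ hconj),
      hΨ.tendsto.eventually cc.critical, hΦΨ] with X h1 h2 h3
    rw [h3] at h1
    have h4 : ∀ i, (cc.u i).1 (Ψ X) = X.1 i := congrFun (congrArg Prod.fst h3)
    have h5 : ∀ j, (cc.y j).1 (Ψ X) = X.2.2.1 j := congrFun (congrArg (fun X => X.2.2.1) h3)
    simp only [← h1, h2, h4, h5]
  have hh0 : h 0 = 0 := funext fun l => by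
    change z l (f (Ψ 0)) = 0
    rw [hΨ.map_zero, h0, map_zero]
  have hnil : IsNilpotent (fderiv ℂ (fun z : Fin t → ℂ => h (0, 0, 0, z)) 0) := by
    -- The map `w ↦ dΨ (ι w)` parametrizes the common kernel of the `du`, `dv` and `dy`. There `df₀`
    -- is conjugate to the linear part of `h`, and its `d`-th power is zero.
    let ι := fibreInclusion cc.r rc.e cc.p t
    have hιt : Tendsto ι (𝓝 0) (𝓝 0) := by simpa using ι.continuous.tendsto 0
    have hΨd : HasFDerivAt Ψ (fderiv ℂ Ψ 0) (ι 0) := by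
      rw [map_zero]
      exact hΨ.analyticAt.differentiableAt.hasFDerivAt
    have hJ : HasFDerivAt (fun w => Ψ (ι w)) ((fderiv ℂ Ψ 0).comp ι) 0 :=
      hΨd.comp 0 ι.hasFDerivAt
    have hJ0 : Ψ (ι 0) = 0 := by rw [map_zero, hΨ.map_zero]
    have hΦJ : ∀ w, fderiv ℂ Φ 0 ((fderiv ℂ Ψ 0).comp ι w) = ι w := by
      have h1 : HasFDerivAt Φ (fderiv ℂ Φ 0) (Ψ (ι 0)) := by
        rw [hJ0]
        exact hΦ.analyticAt.differentiableAt.hasFDerivAt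
      have h2 := (HasFDerivAt.comp (f := fun w => Ψ (ι w)) 0 h1 hJ).unique
        (ι.hasFDerivAt.congr_of_eventuallyEq (hιt.eventually hΦΨ))
      exact fun w => congrArg (fun B => B w) h2
    have hN : HasFDerivAt (fun z : Fin t → ℂ => h (0, 0, 0, z))
        (fderiv ℂ (fun z : Fin t → ℂ => h (0, 0, 0, z)) 0) 0 := by
      refine DifferentiableAt.hasFDerivAt ?_
      refine DifferentiableAt.comp (g := h) (f := ι) 0 ?_ ι.differentiableAt
      rw [map_zero]
      exact hh.differentiableAt
    have hF0 : ∀ w, F (ι w) = ι (h (ι w)) := by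
      intro w
      refine Prod.ext (funext fun i => ?_) (Prod.ext (funext fun k => ?_)
        (Prod.ext (funext fun j => ?_) rfl))
      · change cc.α i * matPow 0 (cc.σ.permMatrix ℕ) i = 0
        rw [matPow_permMatrix, Pi.zero_apply, mul_zero]
      · change rc.μ k * 0 + MvPolynomial.eval (Sum.elim 0 0) (rc.ρ k) = 0
        rw [mul_zero, zero_add, ← rc.constantCoeff_ρ k, ← MvPolynomial.eval_zero,
          show (Sum.elim 0 0 : Fin cc.r ⊕ Fin rc.e → ℂ) = 0 from
            funext fun i => by rcases i with i | i <;> rfl]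
      · change cc.β j * matPow 0 cc.C j * matPow 0 cc.D j * (1 + g (ι w) j) = 0
        -- The transformation law of `y j` at the origin already says that this monomial vanishes at
        -- `0`, so the exponents need no inspection.
        have h1 := (cc.y_map j).self_of_nhds
        simp only [h0, cc.y_zero, cc.u_zero, cc.g_zero, add_zero, mul_one] at h1
        rw [show cc.β j * matPow 0 cc.C j * matPow 0 cc.D j = 0 from h1.symm, zero_mul]
    have hsemi : ∀ᶠ w in 𝓝 0, f (Ψ (ι w)) = Ψ (ι (h (0, 0, 0, w))) := by
      filter_upwards [hιt.eventually (hΨ.tendsto.eventually hconj), hιt.eventually hΦΨ,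
        hιt.eventually (hΨ.tendsto.eventually (hft.eventually hΨΦ))] with w h1 h2 h3
      rw [h2, hF0] at h1
      rw [← h3, h1]
      rfl
    refine isNilpotent_of_semiconj (A := fderiv ℂ f 0) (J := (fderiv ℂ Ψ 0).comp ι) (n := d)
      (fun w w' hw => ?_) (fun w => ?_) fun w => ?_
    · have h1 := hΦJ w
      rw [hw, hΦJ] at h1
      exact (congrArg (fun X => X.2.2.2) h1).symm
    · have h1 : HasFDerivAt f (fderiv ℂ f 0) (Ψ (ι 0)) := by
        rw [hJ0]
        exact hfan.differentiableAt.hasFDerivAt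
      have h2 : HasFDerivAt (fun w => Ψ (ι w)) ((fderiv ℂ Ψ 0).comp ι) (h (0, 0, 0, 0)) := by
        rwa [show h (0, 0, 0, 0) = 0 from hh0]
      have h3 := (HasFDerivAt.comp (f := fun w => Ψ (ι w)) 0 h1 hJ).unique
        ((HasFDerivAt.comp (f := fun w => h (0, 0, 0, w)) 0 h2 hN).congr_of_eventuallyEq hsemi)
      exact congrArg (fun B => B w) h3
    · refine rc.pow_apply_eq_zero fun i => ?_
      have h1 := hΦJ w
      rw [hasFDerivAt_coordinateMap.fderiv] at h1
      rcases i with i | k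
      · exact congrFun (congrArg Prod.fst h1) i
      · exact congrFun (congrArg (fun X => X.2.1) h1) k
  refine ⟨cc.r, rc.e, cc.p, t, cc.α, cc.ξ, rc.μ, cc.β, cc.σ.permMatrix ℕ, cc.C, cc.D, rc.ρ, g, h,
    hd, rc.card_eq_finrank, cc.α_ne_zero,
    fun k => ⟨norm_pos_iff.2 (rc.μ_ne_zero k), rc.norm_μ_lt_one k⟩, cc.β_ne_zero, ⟨cc.σ, rfl⟩,
    cc.not_periodic, rc.constantCoeff_ρ, ?_, ?_, hh, hh0, ⟨Φ, hΦ, hconj⟩, hcrit, rc.hasEigenvalue,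
    hnil, rc.isNilpotent_linear_part, isIterateEigenvalues_permMatrix _ _,
    fun i => ⟨norm_pos_iff.2 (cc.ξ_ne_zero i), cc.norm_ξ_lt_one hc i⟩, rc.resonant⟩
  · exact AnalyticAt.pi fun j => AnalyticAt.comp (by rw [hΨ.map_zero]; exact (cc.g j).2) hΨ.analyticAt
  · funext j
    change (cc.g j).1 (Ψ 0) = 0
    rw [hΨ.map_zero, cc.g_zero]
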